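/- All graphs are finite and simple; a straight-line planar drawing of a connected graph $G$ maps the vertices to distinct points of the plane and the edges to internally disjoint segments. Two such drawings are equivalent if they have the same clockwise order of the edges around each vertex and the same outer face; a plane graph is a connected graph with an equivalence class of drawings. A vertex is external if it is incident to the outer face, and internal otherwise. A subgraph of a plane graph is regarded as a plane graph by deleting everything else from the drawing. A drawing is convex if at each vertex every angle in an internal face is at most $\pi$ and every angle in the outer face is at least $\pi$; a convex graph is a plane graph whose outer face is delimited by a simple cycle and which has a convex drawing in its class. A plane graph $H$ is internally triconnected if it is biconnected and adding a new vertex in its outer face, adjacent to all external vertices, yields a triconnected graph. Lemma. Let $G$ be a convex graph and let $C$ be the simple cycle delimiting its outer face. There exists a sequence $G_1,\dots,G_\ell$ of graphs such that: (i) $G_1=G$; (ii) $G_\ell=C$; (iii) for each $1\le i\le \ell$, $G_i$ is a subgraph of $G$ and is, as a plane graph, a subdivision of a simple internally triconnected plane graph $H_i$ (whose edges may be drawn as simple arcs); (iv) for each $1\le i<\ell$, $G_{i+1}$ is obtained from $G_i$ either - by deleting the edges and the internal vertices of a path $(u_1,\dots,u_k)$, $k\ge 2$, of $G_i$, where $u_2,\dots,u_{k-1}$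 are internal vertices of $G_i$ of degree $2$ in $G_i$; or - by deleting an internal vertex $u$ of $G_i$ of degree $3$ in $G_i$, as well as the edges and the internal vertices of three paths $P_1,P_2,P_3$ of $G_i$ connecting $u$ with three vertices of $C$, where $P_1,P_2,P_3$ are vertex-disjoint except at $u$ and their internal vertices are internal vertices of $G_i$ of degree $2$ in $G_i$. -/

import Mathlib

open Set Filter Topology

universe u

/-- A planar drawing of a simple graph `G`: vertices are distinct points of the plane `ℂ`, each edge
is a simple arc joining its end-vertices, no vertex lies in the interior of an edge, and two
distinct edges meet only at vertices. (The value of `arc` at pairs that are not edges is never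
used.) -/
structure PlaneDrawing {V : Type u} (G : SimpleGraph V) where
  pos : V → ℂ
  arc : Sym2 V → Set ℂ
  pos_injective : Function.Injective pos
  isArc : ∀ u v, G.Adj u v →
    ∃ γ : Path (pos u) (pos v), Function.Injective γ ∧ Set.range γ = arc s(u, v)
  vertex_of_mem_arc : ∀ u v w, G.Adj u v → pos w ∈ arc s(u, v) → w = u ∨ w = v
  arc_inter_arc : ∀ e ∈ G.edgeSet, ∀ f ∈ G.edgeSet, e ≠ f → arc e ∩ arc f ⊆ Set.range pos

namespace PlaneDrawing

variable {V : Type u} {G : SimpleGraph V}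

/-! ### Faces -/

/-- The set of points of the plane covered by the drawing. -/
def support (Γ : PlaneDrawing G) : Set ℂ :=
  Set.range Γ.pos ∪ ⋃ e ∈ G.edgeSet, Γ.arc e

/-- The faces: the connected components of the complement of the drawing. -/
def faces (Γ : PlaneDrawing G) : Set (Set ℂ) :=
  {f | ∃ z ∈ Γ.supportᶜ, f = connectedComponentIn Γ.supportᶜ z}

/-- The outer face: the unbounded one. -/
def outerFace (Γ : PlaneDrawing G) : Set ℂ :=
  {z | z ∈ Γ.supportᶜ ∧ ¬ Bornology.IsBounded (connectedComponentIn Γ.supportᶜ z)}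

/-- A vertex is external if it is incident to the outer face; it is internal otherwise. -/
def External (Γ : PlaneDrawing G) (v : V) : Prop :=
  Γ.pos v ∈ closure Γ.outerFace

/-- The subgraph of `G` delimiting the outer face: all vertices and all edges that are incident to
the outer face. -/
def outerBoundary (Γ : PlaneDrawing G) : G.Subgraph where
  verts := {v | Γ.External v}
  Adj v w := G.Adj v w ∧ Γ.arc s(v, w) ⊆ closure Γ.outerFace
  adj_sub h := h.1
  edge_vert := by
    rintro v w ⟨h, hs⟩
    obtain ⟨γ, -, hγ⟩ := Γ.isArc v w h
    exact hs (hγ ▸ ⟨0, γ.source⟩)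
  symm := ⟨by
    rintro v w ⟨h, hs⟩
    exact ⟨h.symm, by rwa [Sym2.eq_swap]⟩⟩

/-- The outer face is delimited by a simple cycle. -/
def OuterFaceIsCycle (Γ : PlaneDrawing G) : Prop :=
  ∃ (v : V) (c : G.Walk v v), c.IsCycle ∧ c.toSubgraph = Γ.outerBoundary

/-- A subgraph of a plane graph is regarded as a plane graph, by deleting everything else. -/
def restrict (Γ : PlaneDrawing G) (S : G.Subgraph) : PlaneDrawing S.coe where
  pos v := Γ.pos v
  arc e := Γ.arc (e.map Subtype.val)
  pos_injective := Γ.pos_injective.comp Subtype.val_injective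
  isArc u v h := Γ.isArc u v h.adj_sub
  vertex_of_mem_arc u v w h hw := by
    simpa only [Subtype.ext_iff] using Γ.vertex_of_mem_arc u v w h.adj_sub hw
  arc_inter_arc := by
    intro e he f hf hne z hz
    have key : ∀ e ∈ S.coe.edgeSet, e.map Subtype.val ∈ G.edgeSet := by
      intro e
      induction e using Sym2.ind with
      | _ a b => exact fun h => S.adj_sub h
    obtain ⟨w, rfl⟩ := Γ.arc_inter_arc _ (key e he) _ (key f hf)
      (fun h => hne (Sym2.map.injective Subtype.val_injective h)) hz
    induction e using Sym2.ind with
    | _ a b =>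
      rcases Γ.vertex_of_mem_arc a b w (key _ he) hz.1 with rfl | rfl
      · exact ⟨a, rfl⟩
      · exact ⟨b, rfl⟩

/-! ### Straight-line and convex drawings -/

/-- Every edge is drawn as a straight-line segment. -/
def IsStraightLine (Γ : PlaneDrawing G) : Prop :=
  ∀ u v, G.Adj u v → Γ.arc s(u, v) = segment ℝ (Γ.pos u) (Γ.pos v)

/-- In a straight-line drawing, the counterclockwise angle at `v` from the edge `(v, a)` to the edge
`(v, b)`, in `(0, 2π]`; in particular it is `2π` if `a = b`. -/
noncomputable def angle (Γ : PlaneDrawing G) (v a b : V) : ℝ :=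
  toIocMod Real.two_pi_pos 0 (Complex.arg ((Γ.pos b - Γ.pos v) / (Γ.pos a - Γ.pos v)))

/-- The edge `(v, b)` is the one that follows `(v, a)` counterclockwise around `v` (with `b = a` if
`v` has degree 1). Equivalently, the region between `(v, a)` and `(v, b)` close to `v` is a corner
at `v` of some face. -/
def NextCCW (Γ : PlaneDrawing G) (v a b : V) : Prop :=
  G.Adj v a ∧ G.Adj v b ∧ ∀ c, G.Adj v c → Γ.angle v a b ≤ Γ.angle v a c

/-- The corner at `v` counterclockwise from `(v, a)` to `(v, b)` belongs to `f`: the points on its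
bisector that are close to `v` lie in `f`. -/
def CornerIn (Γ : PlaneDrawing G) (v a b : V) (f : Set ℂ) : Prop :=
  ∀ᶠ ε : ℝ in 𝓝[>] 0,
    Γ.pos v + ε * ((Γ.pos a - Γ.pos v) * Complex.exp ((Γ.angle v a b / 2 : ℝ) * Complex.I)) ∈ f

/-- A convex drawing of a (connected) graph: straight-line, every angle in an internal (bounded)
face is at most `π` (convex or flat), every angle in the outer face is at least `π` (concave or
flat). -/
def IsConvex (Γ : PlaneDrawing G) : Prop :=
  Γ.IsStraightLine ∧
  ∀ f ∈ Γ.faces, ∀ v a b, Γ.NextCCW v a b → Γ.CornerIn v a b f →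
    (Bornology.IsBounded f → Γ.angle v a b ≤ Real.pi) ∧
    (¬ Bornology.IsBounded f → Real.pi ≤ Γ.angle v a b)

/-- Two straight-line drawings of `G` are equivalent (represent the same plane graph) if the
circular orderings of the edges around each vertex are the same and the outer face is
the same, i.e. it is delimited by the same vertices and edges. -/
def Equivalent (Γ Γ' : PlaneDrawing G) : Prop :=
  (∀ v a b, Γ.NextCCW v a b ↔ Γ'.NextCCW v a b) ∧ Γ.outerBoundary = Γ'.outerBoundary

end PlaneDrawing

/-! ### Connectivity -/

section Connectivity

variable {V : Type u}

/-- Removing any vertex leaves the graph connected (and there are at least three vertices). -/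
def IsBiconnected (G : SimpleGraph V) : Prop :=
  3 ≤ Nat.card V ∧ ∀ v : V, (G.induce {v}ᶜ).Connected

/-- Removing any two vertices leaves the graph connected (and there are at least four vertices). -/
def IsTriconnected (G : SimpleGraph V) : Prop :=
  4 ≤ Nat.card V ∧ ∀ u v : V, u ≠ v → (G.induce {u, v}ᶜ).Connected

/-- The graph obtained by introducing a new vertex `none` in the outer face and connecting it to all
the vertices incident to the outer face. -/
def PlaneDrawing.withOuterVertex {G : SimpleGraph V} (Γ : PlaneDrawing G) :
    SimpleGraph (Option V) where
  Adj
    | some a, some b => G.Adj a b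
    | some a, none => Γ.External a
    | none, some b => Γ.External b
    | none, none => False
  symm := ⟨by
    rintro (_ | a) (_ | b) h
    · exact h
    · exact h
    · exact h
    · exact SimpleGraph.Adj.symm h⟩
  loopless := ⟨by
    rintro (_ | a) h
    · exact h
    · exact G.loopless.irrefl a h⟩

/-- Internally triconnected plane graphs. -/
def PlaneDrawing.IsInternallyTriconnected {G : SimpleGraph V} (Γ : PlaneDrawing G) : Prop :=
  IsBiconnected G ∧ IsTriconnected Γ.withOuterVertex

end Connectivity

/-! ### Subdivisions -/

/-- The plane graph `(G, Γ)` is a subdivision of the plane graph `(H, Λ)`: it is obtained by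
replacing every edge `(u, v)` of `H` by a path `P u v` with the same end-vertices, where the paths
have no common vertices except for common end-vertices, and everything in `G` is obtained in this
way. The drawings agree: vertices of `H` stay in place, and the arc of an edge of `H` is the
concatenation of the arcs of the edges of its path. -/
def PlaneDrawing.IsSubdivisionOf {V W : Type u} {G : SimpleGraph V} {H : SimpleGraph W}
    (Γ : PlaneDrawing G) (Λ : PlaneDrawing H) : Prop :=
  ∃ (φ : W ↪ V) (P : ∀ u v, H.Adj u v → G.Walk (φ u) (φ v)),
    (∀ u v h, (P u v h).IsPath) ∧
    (∀ u v h, P v u (SimpleGraph.Adj.symm h) = (P u v h).reverse) ∧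
    (∀ u v h w, φ w ∈ (P u v h).support → w = u ∨ w = v) ∧
    (∀ u v h u' v' h', s(u, v) ≠ s(u', v') →
      ∀ x, x ∈ (P u v h).support → x ∈ (P u' v' h').support → x ∈ Set.range φ) ∧
    (∀ x, x ∈ Set.range φ ∨ ∃ u v h, x ∈ (P u v h).support) ∧
    (∀ e ∈ G.edgeSet, ∃ u v h, e ∈ (P u v h).edges) ∧
    (∀ w, Λ.pos w = Γ.pos (φ w)) ∧
    (∀ u v h, Λ.arc s(u, v) = ⋃ e ∈ (P u v h).edgeSet, Γ.arc e)

/-- `(G, Γ)` is a subdivision of a simple internally triconnected plane graph. -/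
def PlaneDrawing.IsSubdivisionOfInternallyTriconnected {V : Type u} {G : SimpleGraph V}
    (Γ : PlaneDrawing G) : Prop :=
  ∃ (W : Type u) (H : SimpleGraph W) (Λ : PlaneDrawing H),
    Λ.IsInternallyTriconnected ∧ Γ.IsSubdivisionOf Λ

/-! ### The two kinds of deletions -/

section Deletions

variable {V : Type u} {G : SimpleGraph V}

/-- `x` is a vertex of the subgraph `S` that is internal in `S`, regarded as a plane graph, and has
degree `d` in `S`. -/
def IsInternalOfDegree (Γ : PlaneDrawing G) (S : G.Subgraph) (d : ℕ) (x : V) : Prop :=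
  (∃ hx : x ∈ S.verts, ¬ (Γ.restrict S).External ⟨x, hx⟩) ∧ (S.neighborSet x).ncard = d

/-- The vertices of a path different from its two end-vertices. -/
def interiorVerts {u v : V} (p : G.Walk u v) : Set V :=
  {x | x ∈ p.support ∧ x ≠ u ∧ x ≠ v}

/-- `T` is obtained from `S` by deleting the edges and the internal vertices of a path with at least
one edge whose internal vertices are internal vertices of `S` of degree 2. -/
def IsPathDeletion (Γ : PlaneDrawing G) (S T : G.Subgraph) : Prop :=
  ∃ (u v : V) (p : G.Walk u v), p.IsPath ∧ 1 ≤ p.length ∧ p.toSubgraph ≤ S ∧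
    (∀ x ∈ interiorVerts p, IsInternalOfDegree Γ S 2 x) ∧
    T = (S.deleteVerts (interiorVerts p)).deleteEdges p.edgeSet

/-- `T` is obtained from `S` by deleting an internal vertex `u` of degree 3 as well as the edges and
the internal vertices of three paths from `u` to vertices of the cycle delimiting the outer
face of `G`, where the paths are vertex-disjoint except at `u` and their internal vertices are
internal vertices of `S` of degree 2. -/
def IsThreePathDeletion (Γ : PlaneDrawing G) (S T : G.Subgraph) : Prop :=
  ∃ u : V, IsInternalOfDegree Γ S 3 u ∧
  ∃ (w : Fin 3 → V) (p : ∀ i, G.Walk u (w i)),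
    (∀ i, (p i).IsPath ∧ (p i).toSubgraph ≤ S ∧ w i ∈ Γ.outerBoundary.verts ∧
      ∀ x ∈ interiorVerts (p i), IsInternalOfDegree Γ S 2 x) ∧
    (∀ i j, i ≠ j → ∀ x, x ∈ (p i).support → x ∈ (p j).support → x = u) ∧
    T = (S.deleteVerts ({u} ∪ ⋃ i, interiorVerts (p i))).deleteEdges (⋃ i, (p i).edgeSet)

end Deletions

/-! The convex drawing is used to establish one combinatorial property, `Good`, relative to the set
`C` of external vertices: a nonempty set of vertices off `C` has at least two outer neighbors, and
if it has exactly two, then it induces a forest together with them. In a convex drawing the edges at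
an internal vertex do not all lie on one side of a line, so a set of internal vertices attains its
extremes, in any direction, at its outer neighbors. A single outer neighbor is thus impossible, and
with two of them everything lies on one line, where a cycle would make edges overlap
(`good_of_isConvex`).

If `C` is the vertex set of a cycle, a `Good` graph without isolated vertices is a subdivision of an
internally triconnected graph. Vertices of a set off `C` with at most two outer neighbors have
degree 2 (`Good.lk_degree`), so replacing each maximal path of such vertices (a link with branch
ends) by an edge leaves no pair of vertices that cuts off a set avoiding `C` (`branchGraph_cut`).
The arcs of a link are concatenated to draw the new edge.

It remains to descend from a `Good` graph `S` to the outer cycle by admissible deletions that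
preserve `Good` (`exists_step`). Let `T` be a maximal `Good` proper subgraph of `S` containing the
cycle. Attaching to `T` an edge, a path or a claw of `S` whose ends do not all lie on one link
preserves `Good` (`Good.sup`), so by maximality the result is `S`. An edge or a path can then be
deleted, and so can a claw with all three feet on `C`. If a claw has a foot off `C`, that foot is
joined to another one by a link of `T`, and it is this link that is deleted from `S`
(`good_delete_link`). If no such piece exists, some part of `S` outside `T` is attached within a
single link, and `S` has a cycle inside a set with two outer neighbors (`no_bridge_at_link`).

Deletions that keep the outer boundary do not change the outer face (`outerFace_restrict`), so `C`
stays the same throughout. -/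

namespace ConvexReduction

/-! ### Good graphs and sets with at most two outer neighbors -/

variable {V : Type u} {T T' : SimpleGraph V} {C A B K : Set V}

/-- The vertices outside `A` that are adjacent to a vertex of `A`. -/
def nbhd (T : SimpleGraph V) (A : Set V) : Set V := {y | y ∉ A ∧ ∃ x ∈ A, T.Adj x y}

/-- `T` has no cycle inside `K`: every nonempty subset of `K` has a vertex with at most one
neighbor in that subset. -/
def Acyc (T : SimpleGraph V) (K : Set V) : Prop :=
  ∀ B ⊆ K, B.Nonempty → ∃ x ∈ B, {y ∈ B | T.Adj x y}.Subsingleton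

theorem Acyc.mono (h : Acyc T K) {K' : Set V} (hK : K' ⊆ K)
    (hT : ∀ x ∈ K', ∀ y ∈ K', T'.Adj x y → T.Adj x y) : Acyc T' K' := by
  intro B hB hne
  obtain ⟨x, hx, hs⟩ := h B (hB.trans hK) hne
  exact ⟨x, hx, hs.anti fun y hy => ⟨hy.1, hT x (hB hx) y (hB hy.1) hy.2⟩⟩

theorem not_acyc (hB : B ⊆ K) (hne : B.Nonempty)
    (h : ∀ x ∈ B, ∃ y ∈ B, ∃ z ∈ B, y ≠ z ∧ T.Adj x y ∧ T.Adj x z) : ¬ Acyc T K := by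
  intro hA
  obtain ⟨x, hx, hs⟩ := hA B hB hne
  obtain ⟨y, hy, z, hz, hyz, h1, h2⟩ := h x hx
  exact hyz (hs ⟨hy, h1⟩ ⟨hz, h2⟩)

/-- No set of vertices outside `C` is separated from the rest by at most two vertices, except for
sets of inner vertices of a single path. -/
def Good (T : SimpleGraph V) (C : Set V) : Prop :=
  ∀ A : Set V, A.Nonempty → A ⊆ T.support \ C →
    2 ≤ (nbhd T A).ncard ∧ ((nbhd T A).ncard ≤ 2 → Acyc T (A ∪ nbhd T A))

/-- A nonempty set of vertices outside `C` with at most two outer neighbors. -/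
structure Lk (T : SimpleGraph V) (C A : Set V) : Prop where
  nonempty : A.Nonempty
  subset : A ⊆ T.support \ C
  le : (nbhd T A).ncard ≤ 2

theorem Good.acyc (h : Good T C) (hA : Lk T C A) : Acyc T (A ∪ nbhd T A) :=
  (h A hA.nonempty hA.subset).2 hA.le

theorem Good.ncard_eq (h : Good T C) (hA : Lk T C A) : (nbhd T A).ncard = 2 :=
  le_antisymm hA.le (h A hA.nonempty hA.subset).1

theorem nbhd_adj {x y : V} (hx : x ∈ A) (h : T.Adj x y) : y ∈ A ∪ nbhd T A := by
  by_cases hy : y ∈ A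
  · exact Or.inl hy
  · exact Or.inr ⟨hy, x, hx, h⟩

theorem nbhd_subset_support : nbhd T A ⊆ T.support := by
  rintro y ⟨-, x, -, h⟩
  exact ⟨x, h.symm⟩

/-- Submodularity of the neighborhood size: a vertex is counted on the left at most as often as on
the right. -/
theorem ncard_nbhd_add [Finite V] (T : SimpleGraph V) (A B : Set V) :
    (nbhd T (A ∪ B)).ncard + (nbhd T (A ∩ B)).ncard ≤ (nbhd T A).ncard + (nbhd T B).ncard := by
  rw [← ncard_union_add_ncard_inter, ← ncard_union_add_ncard_inter (nbhd T A)]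
  refine add_le_add (ncard_le_ncard ?_ (toFinite _)) (ncard_le_ncard ?_ (toFinite _))
  · rintro y (⟨hy, x, hx, h⟩ | ⟨hy, x, hx, h⟩)
    · rw [mem_union, not_or] at hy
      rcases hx with hx | hx
      · exact Or.inl ⟨hy.1, x, hx, h⟩
      · exact Or.inr ⟨hy.2, x, hx, h⟩
    · by_cases hA : y ∈ A
      · exact Or.inr ⟨fun hB => hy ⟨hA, hB⟩, x, hx.2, h⟩
      · exact Or.inl ⟨hA, x, hx.1, h⟩
  · rintro y ⟨⟨hy, -⟩, ⟨-, x, hx, h⟩⟩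
    rw [mem_union, not_or] at hy
    exact ⟨⟨hy.1, x, hx.1, h⟩, ⟨hy.2, x, hx.2, h⟩⟩

/-- If the sets meet, submodularity applies, since the intersection has at least two outer
neighbors. If they are only adjacent, each contains an outer neighbor of the other, so at most one
outer neighbor of each survives. -/
theorem Good.lk_union [Finite V] (h : Good T C) (hA : Lk T C A) (hB : Lk T C B) {x : V}
    (hxA : x ∈ A) (hxB : x ∈ B ∪ nbhd T B) : Lk T C (A ∪ B) := by
  refine ⟨hA.nonempty.inl, union_subset hA.subset hB.subset, ?_⟩
  by_cases hi : (A ∩ B).Nonempty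
  · have h1 := ncard_nbhd_add T A B
    have h2 := (h (A ∩ B) hi (inter_subset_left.trans hA.subset)).1
    have := hA.le
    have := hB.le
    omega
  · have hxB' : x ∈ nbhd T B := hxB.resolve_left fun hb => hi ⟨x, hxA, hb⟩
    obtain ⟨y, hyB, hyx⟩ := hxB'.2
    have hyA : y ∈ nbhd T A := ⟨fun ha => hi ⟨y, ha, hyB⟩, x, hxA, hyx.symm⟩
    have hsub : nbhd T (A ∪ B) ⊆ (nbhd T A \ {y}) ∪ (nbhd T B \ {x}) := by
      rintro z ⟨hz, w, hw, hwz⟩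
      rw [mem_union, not_or] at hz
      rcases hw with hw | hw
      · exact Or.inl ⟨⟨hz.1, w, hw, hwz⟩, fun e => hz.2 (e ▸ hyB)⟩
      · exact Or.inr ⟨⟨hz.2, w, hw, hwz⟩, fun e => hz.1 (e ▸ hxA)⟩
    have h1 := ncard_le_ncard hsub (toFinite _)
    have h2 := ncard_union_le (nbhd T A \ {y}) (nbhd T B \ {x})
    have h3 := ncard_sdiff_singleton_of_mem hyA
    have h4 := ncard_sdiff_singleton_of_mem hxB'
    have := hA.le
    have := hB.le
    omega

theorem Good.two_le_degree [Finite V] (h : Good T C) {x : V} (hx : x ∈ T.support \ C) :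
    2 ≤ (T.neighborSet x).ncard := by
  have h1 := (h {x} (singleton_nonempty x) (singleton_subset_iff.2 hx)).1
  refine h1.trans (ncard_le_ncard ?_ (toFinite _))
  rintro y ⟨-, z, hz, hzy⟩
  rw [mem_singleton_iff] at hz
  exact hz ▸ hzy

theorem Good.exists_two [Finite V] (h : Good T C) {x : V} (hx : x ∈ T.support \ C) :
    ∃ y z, y ≠ z ∧ T.Adj x y ∧ T.Adj x z := by
  obtain ⟨y, hy, z, hz, hyz⟩ := one_lt_ncard_iff_nontrivial.1
    (h.two_le_degree hx)
  exact ⟨y, z, hyz, hy, hz⟩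

theorem exists_of_ncard {s : Set V} (h : 2 < s.ncard) (u v : V) : ∃ y ∈ s, y ≠ u ∧ y ≠ v := by
  by_contra! hc
  have hs : s ⊆ {u, v} := fun y hy => by
    by_cases hyu : y = u
    · exact Or.inl hyu
    · exact Or.inr (hc y hy hyu)
  have := ncard_le_ncard hs (toFinite _)
  have := ncard_insert_le u {v}
  rw [ncard_singleton] at this
  omega

/-- If `u` has at most one neighbor in the set, then it can be exchanged with that neighbor. -/
theorem lk_exchange [Finite V] {u v w : V} (hA : Lk T C A) (hN : nbhd T A = {u, v})
    (hu : ∀ y ∈ A, T.Adj u y → y = w) (hne : (A \ {w}).Nonempty) :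
    Lk T C (A \ {w}) ∧ nbhd T (A \ {w}) ⊆ {w, v} := by
  have hsub : nbhd T (A \ {w}) ⊆ {w, v} := by
    rintro y ⟨hy, x, hx, hxy⟩
    by_cases hyA : y ∈ A
    · left
      by_contra hyw
      exact hy ⟨hyA, hyw⟩
    · right
      have : y ∈ nbhd T A := ⟨hyA, x, hx.1, hxy⟩
      rw [hN] at this
      rcases this with rfl | rfl
      · exact absurd (hu x hx.1 hxy.symm) hx.2
      · rfl
  refine ⟨⟨hne, sdiff_subset.trans hA.subset, ?_⟩, hsub⟩
  have h1 := ncard_le_ncard hsub (toFinite _)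
  have h2 := ncard_insert_le w {v}
  rw [ncard_singleton] at h2
  omega

/-- Take a smallest such set containing a vertex `x` of degree at least 3. By the exchange lemma, an
outer neighbor with only one neighbor in the set must be attached at `x`. Dropping such an outer
neighbor still leaves `x` with two neighbors, so unless both are of this kind some vertex set has
minimum degree 2, against acyclicity. -/
theorem Good.lk_degree [Finite V] (h : Good T C) (hA : Lk T C A) {x : V} (hx : x ∈ A) :
    (T.neighborSet x).ncard = 2 := by
  by_contra hne
  have hdeg : 2 < (T.neighborSet x).ncard :=
    lt_of_le_of_ne (h.two_le_degree (hA.subset hx)) (Ne.symm hne)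
  clear hne
  induction hn : A.ncard using Nat.strong_induction_on generalizing A with
  | _ n ih =>
  obtain ⟨u, v, huv, hN⟩ := ncard_eq_two.1 (h.ncard_eq hA)
  have key : ∀ u v, u ≠ v → nbhd T A = {u, v} → ∀ w ∈ A, (∀ y ∈ A, T.Adj u y → y = w) → w = x := by
    intro u v huv hN w hw hu
    by_contra hwx
    have := (lk_exchange hA hN hu ⟨x, hx, fun e => hwx e.symm⟩).1
    exact ih (A \ {w}).ncard (hn ▸ ncard_sdiff_singleton_lt_of_mem hw) this
      ⟨hx, fun e => hwx e.symm⟩ rfl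
  have hAK : ∀ y ∈ A, ∃ z ∈ A ∪ nbhd T A, ∃ z' ∈ A ∪ nbhd T A, z ≠ z' ∧ T.Adj y z ∧ T.Adj y z' := by
    intro y hy
    obtain ⟨z, z', hzz, h1, h2⟩ := h.exists_two (hA.subset hy)
    exact ⟨z, nbhd_adj hy h1, z', nbhd_adj hy h2, hzz, h1, h2⟩
  have two : ∀ u v, u ≠ v → nbhd T A = {u, v} → (∃ y ∈ A, ∃ z ∈ A, y ≠ z ∧ T.Adj u y ∧ T.Adj u z) ∨
      ∀ y ∈ A, T.Adj u y → y = x := by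
    intro u v huv hN
    obtain ⟨hu, w, hw, hwu⟩ : u ∈ nbhd T A := hN ▸ mem_insert _ _
    by_cases hs : ∀ y ∈ A, T.Adj u y → y = w
    · right
      rw [← key u v huv hN w hw hs]
      exact hs
    · left
      push Not at hs
      obtain ⟨y, hy, huy, hyw⟩ := hs
      exact ⟨y, hy, w, hw, hyw, huy, hwu.symm⟩
  have three : ∀ u v, u ≠ v → nbhd T A = {u, v} →
      (∃ y ∈ A, ∃ z ∈ A, y ≠ z ∧ T.Adj v y ∧ T.Adj v z) →
      (∀ y ∈ A, T.Adj u y → y = x) → False := by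
    intro u v huv hN hv hu
    have hdisj : u ∉ A := (hN ▸ mem_insert _ _ : u ∈ nbhd T A).1
    refine not_acyc (T := T) (B := A ∪ {v}) (K := A ∪ nbhd T A) ?_ ⟨x, Or.inl hx⟩ ?_ (h.acyc hA)
    · rw [hN]
      exact union_subset_union_right _ (by simp)
    · have hmem : ∀ z ∈ A ∪ nbhd T A, z ≠ u → z ∈ A ∪ {v} := by
        rw [hN]
        rintro z (hz | rfl | hz) hzu
        · exact Or.inl hz
        · exact absurd rfl hzu
        · exact Or.inr hz
      rintro y (hy | rfl)
      · by_cases hyx : y = x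
        · subst hyx
          obtain ⟨z, hz, hzu, -⟩ := exists_of_ncard hdeg u u
          obtain ⟨z', hz', hzu', hzz⟩ := exists_of_ncard hdeg u z
          exact ⟨z, hmem z (nbhd_adj hy hz) hzu, z', hmem z' (nbhd_adj hy hz') hzu', hzz.symm, hz, hz'⟩
        · obtain ⟨z, hz, z', hz', hzz, h1, h2⟩ := hAK y hy
          refine ⟨z, hmem z hz ?_, z', hmem z' hz' ?_, hzz, h1, h2⟩
          · rintro rfl
            exact hyx (hu y hy h1.symm)
          · rintro rfl
            exact hyx (hu y hy h2.symm)
      · obtain ⟨y, hy, z, hz, hyz, h1, h2⟩ := hv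
        exact ⟨y, Or.inl hy, z, Or.inl hz, hyz, h1, h2⟩
  have hN' : nbhd T A = {v, u} := by rw [hN, pair_comm]
  rcases two u v huv hN with hu | hu <;> rcases two v u huv.symm hN' with hv | hv
  · refine not_acyc (T := T) (K := A ∪ nbhd T A) subset_rfl ⟨x, Or.inl hx⟩ ?_ (h.acyc hA)
    rintro y (hy | hy)
    · exact hAK y hy
    · rw [hN] at hy
      rcases hy with rfl | rfl
      · obtain ⟨y, hy, z, hz, hyz, h1, h2⟩ := hu
        exact ⟨y, Or.inl hy, z, Or.inl hz, hyz, h1, h2⟩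
      · obtain ⟨y, hy, z, hz, hyz, h1, h2⟩ := hv
        exact ⟨y, Or.inl hy, z, Or.inl hz, hyz, h1, h2⟩
  · exact three v u huv.symm hN' hu hv
  · exact three u v huv hN hv hu
  -- Both outer neighbors are attached only at `x`. A third neighbor of `x` keeps the set nonempty
  -- after `x` is removed, and then `x` is its only outer neighbor.
  · obtain ⟨z, hz, hzu, hzv⟩ := exists_of_ncard hdeg u v
    have hzA : z ∈ A := by
      rcases nbhd_adj hx hz with hz | hz
      · exact hz
      · rw [hN] at hz
        rcases hz with hz | hz
        · exact absurd hz hzu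
        · exact absurd hz hzv
    have hne : (A \ {x}).Nonempty := ⟨z, hzA, (T.ne_of_adj hz).symm⟩
    have h1 := (h (A \ {x}) hne (sdiff_subset.trans hA.subset)).1
    have h2 : nbhd T (A \ {x}) ⊆ {x} := by
      rintro y hy
      rcases (lk_exchange hA hN hu hne).2 hy with h1 | h1
      · exact h1
      · rcases (lk_exchange hA hN' hv hne).2 hy with h2 | h2
        · exact h2
        · rw [mem_singleton_iff] at h1 h2
          exact absurd (h2.symm.trans h1) huv
    have := ncard_le_ncard h2 (toFinite _)
    rw [ncard_singleton] at this
    omega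

end ConvexReduction

/-! ### Links: existence, maximality and uniqueness -/

namespace ConvexReduction

variable {V : Type u} {T T' : SimpleGraph V} {C A B K : Set V}

open SimpleGraph

theorem mem_edges_iff {a b x y : V} {p : T.Walk a b} : s(x, y) ∈ p.edges ↔
    ∃ i < p.length, s(p.getVert i, p.getVert (i + 1)) = s(x, y) := by
  rw [← Walk.mem_edges_toSubgraph, Subgraph.mem_edgeSet, Walk.toSubgraph_adj_iff]
  exact exists_congr fun i => and_comm

theorem mem_support_iff {a b x : V} {p : T.Walk a b} :
    x ∈ p.support ↔ ∃ i ≤ p.length, p.getVert i = x := by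
  rw [Walk.mem_support_iff_exists_getVert]
  exact exists_congr fun i => and_comm

theorem getVert_inj {a b : V} {p : T.Walk a b} (hp : p.IsPath) {i j : ℕ} (hi : i ≤ p.length)
    (hj : j ≤ p.length) (h : p.getVert i = p.getVert j) : i = j :=
  hp.getVert_injOn hi hj h

theorem mem_interiorVerts_iff {a b x : V} {p : T.Walk a b} (hp : p.IsPath) :
    x ∈ interiorVerts p ↔ ∃ i, 0 < i ∧ i < p.length ∧ p.getVert i = x := by
  constructor
  · rintro ⟨h, ha, hb⟩
    obtain ⟨i, hi, rfl⟩ := mem_support_iff.1 h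
    refine ⟨i, Nat.pos_of_ne_zero ?_, lt_of_le_of_ne hi ?_, rfl⟩
    · rintro rfl
      exact ha p.getVert_zero
    · rintro rfl
      exact hb p.getVert_length
  · rintro ⟨i, h0, hi, rfl⟩
    refine ⟨mem_support_iff.2 ⟨i, hi.le, rfl⟩, fun h => ?_, fun h => ?_⟩
    · have := getVert_inj hp hi.le (Nat.zero_le _) (h.trans (by simp))
      omega
    · have := getVert_inj hp hi.le le_rfl (h.trans (by simp))
      omega

theorem interiorVerts_reverse {a b : V} (p : T.Walk a b) :
    interiorVerts p.reverse = interiorVerts p := by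
  ext x
  constructor
  · rintro ⟨h, h1, h2⟩
    exact ⟨by simpa using h, h2, h1⟩
  · rintro ⟨h, h1, h2⟩
    exact ⟨by simpa using h, h2, h1⟩

/-- A path with at least one edge whose inner vertices lie outside `C` and have degree 2. -/
structure IsLink (C : Set V) {a b : V} (p : T.Walk a b) : Prop where
  isPath : p.IsPath
  pos : 1 ≤ p.length
  inner : ∀ x ∈ interiorVerts p, x ∉ C ∧ (T.neighborSet x).ncard = 2

theorem IsLink.reverse {a b : V} {p : T.Walk a b} (h : IsLink C p) : IsLink C p.reverse :=
  ⟨h.isPath.reverse, by simpa using h.pos, by rw [interiorVerts_reverse]; exact h.inner⟩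

theorem IsLink.ne {a b : V} {p : T.Walk a b} (h : IsLink C p) : a ≠ b := by
  have h1 := h.pos
  intro hab
  have := getVert_inj h.isPath (Nat.zero_le _) le_rfl (by simpa using hab)
  omega

/-- The two path edges at an inner vertex already exhaust its degree. -/
theorem IsLink.mem_edges [Finite V] {a b x y : V} {p : T.Walk a b} (h : IsLink C p)
    (hx : x ∈ interiorVerts p) (hxy : T.Adj x y) : s(x, y) ∈ p.edges := by
  obtain ⟨i, h0, hi, rfl⟩ := (mem_interiorVerts_iff h.isPath).1 hx
  have h1 := h.isPath.ncard_neighborSet_toSubgraph_internal_eq_two h0.ne' hi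
  have h2 : p.toSubgraph.neighborSet (p.getVert i) = T.neighborSet (p.getVert i) :=
    eq_of_subset_of_ncard_le (fun z hz => p.toSubgraph.adj_sub hz)
      (by rw [h1, (h.inner _ hx).2]) (toFinite _)
  rw [← Walk.mem_edges_toSubgraph, Subgraph.mem_edgeSet]
  exact (Set.ext_iff.1 h2 y).2 hxy

theorem IsLink.adj_index [Finite V] {a b y : V} {p : T.Walk a b} (h : IsLink C p) {i : ℕ}
    (h0 : 0 < i) (hi : i < p.length) (hxy : T.Adj (p.getVert i) y) :
    y = p.getVert (i - 1) ∨ y = p.getVert (i + 1) := by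
  have h1 := h.mem_edges ((mem_interiorVerts_iff h.isPath).2 ⟨i, h0, hi, rfl⟩) hxy
  obtain ⟨j, hj, e⟩ := mem_edges_iff.1 h1
  rw [Sym2.eq_iff] at e
  rcases e with ⟨e1, e2⟩ | ⟨e1, e2⟩
  · have := getVert_inj h.isPath hj.le hi.le e1
    subst this
    exact Or.inr e2.symm
  · have := getVert_inj h.isPath hj hi.le e2
    subst this
    exact Or.inl (by simpa using e1.symm)

theorem IsLink.nbhd_subset [Finite V] {a b : V} {p : T.Walk a b} (h : IsLink C p) :
    nbhd T (interiorVerts p) ⊆ {a, b} := by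
  rintro y ⟨hy, x, hx, hxy⟩
  have := p.snd_mem_support_of_mem_edges (h.mem_edges hx hxy)
  by_contra hc
  simp only [mem_insert_iff, mem_singleton_iff, not_or] at hc
  exact hy ⟨this, hc⟩

theorem ncard_le_two_of_subset [Finite V] {s : Set V} {a b : V} (h : s ⊆ {a, b}) : s.ncard ≤ 2 := by
  have h1 := ncard_le_ncard h (toFinite _)
  have h2 := ncard_insert_le a {b}
  rw [ncard_singleton] at h2
  omega

theorem support_subset_support {a b : V} {p : T.Walk a b} (hp : 1 ≤ p.length) {x : V}
    (hx : x ∈ p.support) : x ∈ T.support := by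
  obtain ⟨i, hi, rfl⟩ := mem_support_iff.1 hx
  rcases Nat.lt_or_ge i p.length with h | h
  · exact ⟨_, p.adj_getVert_succ h⟩
  · obtain ⟨j, rfl⟩ : ∃ j, i = j + 1 := ⟨i - 1, by omega⟩
    exact ⟨_, (p.adj_getVert_succ (show j < p.length by omega)).symm⟩

theorem IsLink.lk [Finite V] {a b : V} {p : T.Walk a b} (h : IsLink C p)
    (hne : (interiorVerts p).Nonempty) : Lk T C (interiorVerts p) :=
  ⟨hne, fun x hx => ⟨support_subset_support h.pos hx.1, (h.inner x hx).1⟩,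
    ncard_le_two_of_subset h.nbhd_subset⟩

/-- A vertex that is not an inner vertex of a link. -/
def Branch (T : SimpleGraph V) (C : Set V) (x : V) : Prop := x ∈ C ∨ (T.neighborSet x).ncard ≠ 2

theorem IsLink.not_branch {a b x : V} {p : T.Walk a b} (h : IsLink C p)
    (hx : x ∈ interiorVerts p) : ¬ Branch T C x := by
  rintro (h1 | h1)
  · exact (h.inner x hx).1 h1
  · exact h1 (h.inner x hx).2

/-- The end `b` has degree 2, so the path continues along its second edge; what must be excluded is
that this edge returns to the path. -/
theorem IsLink.exists_longer [Finite V] (hT : Good T C) {a b : V} {p : T.Walk a b}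
    (h : IsLink C p) (hb : ¬ Branch T C b) :
    ∃ (c : V) (q : T.Walk a c), IsLink C q ∧ p.length < q.length ∧ ∀ e ∈ p.edges, e ∈ q.edges := by
  rw [Branch, not_or, not_not] at hb
  have hpos := h.pos
  have hb' : T.Adj b (p.getVert (p.length - 1)) := by
    have := p.adj_getVert_succ (show p.length - 1 < p.length by omega)
    rw [show p.length - 1 + 1 = p.length by omega, p.getVert_length] at this
    exact this.symm
  obtain ⟨w, hw, hne⟩ : ∃ w, T.Adj b w ∧ w ≠ p.getVert (p.length - 1) := by
    obtain ⟨w, hw, hne⟩ := exists_ne_of_one_lt_ncard (by rw [hb.2]; norm_num)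
      (p.getVert (p.length - 1)) (s := T.neighborSet b)
    exact ⟨w, hw, hne⟩
  by_cases hws : w ∈ p.support
  · exfalso
    obtain ⟨j, hj, rfl⟩ := mem_support_iff.1 hws
    have hjn : j ≠ p.length := by
      rintro rfl
      exact T.ne_of_adj hw p.getVert_length.symm
    -- Returning to `a` would leave `a` as the only outer neighbor of the other vertices of the
    -- path. Returning to an inner vertex contradicts its degree.
    rcases Nat.eq_zero_or_pos j with rfl | hj0
    · rw [p.getVert_zero] at hw
      have hb0 : b ∈ T.support \ C := ⟨⟨_, hw⟩, hb.1⟩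
      have hab := h.ne
      have hsub : nbhd T (insert b (interiorVerts p)) ⊆ {a} := by
        rintro y ⟨hy, x, hx, hxy⟩
        rw [mem_insert_iff, not_or] at hy
        by_contra hya
        rcases hx with rfl | hx
        · have h3 : ({p.getVert (p.length - 1), a} : Set V) ⊆ T.neighborSet x := by
            rintro z (rfl | rfl)
            · exact hb'
            · exact hw
          have h4 := eq_of_subset_of_ncard_le h3
            (by rw [hb.2, ncard_pair (by simpa using hne.symm)]) (toFinite _)
          have h5 : y ∈ T.neighborSet x := hxy
          rw [← h4] at h5
          rcases h5 with rfl | h5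
          · refine hy.2 ⟨p.getVert_mem_support _, hya, hy.1⟩
          · exact hya h5
        · have := h.nbhd_subset ⟨hy.2, x, hx, hxy⟩
          rcases this with h3 | h3
          · exact hya h3
          · exact hy.1 h3
      have h3 := (hT _ (insert_nonempty _ _) (insert_subset hb0 fun x hx =>
        ⟨support_subset_support h.pos hx.1, (h.inner x hx).1⟩)).1
      have h4 := ncard_le_ncard hsub (toFinite _)
      rw [ncard_singleton] at h4
      omega
    · have h3 := h.adj_index hj0 (lt_of_le_of_ne hj hjn) hw.symm
      have h4 : b = p.getVert p.length := p.getVert_length.symm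
      rcases h3 with h3 | h3
      · have := getVert_inj h.isPath le_rfl (by omega) (h4.symm.trans h3)
        omega
      · have := getVert_inj h.isPath le_rfl (by omega) (h4.symm.trans h3)
        exact hne (by rw [this]; simp)
  · refine ⟨w, p.concat hw, ⟨h.isPath.concat hws hw, by simp, ?_⟩, by simp, fun e he => by
      simp [Walk.edges_concat, he]⟩
    rintro x ⟨hx, hxa, hxw⟩
    rw [Walk.support_concat] at hx
    simp only [List.mem_append, List.mem_singleton] at hx
    rcases hx with hx | hx
    · by_cases hxb : x = b
      · exact hxb ▸ hb
      · exact h.inner x ⟨hx, hxa, hxb⟩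
    · exact absurd hx hxw

/-- A longest link through the edge cannot be extended at either end; the first end is treated by
reversal. -/
theorem Good.exists_link [Finite V] (hT : Good T C) {x y : V} (hxy : T.Adj x y) :
    ∃ (a b : V) (p : T.Walk a b), IsLink C p ∧ s(x, y) ∈ p.edges ∧ Branch T C a ∧ Branch T C b := by
  classical
  have := Fintype.ofFinite V
  let P : ℕ → Prop := fun n => ∃ (a b : V) (p : T.Walk a b), IsLink C p ∧ s(x, y) ∈ p.edges ∧
    p.length = n
  have h1 : P 1 := by
    refine ⟨x, y, hxy.toWalk, ⟨by simp [T.ne_of_adj hxy], by simp, ?_⟩, by simp, by simp⟩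
    rintro z ⟨hz, h1, h2⟩
    simp at hz
    tauto
  have hb : ∀ n, P n → n ≤ Fintype.card V := by
    rintro n ⟨a, b, p, hp, -, rfl⟩
    exact hp.isPath.length_lt.le
  obtain ⟨a, b, p, hp, he, hlen⟩ := Nat.findGreatest_spec (P := P) (hb 1 h1) h1
  have hmax : ∀ n, P n → n ≤ p.length := fun n hn => hlen ▸ Nat.le_findGreatest (hb n hn) hn
  have key : ∀ (a b : V) (q : T.Walk a b), IsLink C q → s(x, y) ∈ q.edges → q.length = p.length →
      Branch T C b := by
    intro a b q hq he' hl
    by_contra hb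
    obtain ⟨c, r, hr, hlt, hsub⟩ := hq.exists_longer hT hb
    have := hmax r.length ⟨a, c, r, hr, hsub _ he', rfl⟩
    omega
  exact ⟨a, b, p, hp, he, key b a p.reverse hp.reverse (by simpa using he) (by simp),
    key a b p hp he rfl⟩

/-- Branch vertices are never inner vertices of links, so the common inner vertices have their outer
neighbors among the common ends; as there are at least two of them, all ends are common. -/
theorem IsLink.ends_eq [Finite V] (hT : Good T C) {a b c d x : V} {p : T.Walk a b} {q : T.Walk c d}
    (hp : IsLink C p) (hq : IsLink C q) (ha : Branch T C a) (hb : Branch T C b)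
    (hc : Branch T C c) (hd : Branch T C d) (hxp : x ∈ interiorVerts p)
    (hxq : x ∈ interiorVerts q) : s(a, b) = s(c, d) := by
  have hsub : nbhd T (interiorVerts p ∩ interiorVerts q) ⊆ {a, b} ∩ {c, d} := by
    rintro y ⟨hy, z, ⟨hz1, hz2⟩, hzy⟩
    have h1 := nbhd_adj hz1 hzy
    have h2 := nbhd_adj hz2 hzy
    rcases h1 with h1 | h1
    · rcases h2 with h2 | h2
      · exact absurd ⟨h1, h2⟩ hy
      · rcases hq.nbhd_subset h2 with rfl | h2
        · exact absurd hc (hp.not_branch h1)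
        · rw [mem_singleton_iff] at h2
          exact absurd (h2 ▸ hd) (hp.not_branch h1)
    · have h1' := hp.nbhd_subset h1
      refine ⟨h1', ?_⟩
      rcases h2 with h2 | h2
      · rcases h1' with rfl | h1'
        · exact absurd ha (hq.not_branch h2)
        · rw [mem_singleton_iff] at h1'
          exact absurd (h1' ▸ hb) (hq.not_branch h2)
      · exact hq.nbhd_subset h2
  have h2 := (hT (interiorVerts p ∩ interiorVerts q) ⟨x, hxp, hxq⟩ (inter_subset_left.trans (hp.lk ⟨x, hxp⟩).subset)).1.trans
    (ncard_le_ncard hsub (toFinite _))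
  have e1 : ({a, b} : Set V) ∩ {c, d} = {a, b} :=
    eq_of_subset_of_ncard_le inter_subset_left (by rwa [ncard_pair hp.ne]) (toFinite _)
  have e2 : ({a, b} : Set V) ∩ {c, d} = {c, d} :=
    eq_of_subset_of_ncard_le inter_subset_right (by rwa [ncard_pair hq.ne]) (toFinite _)
  have e : ({a, b} : Set V) = {c, d} := e1.symm.trans e2
  rw [pair_eq_pair_iff] at e
  rw [Sym2.eq_iff]
  exact e

/-- The vertices of a cycle form a set in which each has two neighbors. -/
theorem Acyc.isAcyclic [Finite V] (h : Acyc T K) : (T.induce K).IsAcyclic := by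
  intro v c hc
  refine not_acyc (T := T) (B := Subtype.val '' {x | x ∈ c.support}) (K := K) ?_
    ⟨v, v, c.start_mem_support, rfl⟩ ?_ h
  · rintro _ ⟨x, -, rfl⟩
    exact x.2
  · rintro _ ⟨x, hx, rfl⟩
    have h2 := hc.ncard_neighborSet_toSubgraph_eq_two hx
    obtain ⟨y, z, hyz, he⟩ := ncard_eq_two.1 h2
    have hy : c.toSubgraph.Adj x y := by
      rw [← Subgraph.mem_neighborSet, he]
      exact Or.inl rfl
    have hz : c.toSubgraph.Adj x z := by
      rw [← Subgraph.mem_neighborSet, he]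
      exact Or.inr rfl
    refine ⟨y, ⟨y, ?_, rfl⟩, z, ⟨z, ?_, rfl⟩, fun e => hyz (Subtype.ext e), hy.adj_sub, hz.adj_sub⟩
    · exact (c.mem_verts_toSubgraph).1 hy.snd_mem
    · exact (c.mem_verts_toSubgraph).1 hz.snd_mem

theorem walk_eq_of_length_one {a b : V} {p q : T.Walk a b} (hp : p.length = 1) (hq : q.length = 1) :
    p = q := by
  obtain ⟨h, rfl⟩ : ∃ h : T.Adj a b, p = h.toWalk := by
    cases p with
    | nil => simp at hp
    | cons h p =>
      cases p with
      | nil => exact ⟨h, rfl⟩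
      | cons h' p => simp at hp
  cases q with
  | nil => simp at hq
  | cons h q =>
    cases q with
    | nil => rfl
    | cons h' q => simp at hq

theorem length_eq_one_of_interior_empty {a b : V} {p : T.Walk a b} (hp : p.IsPath)
    (h : 1 ≤ p.length) (he : ¬ (interiorVerts p).Nonempty) : p.length = 1 := by
  by_contra hne
  exact he ⟨_, (mem_interiorVerts_iff hp).2 ⟨1, by omega, by omega, rfl⟩⟩

/-- All inner vertices together have only the two ends as outer neighbors, so both paths run in a
forest, where paths are unique. Without inner vertices both are the same edge. -/
theorem IsLink.eq [Finite V] (hT : Good T C) {a b : V} {p q : T.Walk a b}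
    (hp : IsLink C p) (hq : IsLink C q) : p = q := by
  classical
  by_cases hne : (interiorVerts p ∪ interiorVerts q).Nonempty
  · have hsub : nbhd T (interiorVerts p ∪ interiorVerts q) ⊆ {a, b} := by
      rintro y ⟨hy, x, hx, hxy⟩
      rw [mem_union, not_or] at hy
      rcases hx with hx | hx
      · exact hp.nbhd_subset ⟨hy.1, x, hx, hxy⟩
      · exact hq.nbhd_subset ⟨hy.2, x, hx, hxy⟩
    have hl : Lk T C (interiorVerts p ∪ interiorVerts q) := by
      refine ⟨hne, ?_, ncard_le_two_of_subset hsub⟩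
      rintro x (hx | hx)
      · exact (hp.lk ⟨x, hx⟩).subset hx
      · exact (hq.lk ⟨x, hx⟩).subset hx
    have e : nbhd T (interiorVerts p ∪ interiorVerts q) = {a, b} :=
      eq_of_subset_of_ncard_le hsub (by rw [hT.ncard_eq hl, ncard_pair hp.ne]) (toFinite _)
    have hac := hT.acyc hl
    rw [e] at hac
    set X := interiorVerts p ∪ interiorVerts q ∪ {a, b} with hX
    have hpX : ∀ x ∈ p.support, x ∈ X := by
      intro x hx
      by_cases h : x = a ∨ x = b
      · exact Or.inr h
      · rw [not_or] at h
        exact Or.inl (Or.inl ⟨hx, h⟩)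
    have hqX : ∀ x ∈ q.support, x ∈ X := by
      intro x hx
      by_cases h : x = a ∨ x = b
      · exact Or.inr h
      · rw [not_or] at h
        exact Or.inl (Or.inr ⟨hx, h⟩)
    have hind : ∀ (r : T.Walk a b) (hr : ∀ x ∈ r.support, x ∈ X), r.IsPath →
        (r.induce X hr).IsPath := by
      intro r hr hpath
      rw [← Walk.isPath_map_iff_of_injective (f := (SimpleGraph.Embedding.induce X).toHom)
        Subtype.val_injective, Walk.map_induce]
      exact hpath
    have key := (hac.isAcyclic.subsingleton_path ⟨a, hpX a p.start_mem_support⟩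
      ⟨b, hpX b p.end_mem_support⟩).elim ⟨p.induce X hpX, hind p hpX hp.isPath⟩
      ⟨q.induce X hqX, hind q hqX hq.isPath⟩
    have h2 := congrArg (fun r => r.1.map (SimpleGraph.Embedding.induce X).toHom) key
    simp only [Walk.map_induce] at h2
    exact h2
  · rw [union_nonempty, not_or] at hne
    exact walk_eq_of_length_one (length_eq_one_of_interior_empty hp.isPath hp.pos hne.1)
      (length_eq_one_of_interior_empty hq.isPath hq.pos hne.2)

end ConvexReduction

/-! ### Attaching edges, paths and claws to a good graph -/

namespace ConvexReduction

variable {V : Type u} {T T' S Y : SimpleGraph V} {C A B K : Set V}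

open SimpleGraph

/-- Attaching a piece `Y` to `T` at the vertices of `X`. -/
theorem Good.sup [Finite V] (hT : Good T C) {X : Set V} (hX : X ⊆ T.support)
    (y2 : ∀ K : Set V, (∀ z ∈ K, z ∉ T.support → ∀ y, Y.Adj z y → y ∈ K) →
      (∃ x ∈ K, ∃ y ∈ K, Y.Adj x y) → X ⊆ K)
    (y3 : ∀ A : Set V, A.Nonempty → A ⊆ Y.support \ T.support → 2 ≤ (nbhd Y A).ncard)
    (y4 : ∀ A : Set V, A.Nonempty → A ⊆ Y.support \ T.support → (nbhd Y A).ncard ≤ 2 →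
      Acyc (T ⊔ Y) (A ∪ nbhd Y A))
    (y5 : ∀ A : Set V, Lk T C A → ¬ X ⊆ A ∪ nbhd T A) : Good (T ⊔ Y) C := by
  intro A hne hA
  -- If `A` meets `T` and has at most two outer neighbors, these are exactly the ones it has in `T`.
  -- A piece edge inside the closure of `A` would then, by `y2`, bring all of `X` into the closure
  -- of one link set of `T`, which `y5` forbids; so only edges of `T` matter. If `A` avoids `T`, its
  -- outer neighbors are those in `Y`.
  by_cases hAT : (A ∩ T.support).Nonempty
  · have hAT' : A ∩ T.support ⊆ T.support \ C := fun x hx => ⟨hx.2, (hA hx.1).2⟩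
    have hsub : nbhd T (A ∩ T.support) ⊆ nbhd (T ⊔ Y) A := by
      rintro y ⟨hy, x, hx, hxy⟩
      exact ⟨fun h => hy ⟨h, x, hxy.symm⟩, x, hx.1, Or.inl hxy⟩
    have h2 := (hT _ hAT hAT').1
    refine ⟨h2.trans (ncard_le_ncard hsub (toFinite _)), fun hle => ?_⟩
    have hlk : Lk T C (A ∩ T.support) := ⟨hAT, hAT',
      (ncard_le_ncard hsub (toFinite _)).trans hle⟩
    have he : nbhd T (A ∩ T.support) = nbhd (T ⊔ Y) A :=
      eq_of_subset_of_ncard_le hsub (hle.trans h2) (toFinite _)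
    have hno : ¬ ∃ x ∈ A ∪ nbhd (T ⊔ Y) A, ∃ y ∈ A ∪ nbhd (T ⊔ Y) A, Y.Adj x y := by
      intro hex
      have hK : X ⊆ A ∪ nbhd (T ⊔ Y) A := by
        refine y2 _ ?_ hex
        intro z hz hzT y hzy
        refine nbhd_adj (hz.resolve_right fun hz => hzT ?_) (Or.inr hzy)
        rw [← he] at hz
        exact nbhd_subset_support hz
      refine y5 _ hlk fun x hx => ?_
      rcases hK hx with h | h
      · exact Or.inl ⟨h, hX hx⟩
      · exact Or.inr (he ▸ h)
    have hsup : A ⊆ T.support := by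
      intro x hx
      obtain ⟨y, hxy | hxy⟩ := (hA hx).1
      · exact ⟨y, hxy⟩
      · exact absurd ⟨x, Or.inl hx, y, nbhd_adj hx (Or.inr hxy), hxy⟩ hno
    refine (hT.acyc hlk).mono ?_ ?_
    · rw [he, inter_eq_left.2 hsup]
    · rintro x hx y hy (h | h)
      · exact h
      · exact absurd ⟨x, hx, y, hy, h⟩ hno
  · have hAT' : ∀ x ∈ A, x ∉ T.support := fun x hx h => hAT ⟨x, hx, h⟩
    have hAY : A ⊆ Y.support \ T.support := by
      intro x hx
      refine ⟨?_, hAT' x hx⟩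
      obtain ⟨y, hxy | hxy⟩ := (hA hx).1
      · exact absurd ⟨y, hxy⟩ (hAT' x hx)
      · exact ⟨y, hxy⟩
    have he : nbhd (T ⊔ Y) A = nbhd Y A := by
      ext y
      constructor
      · rintro ⟨hy, x, hx, hxy | hxy⟩
        · exact absurd ⟨y, hxy⟩ (hAT' x hx)
        · exact ⟨hy, x, hx, hxy⟩
      · rintro ⟨hy, x, hx, hxy⟩
        exact ⟨hy, x, hx, Or.inr hxy⟩
    rw [he]
    exact ⟨y3 A hne hAY, y4 A hne hAY⟩

/-- The graph formed by the edges of a family of walks. -/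
def edgeUnion {ι : Type*} {a b : ι → V} (p : ∀ i, S.Walk (a i) (b i)) : SimpleGraph V :=
  fromEdgeSet (⋃ i, (p i).edgeSet)

theorem edgeUnion_adj {ι : Type*} {a b : ι → V} {p : ∀ i, S.Walk (a i) (b i)} {x y : V} :
    (edgeUnion p).Adj x y ↔ ∃ i, s(x, y) ∈ (p i).edges := by
  rw [edgeUnion, fromEdgeSet_adj, mem_iUnion]
  constructor
  · rintro ⟨⟨i, hi⟩, -⟩
    exact ⟨i, hi⟩
  · rintro ⟨i, hi⟩
    exact ⟨⟨i, hi⟩, S.ne_of_adj ((p i).adj_of_mem_edges hi)⟩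

/-- Paths with a common first vertex `u`, disjoint otherwise, that meet `T` in their last vertices
only. -/
structure IsStar (T : SimpleGraph V) {k : ℕ} {u : V} {w : Fin k → V}
    (p : ∀ i, S.Walk u (w i)) : Prop where
  isPath : ∀ i, (p i).IsPath
  center : u ∉ T.support
  ends : ∀ i, w i ∈ T.support
  inner : ∀ i, ∀ x ∈ (p i).support, x ≠ w i → x ∉ T.support
  disjoint : ∀ i j, i ≠ j → ∀ x, x ∈ (p i).support → x ∈ (p j).support → x = u

namespace IsStar

variable {k : ℕ} {u : V} {w : Fin k → V} {p : ∀ i, S.Walk u (w i)}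

theorem notMem (h : IsStar T p) (i : Fin k) {j : ℕ} (hj : j < (p i).length) :
    (p i).getVert j ∉ T.support := by
  refine h.inner i _ ((p i).getVert_mem_support j) fun e => ?_
  have := getVert_inj (h.isPath i) hj.le le_rfl (e.trans (by simp))
  omega

theorem adj (i : Fin k) {j : ℕ} (hj : j < (p i).length) :
    (edgeUnion p).Adj ((p i).getVert j) ((p i).getVert (j + 1)) :=
  edgeUnion_adj.2 ⟨i, mem_edges_iff.2 ⟨j, hj, rfl⟩⟩

theorem exists_index {x y : V} (h : (edgeUnion p).Adj x y) :
    ∃ i, ∃ j < (p i).length, ((p i).getVert j = x ∧ (p i).getVert (j + 1) = y) ∨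
      ((p i).getVert j = y ∧ (p i).getVert (j + 1) = x) := by
  obtain ⟨i, hi⟩ := edgeUnion_adj.1 h
  obtain ⟨j, hj, e⟩ := mem_edges_iff.1 hi
  rw [Sym2.eq_iff] at e
  exact ⟨i, j, hj, e⟩

/-- Closure under adjacency off `T` spreads from any edge of the star down its leg to the center,
and from there along every leg to its end. This is condition `y2` of `Good.sup`. -/
theorem ends_subset (h : IsStar T p) (K : Set V)
    (hK : ∀ z ∈ K, z ∉ T.support → ∀ y, (edgeUnion p).Adj z y → y ∈ K)
    (hex : ∃ x ∈ K, ∃ y ∈ K, (edgeUnion p).Adj x y) : range w ⊆ K := by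
  obtain ⟨x, hx, y, hy, hxy⟩ := hex
  obtain ⟨i, j, hj, e⟩ := exists_index hxy
  have hjK : (p i).getVert j ∈ K := by
    rcases e with ⟨e, -⟩ | ⟨e, -⟩
    · exact e ▸ hx
    · exact e ▸ hy
  have hu : u ∈ K := by
    have : ∀ m, m ≤ j → (p i).getVert (j - m) ∈ K := by
      intro m
      induction m with
      | zero => exact fun _ => hjK
      | succ m ih =>
        intro hm
        refine hK _ (ih (by omega)) (h.notMem i (by omega)) _ ?_
        have := adj (p := p) i (show j - (m + 1) < (p i).length by omega)
        rw [show j - (m + 1) + 1 = j - m by omega] at this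
        exact this.symm
    have := this j le_rfl
    rwa [Nat.sub_self, Walk.getVert_zero] at this
  rintro _ ⟨i', rfl⟩
  have : ∀ m, m ≤ (p i').length → (p i').getVert m ∈ K := by
    intro m
    induction m with
    | zero => exact fun _ => by rwa [Walk.getVert_zero]
    | succ m ih =>
      intro hm
      exact hK _ (ih (by omega)) (h.notMem i' hm) _ (adj i' hm)
  have := this _ le_rfl
  rwa [Walk.getVert_length] at this

theorem mem_support_of_adj {x y : V} (h : (edgeUnion p).Adj x y) : ∃ i, x ∈ (p i).support := by
  obtain ⟨i, hi⟩ := edgeUnion_adj.1 h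
  exact ⟨i, (p i).fst_mem_support_of_mem_edges hi⟩

theorem exists_lt (h : IsStar T p) {x : V} (hx : x ∈ (edgeUnion p).support \ T.support) :
    ∃ i, ∃ j < (p i).length, (p i).getVert j = x := by
  obtain ⟨⟨y, hxy⟩, hxT⟩ := hx
  obtain ⟨i, hi⟩ := mem_support_of_adj hxy
  obtain ⟨j, hj, e⟩ := mem_support_iff.1 hi
  refine ⟨i, j, lt_of_le_of_ne hj ?_, e⟩
  rintro rfl
  rw [Walk.getVert_length] at e
  exact hxT (e ▸ h.ends i)

theorem exists_up (i : Fin k) {j : ℕ} (hj : (p i).getVert j ∈ A) (hjl : j ≤ (p i).length)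
    (hw : w i ∉ A) :
    ∃ m, j < m ∧ m ≤ (p i).length ∧ (p i).getVert m ∈ nbhd (edgeUnion p) A := by
  by_contra! hc
  have : ∀ m, j + m ≤ (p i).length → (p i).getVert (j + m) ∈ A := by
    intro m
    induction m with
    | zero => exact fun _ => hj
    | succ m ih =>
      intro hm
      by_contra hn
      exact hc (j + (m + 1)) (by omega) hm ⟨hn, _, ih (by omega), adj i (by omega)⟩
  have := this ((p i).length - j) (by omega)
  rw [show j + ((p i).length - j) = (p i).length by omega, Walk.getVert_length] at this
  exact hw this

theorem exists_down (i : Fin k) {j : ℕ} (hj : (p i).getVert j ∈ A) (hjl : j ≤ (p i).length)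
    (hu : u ∉ A) :
    ∃ m < j, (p i).getVert m ∈ nbhd (edgeUnion p) A := by
  by_contra! hc
  have : ∀ m, m ≤ j → (p i).getVert (j - m) ∈ A := by
    intro m
    induction m with
    | zero => exact fun _ => hj
    | succ m ih =>
      intro hm
      by_contra hn
      refine hc (j - (m + 1)) (by omega) ⟨hn, _, ih (by omega), ?_⟩
      have := adj (p := p) i (show j - (m + 1) < (p i).length by omega)
      rw [show j - (m + 1) + 1 = j - m by omega] at this
      exact this.symm
  have := this j le_rfl
  rw [Nat.sub_self, Walk.getVert_zero] at this
  exact hu this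

/-- Every leg leaves `A` before or at its end, and the exits are distinct because legs share only
`u`, which lies in `A`. -/
theorem le_ncard_nbhd [Finite V] (h : IsStar T p) (hA : A ⊆ (edgeUnion p).support \ T.support)
    (hu : u ∈ A) : k ≤ (nbhd (edgeUnion p) A).ncard := by
  have hex : ∀ i, ∃ m, 0 < m ∧ m ≤ (p i).length ∧ (p i).getVert m ∈ nbhd (edgeUnion p) A :=
    fun i => exists_up i (by rwa [Walk.getVert_zero]) (Nat.zero_le _) fun hw => (hA hw).2 (h.ends i)
  choose m h0 hm hmem using hex
  have hinj : Function.Injective fun i => (p i).getVert (m i) := by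
    intro i j hij
    by_contra hne
    have h1 := h.disjoint i j hne _ ((p i).getVert_mem_support (m i))
      (by simp only at hij; rw [hij]; exact (p j).getVert_mem_support (m j))
    refine (hmem i).1 ?_
    rwa [h1]
  calc k = Nat.card (Fin k) := by simp
    _ = (range fun i => (p i).getVert (m i)).ncard := (ncard_range_of_injective hinj).symm
    _ ≤ _ := ncard_le_ncard (by rintro _ ⟨i, rfl⟩; exact hmem i) (toFinite _)

/-- If the center is not in `A`, a leg that meets `A` leaves it in both directions. -/
theorem two_le_ncard_nbhd [Finite V] (h : IsStar T p) (hk : 2 ≤ k) (hne : A.Nonempty)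
    (hA : A ⊆ (edgeUnion p).support \ T.support) : 2 ≤ (nbhd (edgeUnion p) A).ncard := by
  by_cases hu : u ∈ A
  · exact hk.trans (h.le_ncard_nbhd hA hu)
  · obtain ⟨x, hx⟩ := hne
    obtain ⟨i, j, hj, rfl⟩ := h.exists_lt (hA hx)
    obtain ⟨m, hm1, hm2, hm⟩ := exists_up i hx hj.le fun hw => (hA hw).2 (h.ends i)
    obtain ⟨m', hm1', hm'⟩ := exists_down i hx hj.le hu
    have : (p i).getVert m ≠ (p i).getVert m' := fun e => by
      have := getVert_inj (h.isPath i) hm2 (by omega) e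
      omega
    rw [← ncard_pair this]
    exact ncard_le_ncard (pair_subset hm hm') (toFinite _)

/-- A vertex of the set that is farthest along its leg can be adjacent, within the set, only to its
predecessor. -/
theorem acyc (h : IsStar T p) : Acyc (edgeUnion p) univ := by
  classical
  intro B _ hne
  by_cases hB : B ⊆ {u}
  · obtain ⟨x, hx⟩ := hne
    refine ⟨x, hx, ?_⟩
    rintro y ⟨hy, hxy⟩
    exact absurd ((hB hx).trans (hB hy).symm) (SimpleGraph.ne_of_adj _ hxy)
  · obtain ⟨x, hx, hxu⟩ := not_subset.1 hB
    by_cases hxs : x ∈ (edgeUnion p).support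
    · obtain ⟨y, hxy⟩ := hxs
      obtain ⟨i, hi⟩ := mem_support_of_adj hxy
      obtain ⟨j, hj, rfl⟩ := mem_support_iff.1 hi
      let J := Nat.findGreatest (fun m => (p i).getVert m ∈ B) (p i).length
      have hJB : (p i).getVert J ∈ B := Nat.findGreatest_spec (P := fun m => (p i).getVert m ∈ B)
        hj hx
      have hJl : J ≤ (p i).length := Nat.findGreatest_le _
      have hjJ : j ≤ J := Nat.le_findGreatest hj hx
      have hj0 : 0 < j := by
        refine Nat.pos_of_ne_zero ?_
        rintro rfl
        exact hxu (by simp)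
      refine ⟨_, hJB, subsingleton_of_forall_eq ((p i).getVert (J - 1)) ?_⟩
      rintro y ⟨hy, hJy⟩
      obtain ⟨i', m, hm, e⟩ := exists_index hJy
      have hii : i = i' := by
        by_contra hne
        have hmem : (p i).getVert J ∈ (p i').support := by
          rcases e with ⟨e, -⟩ | ⟨-, e⟩
          · exact e ▸ (p i').getVert_mem_support _
          · exact e ▸ (p i').getVert_mem_support _
        have := h.disjoint i i' hne _ ((p i).getVert_mem_support _) hmem
        have := getVert_inj (h.isPath i) hJl (Nat.zero_le _) (this.trans (by simp))
        omega
      subst hii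
      rcases e with ⟨e, e'⟩ | ⟨e, e'⟩
      · have := getVert_inj (h.isPath i) hm.le hJl e
        subst this
        have : J + 1 ≤ J := Nat.le_findGreatest hm (e'.symm ▸ hy)
        omega
      · have := getVert_inj (h.isPath i) hm hJl e'
        rw [← this, ← e]
        rfl
    · refine ⟨x, hx, ?_⟩
      rintro y ⟨-, hxy⟩
      exact absurd ⟨y, hxy⟩ hxs

theorem mem_range (h : IsStar T p) {x y : V} (hxy : (edgeUnion p).Adj x y) (hx : x ∈ T.support) :
    x ∈ range w := by
  obtain ⟨i, hi⟩ := mem_support_of_adj hxy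
  by_contra hc
  exact h.inner i x hi (fun e => hc ⟨i, e.symm⟩) hx

/-- A cycle in the closure of a set of new vertices would need an edge of `T` between two ends.
Hypothesis `h2` rules this out for a path; with three legs or more, a set with at most two outer
neighbors misses the center and so has an outer neighbor off `T`. -/
theorem good_sup [Finite V] (hT : Good T C) (h : IsStar T p) (hk : 2 ≤ k)
    (h2 : k ≤ 2 → ∀ i j, ¬ T.Adj (w i) (w j))
    (h5 : ∀ A : Set V, Lk T C A → ¬ range w ⊆ A ∪ nbhd T A) : Good (T ⊔ edgeUnion p) C := by
  refine hT.sup (X := range w) ?_ h.ends_subset (fun A hne hA => h.two_le_ncard_nbhd hk hne hA) ?_ h5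
  · rintro _ ⟨i, rfl⟩
    exact h.ends i
  · intro A hne hA hle
    refine (h.acyc).mono (subset_univ _) ?_
    have hN : ∀ x ∈ A ∪ nbhd (edgeUnion p) A, x ∈ T.support →
        x ∈ nbhd (edgeUnion p) A ∧ x ∈ range w := by
      rintro x (hx | hx) hxT
      · exact absurd hxT (hA hx).2
      · obtain ⟨y, -, hyx⟩ := hx.2
        exact ⟨hx, h.mem_range hyx.symm hxT⟩
    rintro s hs t ht (hst | hst)
    · exfalso
      obtain ⟨hsN, i, rfl⟩ := hN s hs ⟨t, hst⟩
      obtain ⟨htN, j, rfl⟩ := hN t ht ⟨_, hst.symm⟩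
      have he : ({w i, w j} : Set V) = nbhd (edgeUnion p) A :=
        eq_of_subset_of_ncard_le (pair_subset hsN htN)
          (by rwa [ncard_pair (T.ne_of_adj hst)]) (toFinite _)
      by_cases hu : u ∈ A
      · exact h2 ((h.le_ncard_nbhd hA hu).trans hle) i j hst
      · obtain ⟨x, hx⟩ := hne
        obtain ⟨l, m, hm, rfl⟩ := h.exists_lt (hA hx)
        obtain ⟨m', hm', hmem⟩ := exists_down l hx hm.le hu
        have h1 := h.notMem l (hm'.trans hm)
        rw [← he] at hmem
        rcases hmem with e | e
        · exact h1 (e ▸ h.ends i)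
        · rw [mem_singleton_iff] at e
          exact h1 (e ▸ h.ends j)
    · exact hst

end IsStar

/-- The edge brings no new vertex, so the conditions of `Good.sup` on sets of new vertices are void.
-/
theorem good_sup_edge [Finite V] (hT : Good T C) {x y : V} (hx : x ∈ T.support)
    (hy : y ∈ T.support) (h5 : ∀ A : Set V, Lk T C A → ¬ {x, y} ⊆ A ∪ nbhd T A) :
    Good (T ⊔ edge x y) C := by
  have hno : ∀ A : Set V, A.Nonempty → ¬ A ⊆ (edge x y).support \ T.support := by
    rintro A ⟨z, hz⟩ hA
    obtain ⟨⟨z', hzz⟩, hzT⟩ := hA hz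
    replace hzz : (edge x y).Adj z z' := hzz
    rw [edge_adj] at hzz
    rcases hzz.1 with ⟨rfl, -⟩ | ⟨rfl, -⟩
    · exact hzT hx
    · exact hzT hy
  refine hT.sup (X := {x, y}) (pair_subset hx hy) ?_ (fun A h1 h2 => absurd h2 (hno A h1))
    (fun A h1 h2 => absurd h2 (hno A h1)) h5
  rintro K - ⟨a, ha, b, hb, hab⟩
  rw [edge_adj] at hab
  rcases hab.1 with ⟨rfl, rfl⟩ | ⟨rfl, rfl⟩
  · exact pair_subset ha hb
  · exact pair_subset hb ha

end ConvexReduction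

namespace ConvexReduction

variable {V : Type u} {T T' S Y Cg : SimpleGraph V} {C A B K : Set V}

open SimpleGraph

/-! ### Components outside a subgraph -/

/-- The vertices that can be reached from `v` in `S` without touching `T`. -/
def comp (S T : SimpleGraph V) (v : V) : Set V :=
  {x | ∃ p : S.Walk v x, ∀ y ∈ p.support, y ∉ T.support}

theorem mem_comp_self {v : V} (hv : v ∉ T.support) : v ∈ comp S T v :=
  ⟨Walk.nil, by simpa using hv⟩

theorem comp_disjoint {v x : V} (hx : x ∈ comp S T v) : x ∉ T.support := by
  obtain ⟨p, hp⟩ := hx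
  exact hp x p.end_mem_support

theorem comp_trans {v x y : V} (hx : x ∈ comp S T v) (hy : y ∈ comp S T x) : y ∈ comp S T v := by
  obtain ⟨p, hp⟩ := hx
  obtain ⟨q, hq⟩ := hy
  refine ⟨p.append q, fun z hz => ?_⟩
  rw [Walk.mem_support_append_iff] at hz
  exact hz.elim (hp z) (hq z)

theorem comp_symm {v x : V} (hx : x ∈ comp S T v) : v ∈ comp S T x := by
  obtain ⟨p, hp⟩ := hx
  exact ⟨p.reverse, by simpa using hp⟩

theorem comp_eq {v x : V} (hx : x ∈ comp S T v) : comp S T x = comp S T v :=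
  Subset.antisymm (fun _ h => comp_trans hx h) fun _ h => comp_trans (comp_symm hx) h

theorem comp_adj {v x y : V} (hx : x ∈ comp S T v) (h : S.Adj x y) (hy : y ∉ T.support) :
    y ∈ comp S T v :=
  comp_trans hx ⟨h.toWalk, fun z hz => by
    simp only [Adj.toWalk, Walk.support_cons, Walk.support_nil, List.mem_cons, List.not_mem_nil,
      or_false] at hz
    rcases hz with rfl | rfl
    · exact comp_disjoint hx
    · exact hy⟩

theorem nbhd_comp_subset {v : V} : nbhd S (comp S T v) ⊆ T.support := by
  rintro y ⟨hy, x, hx, hxy⟩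
  by_contra hyT
  exact hy (comp_adj hx hxy hyT)

theorem comp_subset_support {v : V} (hv : v ∈ S.support) : comp S T v ⊆ S.support := by
  rintro x ⟨p, -⟩
  rcases Nat.eq_zero_or_pos p.length with h | h
  · exact (Walk.eq_of_length_eq_zero h) ▸ hv
  · exact support_subset_support h p.end_mem_support

theorem comp_walk {v x y : V} (hx : x ∈ comp S T v) (hy : y ∈ comp S T v) :
    ∃ p : S.Walk x y, ∀ z ∈ p.support, z ∈ comp S T v := by
  classical
  obtain ⟨p, hp⟩ : y ∈ comp S T x := comp_trans (comp_symm hx) hy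
  refine ⟨p, fun z hz => comp_trans hx ⟨p.takeUntil z hz, fun y hy => hp y ?_⟩⟩
  exact p.support_takeUntil_subset_support hz hy

theorem exists_path_through {v a b : V} (ha : a ∈ nbhd S (comp S T v))
    (hb : b ∈ nbhd S (comp S T v)) (hab : a ≠ b) :
    ∃ P : S.Walk a b, P.IsPath ∧ (∀ x ∈ P.support, x ≠ a → x ≠ b → x ∈ comp S T v) ∧
      ∃ x ∈ P.support, x ∈ comp S T v := by
  classical
  obtain ⟨haD, d, hd, hda⟩ := ha
  obtain ⟨hbD, e, he, heb⟩ := hb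
  obtain ⟨q, hq⟩ := comp_walk hd he
  let W : S.Walk a b := Walk.cons hda.symm (q.concat heb)
  have hW : ∀ x ∈ W.support, x = a ∨ x ∈ comp S T v ∨ x = b := by
    intro x hx
    simp only [W, Walk.support_cons, Walk.support_concat, List.mem_cons, List.mem_append,
      List.not_mem_nil, or_false] at hx
    rcases hx with hx | hx | hx
    · exact Or.inl hx
    · exact Or.inr (Or.inl (hq x hx))
    · exact Or.inr (Or.inr hx)
  have hWe : ∀ x y, s(x, y) ∈ W.edges → x ∈ comp S T v ∨ y ∈ comp S T v := by
    intro x y hxy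
    simp only [W, Walk.edges_cons, Walk.edges_concat, List.mem_cons, List.concat_eq_append,
      List.mem_append, List.not_mem_nil, or_false] at hxy
    rcases hxy with h | h | h
    · rw [Sym2.eq_iff] at h
      rcases h with ⟨rfl, rfl⟩ | ⟨rfl, rfl⟩
      · exact Or.inr hd
      · exact Or.inl hd
    · exact Or.inl (hq x (q.fst_mem_support_of_mem_edges h))
    · rw [Sym2.eq_iff] at h
      rcases h with ⟨rfl, rfl⟩ | ⟨rfl, rfl⟩
      · exact Or.inl he
      · exact Or.inr he
  refine ⟨W.bypass, W.bypass_isPath, ?_, ?_⟩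
  · intro x hx hxa hxb
    rcases hW x (W.support_bypass_subset_support hx) with h | h | h
    · exact absurd h hxa
    · exact h
    · exact absurd h hxb
  · have hlen : 0 < W.bypass.length := by
      rw [Nat.pos_iff_ne_zero]
      exact fun h => hab (Walk.eq_of_length_eq_zero h)
    have h1 : s(W.bypass.getVert 0, W.bypass.getVert (0 + 1)) ∈ W.bypass.edges :=
      mem_edges_iff.2 ⟨0, hlen, rfl⟩
    rcases hWe _ _ (W.edges_bypass_subset_edges h1) with h | h
    · rw [Walk.getVert_zero] at h
      exact absurd h haD
    · exact ⟨_, W.bypass.getVert_mem_support _, h⟩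

theorem exists_first_hit {x y : V} (p : S.Walk x y) (Z : Set V) (hy : y ∈ Z) :
    ∃ z ∈ Z, ∃ q : S.Walk x z, q.IsPath ∧ (∀ a ∈ q.support, a ∈ p.support) ∧
      ∀ a ∈ q.support, a ∈ Z → a = z := by
  classical
  induction p with
  | nil => exact ⟨_, hy, Walk.nil, by simp, by simp, by simp⟩
  | @cons u v w h p ih =>
    by_cases hu : u ∈ Z
    · exact ⟨u, hu, Walk.nil, by simp, by simp, by simp⟩
    · obtain ⟨z, hz, q, -, hq2, hq3⟩ := ih hy
      refine ⟨z, hz, (Walk.cons h q).bypass, Walk.bypass_isPath _, ?_, ?_⟩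
      · intro a ha
        have := Walk.support_bypass_subset_support _ ha
        simp only [Walk.support_cons, List.mem_cons] at this ⊢
        exact this.imp_right (hq2 a)
      · intro a ha haZ
        have := Walk.support_bypass_subset_support _ ha
        simp only [Walk.support_cons, List.mem_cons] at this
        rcases this with rfl | this
        · exact absurd haZ hu
        · exact hq3 a this haZ

theorem eq_of_mem_takeUntil_dropUntil [DecidableEq V] {a b u x : V} {P : S.Walk a b}
    (hP : P.IsPath) (hu : u ∈ P.support) (h1 : x ∈ (P.takeUntil u hu).support)
    (h2 : x ∈ (P.dropUntil u hu).support) : x = u := by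
  have h := hP.support_nodup
  rw [← P.take_spec hu, Walk.support_append, List.nodup_append'] at h
  rw [← Walk.cons_tail_support, List.mem_cons] at h2
  rcases h2 with h2 | h2
  · exact h2
  · exact absurd h2 (h.2.2 h1)

theorem edgeUnion_le {ι : Type*} {a b : ι → V} {p : ∀ i, S.Walk (a i) (b i)} :
    edgeUnion p ≤ S := by
  intro x y h
  obtain ⟨i, hi⟩ := edgeUnion_adj.1 h
  exact (p i).adj_of_mem_edges hi

/-- The two halves of a path form a star. -/
theorem exists_star_two {v a b : V} (P : S.Walk a b) (hP : P.IsPath)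
    (hin : ∀ x ∈ P.support, x ≠ a → x ≠ b → x ∈ comp S T v) {u : V} (hu : u ∈ P.support)
    (huD : u ∈ comp S T v) (haT : a ∈ T.support) (hbT : b ∈ T.support) :
    ∃ p : ∀ i : Fin 2, S.Walk u (![a, b] i), IsStar T p ∧
      ∀ e, e ∈ P.edges ↔ ∃ i, e ∈ (p i).edges := by
  classical
  let p : ∀ i : Fin 2, S.Walk u (![a, b] i) := fun i => match i with
    | 0 => (P.takeUntil u hu).reverse
    | 1 => P.dropUntil u hu
  have hsub : ∀ i, ∀ x ∈ (p i).support, x ∈ P.support := by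
    intro i x hx
    fin_cases i
    · exact P.support_takeUntil_subset_support hu (by simpa [p] using hx)
    · exact P.support_dropUntil_subset_support hu hx
  have hdis : ∀ x, x ∈ (p 0).support → x ∈ (p 1).support → x = u := fun x h1 h2 =>
    eq_of_mem_takeUntil_dropUntil hP hu (by simpa [p] using h1) h2
  have hau : a ≠ u := fun h => comp_disjoint huD (h ▸ haT)
  have hbu : b ≠ u := fun h => comp_disjoint huD (h ▸ hbT)
  refine ⟨p, ⟨?_, comp_disjoint huD, ?_, ?_, ?_⟩, ?_⟩
  · intro i
    fin_cases i
    · exact (hP.takeUntil hu).reverse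
    · exact hP.dropUntil hu
  · intro i
    fin_cases i
    · exact haT
    · exact hbT
  · intro i x hx hne
    refine comp_disjoint (v := v) (S := S) (hin x (hsub i x hx) ?_ ?_)
    · rintro rfl
      fin_cases i
      · exact hne rfl
      · exact hau (hdis x (p 0).end_mem_support hx)
    · rintro rfl
      fin_cases i
      · exact hbu (hdis x hx (p 1).end_mem_support)
      · exact hne rfl
  · intro i j hij x hi hj
    fin_cases i <;> fin_cases j
    · exact absurd rfl hij
    · exact hdis x hi hj
    · exact hdis x hj hi
    · exact absurd rfl hij
  · intro e
    rw [Fin.exists_fin_two]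
    conv_lhs => rw [← P.take_spec hu, Walk.edges_append, List.mem_append]
    simp [p]

/-- Take a path from `a` to `b` through the component, and a path from `c` through the component
stopped when it first meets the former; the meeting point is the center. -/
theorem exists_star_three {v a b c : V} (ha : a ∈ nbhd S (comp S T v))
    (hb : b ∈ nbhd S (comp S T v)) (hc : c ∈ nbhd S (comp S T v)) (hab : a ≠ b) (hac : a ≠ c)
    (hbc : b ≠ c) : ∃ (u : V) (p : ∀ i : Fin 3, S.Walk u (![a, b, c] i)), IsStar T p := by
  classical
  obtain ⟨P, hP, hin, u₀, hu₀, hu₀D⟩ := exists_path_through ha hb hab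
  have haT := nbhd_comp_subset ha
  have hbT := nbhd_comp_subset hb
  have hcT := nbhd_comp_subset hc
  obtain ⟨hcD, d, hd, hdc⟩ := hc
  obtain ⟨r, hr⟩ := comp_walk hd hu₀D
  obtain ⟨u, ⟨huP, huD⟩, q, hq, hqs, hqZ⟩ := exists_first_hit (Walk.cons hdc.symm r)
    {x | x ∈ P.support ∧ x ∈ comp S T v} ⟨hu₀, hu₀D⟩
  have hqD : ∀ x ∈ q.support, x ≠ c → x ∈ comp S T v := by
    intro x hx hxc
    have := hqs x hx
    simp only [Walk.support_cons, List.mem_cons] at this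
    exact hr x (this.resolve_left hxc)
  have hcP : c ∉ P.support := fun h => hcD (hin c h hac.symm hbc.symm)
  have hqP : ∀ x ∈ q.support, x ∈ P.support → x = u := fun x hx hxP =>
    hqZ x hx ⟨hxP, hqD x hx fun h => hcP (h ▸ hxP)⟩
  obtain ⟨p', hp', hedges⟩ := exists_star_two P hP hin huP huD haT hbT
  let p : ∀ i : Fin 3, S.Walk u (![a, b, c] i) := fun i => match i with
    | 0 => p' 0
    | 1 => p' 1
    | 2 => q.reverse
  have hsub : ∀ i, ∀ x ∈ (p' i).support, x ∈ P.support := by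
    intro i x hx
    obtain ⟨j, hj, rfl⟩ := mem_support_iff.1 hx
    rcases Nat.eq_zero_or_pos j with rfl | hj0
    · rw [Walk.getVert_zero]
      exact huP
    · have h1 : s((p' i).getVert (j - 1), (p' i).getVert (j - 1 + 1)) ∈ P.edges :=
        (hedges _).2 ⟨i, mem_edges_iff.2 ⟨j - 1, by omega, rfl⟩⟩
      rw [Nat.sub_add_cancel hj0] at h1
      exact P.snd_mem_support_of_mem_edges h1
  have hq2 : ∀ x, x ∈ (p 2).support → x ∈ q.support := fun x hx => by simpa [p] using hx
  refine ⟨u, p, ⟨?_, comp_disjoint huD, ?_, ?_, ?_⟩⟩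
  · intro i
    fin_cases i
    · exact hp'.isPath 0
    · exact hp'.isPath 1
    · exact hq.reverse
  · intro i
    fin_cases i
    · exact haT
    · exact hbT
    · exact hcT
  · intro i x hx hne
    fin_cases i
    · exact hp'.inner 0 x hx hne
    · exact hp'.inner 1 x hx hne
    · exact comp_disjoint (hqD x (hq2 x hx) hne)
  · intro i j hij x hi hj
    fin_cases i <;> fin_cases j
    · exact absurd rfl hij
    · exact hp'.disjoint 0 1 (by decide) x hi hj
    · exact hqP x (hq2 x hj) (hsub 0 x hi)
    · exact hp'.disjoint 1 0 (by decide) x hi hj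
    · exact absurd rfl hij
    · exact hqP x (hq2 x hj) (hsub 1 x hi)
    · exact hqP x (hq2 x hi) (hsub 0 x hj)
    · exact hqP x (hq2 x hi) (hsub 1 x hj)
    · exact absurd rfl hij

/-! ### The two kinds of steps -/

/-- Graphs on `V` never lose vertices, so a deleted vertex is one that leaves the support. The
condition on supports says that exactly the inner vertices of the path become isolated. -/
def PathStep (C : Set V) (S T : SimpleGraph V) : Prop :=
  ∃ (a b : V) (p : S.Walk a b), IsLink C p ∧ T = S.deleteEdges p.edgeSet ∧
    T.support = S.support \ interiorVerts p

def ClawStep (C : Set V) (S T : SimpleGraph V) : Prop :=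
  ∃ u ∈ S.support, u ∉ C ∧ (S.neighborSet u).ncard = 3 ∧
    ∃ (w : Fin 3 → V) (p : ∀ i, S.Walk u (w i)),
      (∀ i, (p i).IsPath ∧ w i ∈ C ∧
        ∀ x ∈ interiorVerts (p i), x ∉ C ∧ (S.neighborSet x).ncard = 2) ∧
      (∀ i j, i ≠ j → ∀ x, x ∈ (p i).support → x ∈ (p j).support → x = u) ∧
      T = S.deleteEdges (⋃ i, (p i).edgeSet) ∧
      T.support = S.support \ ({u} ∪ ⋃ i, interiorVerts (p i))

theorem ncard_neighborSet_eq_two [Finite V] {a b x : V} {p : S.Walk a b} (hp : p.IsPath)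
    (hx : x ∈ interiorVerts p) (h : ∀ y, S.Adj x y → s(x, y) ∈ p.edges) :
    (S.neighborSet x).ncard = 2 := by
  obtain ⟨i, h0, hi, rfl⟩ := (mem_interiorVerts_iff hp).1 hx
  rw [← hp.ncard_neighborSet_toSubgraph_internal_eq_two h0.ne' hi]
  congr 1
  ext y
  refine ⟨fun hy => ?_, fun hy => p.toSubgraph.adj_sub hy⟩
  have := h y hy
  rwa [← Walk.mem_edges_toSubgraph, Subgraph.mem_edgeSet] at this

end ConvexReduction

/-! ### Vertices on a common link, and deletion of a link -/

namespace ConvexReduction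

variable {V : Type u} {T T' S Y Cg : SimpleGraph V} {C A B K : Set V}

open SimpleGraph

/-- Two vertices that lie on a common link. -/
def Colinked (T : SimpleGraph V) (C : Set V) (x y : V) : Prop :=
  T.Adj x y ∨ ∃ A, Lk T C A ∧ x ∈ A ∪ nbhd T A ∧ y ∈ A ∪ nbhd T A

/-- Otherwise `{a}` would itself be such a set. -/
theorem branch_of_not_lk [Finite V] {a : V} (haT : a ∈ T.support)
    (ha : ∀ A, Lk T C A → a ∉ A) : Branch T C a := by
  by_contra hb
  rw [Branch, not_or, not_not] at hb
  refine ha {a} ⟨singleton_nonempty a, singleton_subset_iff.2 ⟨haT, hb.1⟩, ?_⟩ rfl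
  rw [← hb.2]
  refine ncard_le_ncard ?_ (toFinite _)
  rintro y ⟨-, x, rfl, h⟩
  exact h

theorem isLink_toWalk {a b : V} (h : T.Adj a b) : IsLink C h.toWalk := by
  refine ⟨by simp [T.ne_of_adj h], by simp, ?_⟩
  rintro z ⟨hz, h1, h2⟩
  simp at hz
  tauto

/-- If `a` and `b` are the outer neighbors of `A`, follow the maximal link that enters `A` from `a`.
All vertices of `A` have degree 2, so the link must leave `A`, which it can do only at `b`, and it
ends there because `b` is a branch vertex. -/
theorem Good.exists_link_of_colinked [Finite V] (hT : Good T C) {a b : V} (hab : a ≠ b)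
    (haT : a ∈ T.support) (hbT : b ∈ T.support)
    (ha : ∀ A, Lk T C A → a ∉ A) (hb : ∀ A, Lk T C A → b ∉ A) (h : Colinked T C a b) :
    ∃ q : T.Walk a b, IsLink C q := by
  rcases h with h | ⟨A, hA, haA, hbA⟩
  · exact ⟨h.toWalk, isLink_toWalk h⟩
  · have ha' := haA.resolve_left (ha A hA)
    have hb' := hbA.resolve_left (hb A hA)
    have hN : {a, b} = nbhd T A := eq_of_subset_of_ncard_le (pair_subset ha' hb')
      (by rw [ncard_pair hab]; exact hA.le) (toFinite _)
    obtain ⟨-, x, hx, hxa⟩ := ha'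
    have hbra := branch_of_not_lk haT ha
    have hbrb := branch_of_not_lk hbT hb
    have hA' : ∀ y, Branch T C y → y ∉ A := by
      rintro y (h | h) hy
      · exact (hA.subset hy).2 h
      · exact h (hT.lk_degree hA hy)
    obtain ⟨c, d, r, hr, he, hc, hd⟩ := hT.exists_link hxa
    obtain ⟨d, r, hr, hxr, hd⟩ : ∃ (d : V) (r : T.Walk a d), IsLink C r ∧ x ∈ r.support ∧
        Branch T C d := by
      have hars := r.snd_mem_support_of_mem_edges he
      have hxrs := r.fst_mem_support_of_mem_edges he
      by_cases hac : a = c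
      · subst hac
        exact ⟨d, r, hr, hxrs, hd⟩
      · by_cases had : a = d
        · subst had
          exact ⟨c, r.reverse, hr.reverse, by simpa using hxrs, hc⟩
        · exact absurd hbra (hr.not_branch ⟨hars, hac, had⟩)
    obtain ⟨j, hj, rfl⟩ := mem_support_iff.1 hxr
    have hex : ∃ m, 0 < m ∧ m ≤ r.length ∧ r.getVert m ∈ nbhd T A := by
      by_contra! hcon
      have : ∀ m, j + m ≤ r.length → r.getVert (j + m) ∈ A := by
        intro m
        induction m with
        | zero => exact fun _ => hx
        | succ m ih =>
          intro hm
          by_contra hn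
          exact hcon (j + (m + 1)) (by omega) (by omega)
            ⟨hn, _, ih (by omega), r.adj_getVert_succ (by omega)⟩
      have := this (r.length - j) (by omega)
      rw [show j + (r.length - j) = r.length by omega, Walk.getVert_length] at this
      exact hA' d hd this
    obtain ⟨m, hm0, hm, hmem⟩ := hex
    have hmb : r.getVert m = b := by
      rw [← hN] at hmem
      rcases hmem with e | e
      · have := getVert_inj hr.isPath hm (Nat.zero_le _) (e.trans (by simp))
        omega
      · exact e
    rcases hm.lt_or_eq with hlt | rfl
    · exact absurd (hmb ▸ hbrb)
        (hr.not_branch ((mem_interiorVerts_iff hr.isPath).2 ⟨m, hm0, hlt, rfl⟩))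
    · rw [Walk.getVert_length] at hmb
      subst hmb
      exact ⟨r, hr⟩

/-! ### Deleting a link -/

/-- The star offers a detour from `w i` to `w j` that replaces the link `q`. A set that gains few
outer neighbors from the loss of `q` is compared with a set in `S`; one that separates the ends of
`q` is also crossed by the detour. -/
theorem good_delete_link [Finite V] {k : ℕ} {u : V} {w : Fin k → V} {p : ∀ i, S.Walk u (w i)}
    (hS : Good S C) (hs : IsStar T p)
    (hST : S = T ⊔ edgeUnion p) (hbr : ∀ i A, Lk T C A → w i ∉ A) {i j : Fin k}
    {q : T.Walk (w i) (w j)} (hq : IsLink C q) :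
    Good (S.deleteEdges q.edgeSet) C := by
  set T2 := S.deleteEdges q.edgeSet with hT2
  have hT2S : T2 ≤ S := deleteEdges_le _
  have hTS : T ≤ S := hST ▸ le_sup_left
  have adj2 : ∀ x y, T2.Adj x y ↔ S.Adj x y ∧ s(x, y) ∉ q.edges := fun x y => by
    rw [hT2, deleteEdges_adj]
    rfl
  have hYT2 : edgeUnion p ≤ T2 := by
    intro x y hxy
    refine (adj2 x y).2 ⟨edgeUnion_le hxy, fun he => ?_⟩
    have hx := support_subset_support hq.pos (q.fst_mem_support_of_mem_edges he)
    have hy := support_subset_support hq.pos (q.snd_mem_support_of_mem_edges he)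
    obtain ⟨l, m, hm, e⟩ := IsStar.exists_index hxy
    have := hs.notMem l hm
    rcases e with ⟨e, -⟩ | ⟨e, -⟩
    · exact this (e ▸ hx)
    · exact this (e ▸ hy)
  have hI : ∀ x ∈ interiorVerts q, ∀ y, S.Adj x y → s(x, y) ∈ q.edges := by
    intro x hx y hxy
    rw [hST] at hxy
    rcases hxy with hxy | hxy
    · exact hq.mem_edges hx hxy
    · obtain ⟨l, rfl⟩ := hs.mem_range hxy (support_subset_support hq.pos hx.1)
      exact absurd hx (hbr l _ (hq.lk ⟨_, hx⟩))
  have hqs : ∀ x ∈ q.support, x ∈ interiorVerts q ∨ x = w i ∨ x = w j := by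
    intro x hx
    by_cases h : x = w i ∨ x = w j
    · exact Or.inr h
    · rw [not_or] at h
      exact Or.inl ⟨hx, h⟩
  intro A hne hA
  have hAI : ∀ x ∈ A, x ∉ interiorVerts q := by
    intro x hx hxI
    obtain ⟨y, hxy⟩ := (hA hx).1
    have := (adj2 x y).1 hxy
    exact this.2 (hI x hxI y this.1)
  set N := nbhd T2 A with hN
  -- The detour through `u` leaves `A` at a vertex `z` off `T`. If `N` had at most two elements,
  -- then in `T` the part of `A` together with the inside of `q` would have `w j'` and at most one
  -- more outer neighbor, and so be a link set containing the end `w i'`.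
  have hard : ∀ i' j', s(w i', w j') = s(w i, w j) → w i' ∈ A → w j' ∉ A ∪ N → 2 < N.ncard := by
    intro i' j' hij ha hb
    have hqs' : ∀ x ∈ q.support, x ∈ interiorVerts q ∨ x = w i' ∨ x = w j' := by
      intro x hx
      refine (hqs x hx).imp_right fun h => ?_
      rw [Sym2.eq_iff] at hij
      rcases hij with ⟨h1, h2⟩ | ⟨h1, h2⟩
      · rw [h1, h2]
        exact h
      · rw [h1, h2]
        exact h.symm
    rw [mem_union, not_or] at hb
    have hYN : nbhd (edgeUnion p) A ⊆ N := by
      rintro y ⟨hy, x, hx, hxy⟩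
      exact ⟨hy, x, hx, hYT2 hxy⟩
    obtain ⟨z, hzN, hzT⟩ : ∃ z ∈ N, z ∉ T.support := by
      by_cases hu : u ∈ A
      · obtain ⟨m, hm1, hm2, hm⟩ := IsStar.exists_up (p := p) j' (j := 0) (A := A) (by simpa using hu)
          (Nat.zero_le _) hb.1
        refine ⟨_, hYN hm, hs.notMem j' (lt_of_le_of_ne hm2 ?_)⟩
        rintro rfl
        rw [Walk.getVert_length] at hm
        exact hb.2 (hYN hm)
      · obtain ⟨m, hm1, hm⟩ := IsStar.exists_down (p := p) i' (j := (p i').length) (A := A)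
          (by simpa using ha) le_rfl hu
        exact ⟨_, hYN hm, hs.notMem i' hm1⟩
    by_contra hle
    have haT : w i' ∈ A ∩ T.support ∪ interiorVerts q := Or.inl ⟨ha, hs.ends i'⟩
    have hsub : nbhd T (A ∩ T.support ∪ interiorVerts q) ⊆ insert (w j') (N \ {z}) := by
      rintro y ⟨hy, x, hx, hxy⟩
      have hyq : y ∈ q.support → y = w j' := by
        intro h
        rcases hqs' y h with h | rfl | h
        · exact absurd (Or.inr h) hy
        · exact absurd haT hy
        · exact h
      rcases hx with hx | hx
      · by_cases he : s(x, y) ∈ q.edges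
        · exact Or.inl (hyq (q.snd_mem_support_of_mem_edges he))
        · have hyT : y ∈ T.support := ⟨x, hxy.symm⟩
          refine Or.inr ⟨⟨fun h => hy (Or.inl ⟨h, hyT⟩), x, hx.1, (adj2 x y).2 ⟨hTS hxy, he⟩⟩, ?_⟩
          rintro rfl
          exact hzT hyT
      · exact Or.inl (hyq (q.snd_mem_support_of_mem_edges (hq.mem_edges hx hxy)))
    refine hbr i' _ ⟨⟨_, haT⟩, ?_, ?_⟩ haT
    · rintro x (hx | hx)
      · exact ⟨hx.2, (hA hx.1).2⟩
      · exact ⟨support_subset_support hq.pos hx.1, (hq.inner x hx).1⟩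
    · have h1 := ncard_le_ncard hsub (toFinite _)
      have h2 := ncard_insert_le (w j') (N \ {z})
      have h3 := ncard_sdiff_singleton_lt_of_mem hzN (toFinite _)
      omega
  by_cases hcase : (w i ∈ A → w j ∈ A ∪ N) ∧ (w j ∈ A → w i ∈ A ∪ N)
  · have easy : ∀ D : Set V, A ⊆ D → D ⊆ S.support \ C → nbhd S D ⊆ N →
        2 ≤ N.ncard ∧ (N.ncard ≤ 2 → Acyc T2 (A ∪ N)) := by
      intro D hAD hD hDN
      have h1 := hS D (hne.mono hAD) hD
      refine ⟨h1.1.trans (ncard_le_ncard hDN (toFinite _)), fun hle => ?_⟩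
      have he : nbhd S D = N := eq_of_subset_of_ncard_le hDN (hle.trans h1.1) (toFinite _)
      refine (h1.2 (he ▸ hle)).mono ?_ fun x _ y _ h => hT2S h
      rw [he]
      exact union_subset_union_left _ hAD
    have hAS : A ⊆ S.support \ C := fun x hx => by
      obtain ⟨⟨y, hy⟩, h⟩ := hA hx
      exact ⟨⟨y, hT2S hy⟩, h⟩
    by_cases hin : w i ∈ A ∨ w j ∈ A
    · refine easy (A ∪ interiorVerts q) subset_union_left (union_subset hAS fun x hx => ?_) ?_
      · obtain ⟨y, hy⟩ := support_subset_support hq.pos hx.1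
        exact ⟨⟨y, hTS hy⟩, (hq.inner x hx).1⟩
      · rintro y ⟨hy, x, hx, hxy⟩
        rw [mem_union, not_or] at hy
        have hyq : y ∈ q.support → y ∈ N := by
          intro h
          rcases hqs y h with h | rfl | rfl
          · exact absurd h hy.2
          · exact (hcase.2 (hin.resolve_left hy.1)).resolve_left hy.1
          · exact (hcase.1 (hin.resolve_right hy.1)).resolve_left hy.1
        rcases hx with hx | hx
        · by_cases he : s(x, y) ∈ q.edges
          · exact hyq (q.snd_mem_support_of_mem_edges he)
          · exact ⟨hy.1, x, hx, (adj2 x y).2 ⟨hxy, he⟩⟩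
        · exact hyq (q.snd_mem_support_of_mem_edges (hI x hx y hxy))
    · rw [not_or] at hin
      refine easy A subset_rfl hAS ?_
      rintro y ⟨hy, x, hx, hxy⟩
      refine ⟨hy, x, hx, (adj2 x y).2 ⟨hxy, fun he => ?_⟩⟩
      rcases hqs x (q.fst_mem_support_of_mem_edges he) with h | rfl | rfl
      · exact hAI x hx h
      · exact hin.1 hx
      · exact hin.2 hx
  · have h2 : 2 < N.ncard := by
      rw [not_and_or] at hcase
      rcases hcase with h | h
      · push Not at h
        exact hard i j rfl h.1 h.2
      · push Not at h
        exact hard j i Sym2.eq_swap h.1 h.2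
    exact ⟨h2.le, fun h => absurd h2 (not_lt.2 h)⟩

/-- Since `w i` is off `C`, at most one vertex of `q` lies on `C`, so no edge of the outer cycle is
deleted. -/
theorem step_delete_link [Finite V] {k : ℕ} {u : V} {w : Fin k → V} {p : ∀ i, S.Walk u (w i)}
    (hS : Good S C) (hs : IsStar T p)
    (hST : S = T ⊔ edgeUnion p) (hbr : ∀ i A, Lk T C A → w i ∉ A) {i j : Fin k}
    {q : T.Walk (w i) (w j)} (hq : IsLink C q) (hCg : Cg ≤ T) (hCs : Cg.support = C)
    (hi : w i ∉ C) : ∃ T', Cg ≤ T' ∧ T' < S ∧ Good T' C ∧ PathStep C S T' := by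
  have hTS : T ≤ S := hST ▸ le_sup_left
  have hqs : ∀ x ∈ q.support, x ∈ interiorVerts q ∨ x = w i ∨ x = w j := by
    intro x hx
    by_cases h : x = w i ∨ x = w j
    · exact Or.inr h
    · rw [not_or] at h
      exact Or.inl ⟨hx, h⟩
  have hI : ∀ x ∈ interiorVerts q, ∀ y, S.Adj x y → s(x, y) ∈ q.edges := by
    intro x hx y hxy
    rw [hST] at hxy
    rcases hxy with hxy | hxy
    · exact hq.mem_edges hx hxy
    · obtain ⟨l, rfl⟩ := hs.mem_range hxy (support_subset_support hq.pos hx.1)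
      exact absurd hx (hbr l _ (hq.lk ⟨_, hx⟩))
  have hedge : ∀ x y, s(x, y) ∈ q.edges → x ∉ C ∨ y ∉ C := by
    intro x y he
    by_contra! hc
    have h1 : ∀ z ∈ q.support, z ∈ C → z = w j := by
      intro z hz hzC
      rcases hqs z hz with h | rfl | h
      · exact absurd hzC (hq.inner z h).1
      · exact absurd hzC hi
      · exact h
    have h2 := h1 x (q.fst_mem_support_of_mem_edges he) hc.1
    have h3 := h1 y (q.snd_mem_support_of_mem_edges he) hc.2
    exact T.ne_of_adj (q.adj_of_mem_edges he) (h2.trans h3.symm)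
  have hlen := hq.pos
  refine ⟨S.deleteEdges q.edgeSet, ?_, lt_of_le_of_ne (deleteEdges_le _) ?_,
    good_delete_link hS hs hST hbr hq, w i, w j, q.mapLe hTS, ⟨?_, ?_, ?_⟩, ?_, ?_⟩
  · intro x y hxy
    refine deleteEdges_adj.2 ⟨hTS (hCg hxy), fun he => ?_⟩
    rcases hedge x y he with h | h
    · exact h (hCs ▸ ⟨y, hxy⟩)
    · exact h (hCs ▸ ⟨x, hxy.symm⟩)
  · intro h
    have h1 : s(q.getVert 0, q.getVert (0 + 1)) ∈ q.edges := mem_edges_iff.2 ⟨0, hlen, rfl⟩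
    have h2 : S.Adj (q.getVert 0) (q.getVert (0 + 1)) := hTS (q.adj_getVert_succ hlen)
    rw [← h, deleteEdges_adj] at h2
    exact h2.2 h1
  · exact hq.isPath.mapLe hTS
  · simpa using hlen
  · intro x hx
    have hx' : x ∈ interiorVerts q := by
      obtain ⟨h1, h2⟩ := hx
      exact ⟨by simpa using h1, h2⟩
    exact ⟨(hq.inner x hx').1, ncard_neighborSet_eq_two (hq.isPath.mapLe hTS) hx
      fun y hy => by simpa using hI x hx' y hy⟩
  · congr 1
    ext e
    change e ∈ q.edges ↔ e ∈ (q.mapLe hTS).edges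
    simp
  · have hint : interiorVerts (q.mapLe hTS) = interiorVerts q := by
      ext x
      simp [interiorVerts]
    rw [hint]
    ext x
    constructor
    · rintro ⟨y, hxy⟩
      replace hxy : (S.deleteEdges q.edgeSet).Adj x y := hxy
      rw [deleteEdges_adj] at hxy
      exact ⟨⟨y, hxy.1⟩, fun hx => hxy.2 (hI x hx y hxy.1)⟩
    · rintro ⟨⟨y, hxy⟩, hx⟩
      replace hxy : S.Adj x y := hxy
      by_cases he : s(x, y) ∈ q.edges
      · obtain ⟨l, rfl⟩ : ∃ l, x = w l := by
          rcases hqs x (q.fst_mem_support_of_mem_edges he) with h | h | h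
          · exact absurd h hx
          · exact ⟨i, h⟩
          · exact ⟨j, h⟩
        -- An end of `q` does not become isolated: it keeps the last edge of its star leg.
        have hl0 : 0 < (p l).length := by
          rw [Nat.pos_iff_ne_zero]
          intro h
          exact hs.center (Walk.eq_of_length_eq_zero h ▸ hs.ends l)
        have h1 := IsStar.adj (p := p) l (show (p l).length - 1 < (p l).length by omega)
        rw [Nat.sub_add_cancel hl0, Walk.getVert_length] at h1
        refine ⟨(p l).getVert ((p l).length - 1), ?_⟩
        refine deleteEdges_adj.2 ⟨edgeUnion_le h1.symm, fun he' => ?_⟩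
        exact hs.notMem l (show (p l).length - 1 < (p l).length by omega)
          (support_subset_support hq.pos (q.snd_mem_support_of_mem_edges he'))
      · exact ⟨y, deleteEdges_adj.2 ⟨hxy, he⟩⟩

end ConvexReduction

/-! ### One reduction step from a maximal good proper subgraph -/

namespace ConvexReduction

variable {V : Type u} {T T' S Y Cg : SimpleGraph V} {C A B K : Set V}

open SimpleGraph

theorem step_of_sup_edge [Finite V] {x y : V} (hST : S = T ⊔ edge x y) (hx : x ∈ T.support)
    (hy : y ∈ T.support) (hxy : S.Adj x y) (hT : ¬ T.Adj x y) : PathStep C S T := by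
  refine ⟨x, y, hxy.toWalk, isLink_toWalk hxy, ?_, ?_⟩
  · ext a b
    rw [deleteEdges_adj]
    have h1 : s(a, b) ∈ hxy.toWalk.edgeSet ↔ s(a, b) = s(x, y) := by
      change s(a, b) ∈ hxy.toWalk.edges ↔ _
      simp
    rw [h1]
    constructor
    · intro h
      refine ⟨hST ▸ Or.inl h, fun e => hT ?_⟩
      rw [Sym2.eq_iff] at e
      rcases e with ⟨rfl, rfl⟩ | ⟨rfl, rfl⟩
      · exact h
      · exact h.symm
    · rintro ⟨h, he⟩
      rw [hST] at h
      rcases h with h | h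
      · exact h
      · rw [edge_adj] at h
        rw [Sym2.eq_iff] at he
        exact absurd h.1 (by tauto)
  · have h0 : interiorVerts hxy.toWalk = ∅ := by
      ext z
      simp [interiorVerts]
      tauto
    rw [h0, sdiff_empty]
    ext a
    constructor
    · rintro ⟨b, h⟩
      exact ⟨b, hST ▸ Or.inl h⟩
    · rintro ⟨b, h⟩
      replace h : S.Adj a b := h
      rw [hST] at h
      rcases h with h | h
      · exact ⟨b, h⟩
      · rw [edge_adj] at h
        rcases h.1 with ⟨rfl, -⟩ | ⟨rfl, -⟩
        · exact hx
        · exact hy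

/-- The subgraph is recovered from its union with a star. -/
theorem IsStar.eq_deleteEdges {k : ℕ} {u : V} {w : Fin k → V} {p : ∀ i, S.Walk u (w i)}
    (hs : IsStar T p) (hST : S = T ⊔ edgeUnion p) {E : Set (Sym2 V)}
    (hE : ∀ e, e ∈ E ↔ ∃ i, e ∈ (p i).edges) : T = S.deleteEdges E := by
  have hTS : T ≤ S := hST ▸ le_sup_left
  ext x y
  rw [deleteEdges_adj, hE]
  constructor
  · refine fun h => ⟨hTS h, fun he => ?_⟩
    obtain ⟨l, m, hm, e⟩ := exists_index (edgeUnion_adj.2 he)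
    have := hs.notMem l hm
    rcases e with ⟨e, -⟩ | ⟨e, -⟩
    · exact this (e ▸ ⟨y, h⟩)
    · exact this (e ▸ ⟨x, h.symm⟩)
  · rintro ⟨h, he⟩
    rw [hST] at h
    rcases h with h | h
    · exact h
    · exact absurd (edgeUnion_adj.1 h) he

theorem IsStar.support_eq {k : ℕ} {u : V} {w : Fin k → V} {p : ∀ i, S.Walk u (w i)}
    (hs : IsStar T p) (hST : S = T ⊔ edgeUnion p) {D : Set V}
    (hD : ∀ x, x ∈ D ↔ ∃ i, x ∈ (p i).support ∧ x ≠ w i) : T.support = S.support \ D := by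
  have hTS : T ≤ S := hST ▸ le_sup_left
  ext x
  rw [Set.mem_sdiff, hD]
  constructor
  · rintro ⟨y, h⟩
    refine ⟨⟨y, hTS h⟩, ?_⟩
    rintro ⟨i, hi, hne⟩
    exact hs.inner i x hi hne ⟨y, h⟩
  · rintro ⟨⟨y, h⟩, hx⟩
    replace h : S.Adj x y := h
    rw [hST] at h
    rcases h with h | h
    · exact ⟨y, h⟩
    · obtain ⟨i, hi⟩ := mem_support_of_adj h
      by_contra hxT
      refine hx ⟨i, hi, fun e => hxT (e ▸ hs.ends i)⟩

theorem IsStar.inner_degree [Finite V] {k : ℕ} {u : V} {w : Fin k → V}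
    {p : ∀ i, S.Walk u (w i)} (hs : IsStar T p) (hST : S = T ⊔ edgeUnion p) {i : Fin k} {x : V}
    (hx : x ∈ interiorVerts (p i)) : (S.neighborSet x).ncard = 2 := by
  refine ncard_neighborSet_eq_two (hs.isPath i) hx fun y hy => ?_
  rw [hST] at hy
  rcases hy with hy | hy
  · exact absurd ⟨y, hy⟩ (hs.inner i x hx.1 hx.2.2)
  · obtain ⟨j, hj⟩ := edgeUnion_adj.1 hy
    by_cases hij : i = j
    · exact hij ▸ hj
    · exact absurd (hs.disjoint i j hij x hx.1 ((p j).fst_mem_support_of_mem_edges hj)) hx.2.1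

theorem IsStar.length_pos {k : ℕ} {u : V} {w : Fin k → V}
    {p : ∀ i, S.Walk u (w i)} (hs : IsStar T p) (i : Fin k) : 0 < (p i).length := by
  rw [Nat.pos_iff_ne_zero]
  intro h
  exact hs.center (Walk.eq_of_length_eq_zero h ▸ hs.ends i)

theorem IsStar.center_degree [Finite V] {k : ℕ} {u : V} {w : Fin k → V}
    {p : ∀ i, S.Walk u (w i)} (hs : IsStar T p) (hST : S = T ⊔ edgeUnion p) :
    (S.neighborSet u).ncard = k := by
  have he : S.neighborSet u = range fun i => (p i).getVert 1 := by
    ext y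
    constructor
    · intro hy
      replace hy : S.Adj u y := hy
      rw [hST] at hy
      rcases hy with hy | hy
      · exact absurd ⟨y, hy⟩ hs.center
      · obtain ⟨i, j, hj, e⟩ := exists_index hy
        rcases e with ⟨e, e'⟩ | ⟨e, e'⟩
        · have := getVert_inj (hs.isPath i) hj.le (Nat.zero_le _) (e.trans (by simp))
          subst this
          exact ⟨i, e'⟩
        · have := getVert_inj (hs.isPath i) hj (Nat.zero_le _) (e'.trans (by simp))
          omega
    · rintro ⟨i, rfl⟩
      have := (p i).adj_getVert_succ (hs.length_pos i)
      rwa [Walk.getVert_zero] at this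
  rw [he, ncard_range_of_injective, Nat.card_fin]
  intro i j hij
  by_contra hne
  have h1 := hs.disjoint i j hne _ ((p i).getVert_mem_support 1)
    (by simp only at hij; rw [hij]; exact (p j).getVert_mem_support 1)
  have := getVert_inj (hs.isPath i) (hs.length_pos i) (Nat.zero_le _) (h1.trans (by simp))
  omega

theorem step_of_sup_claw [Finite V] {u : V} {w : Fin 3 → V} {p : ∀ i, S.Walk u (w i)}
    (hs : IsStar T p) (hST : S = T ⊔ edgeUnion p)
    (hwC : ∀ i, w i ∈ C) (hCT : C ⊆ T.support) : ClawStep C S T := by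
  refine ⟨u, support_subset_support (hs.length_pos 0) (p 0).start_mem_support,
    fun h => hs.center (hCT h), hs.center_degree hST, w, p, fun i =>
      ⟨hs.isPath i, hwC i, fun x hx => ⟨fun h => hs.inner i x hx.1 hx.2.2 (hCT h),
        hs.inner_degree hST hx⟩⟩, hs.disjoint, hs.eq_deleteEdges hST (fun e => mem_iUnion),
    hs.support_eq hST fun x => ?_⟩
  rw [mem_union, mem_singleton_iff, mem_iUnion]
  constructor
  · rintro (rfl | ⟨i, hi⟩)
    · exact ⟨0, (p 0).start_mem_support, fun h => hs.center (h ▸ hs.ends 0)⟩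
    · exact ⟨i, hi.1, hi.2.2⟩
  · rintro ⟨i, hi, hne⟩
    by_cases hxu : x = u
    · exact Or.inl hxu
    · exact Or.inr ⟨i, hi, hxu, hne⟩

theorem step_of_sup_path [Finite V] {a b u : V} {w : Fin 2 → V} {p : ∀ i, S.Walk u (w i)}
    (hs : IsStar T p) (hST : S = T ⊔ edgeUnion p) (P : S.Walk a b) (hP : P.IsPath)
    (hPe : ∀ e, e ∈ P.edges ↔ ∃ i, e ∈ (p i).edges) (ha : a ∈ T.support) (hb : b ∈ T.support)
    (hPT : ∀ x ∈ P.support, x ≠ a → x ≠ b → x ∉ T.support) (hpos : 1 ≤ P.length)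
    (hCT : C ⊆ T.support) : PathStep C S T := by
  have hmem : ∀ {x}, x ∈ interiorVerts P → x ∉ T.support := fun hx => hPT _ hx.1 hx.2.1 hx.2.2
  refine ⟨a, b, P, ⟨hP, hpos, fun x hx => ⟨fun h => hmem hx (hCT h), ?_⟩⟩,
    hs.eq_deleteEdges hST hPe, ?_⟩
  · refine ncard_neighborSet_eq_two hP hx fun y hy => ?_
    rw [hST] at hy
    rcases hy with hy | hy
    · exact absurd ⟨y, hy⟩ (hmem hx)
    · exact (hPe _).2 (edgeUnion_adj.1 hy)
  · ext x
    constructor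
    · rintro ⟨y, h⟩
      exact ⟨⟨y, hST ▸ Or.inl h⟩, fun hx => hmem hx ⟨y, h⟩⟩
    · rintro ⟨⟨y, h⟩, hx⟩
      replace h : S.Adj x y := h
      rw [hST] at h
      rcases h with h | h
      · exact ⟨y, h⟩
      · have := P.fst_mem_support_of_mem_edges ((hPe _).2 (edgeUnion_adj.1 h))
        by_cases hxa : x = a
        · exact hxa ▸ ha
        · by_cases hxb : x = b
          · exact hxb ▸ hb
          · exact absurd ⟨this, hxa, hxb⟩ hx

theorem exists_maximal_lk [Finite V] (hA : Lk T C A) :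
    ∃ M, A ⊆ M ∧ Lk T C M ∧ ∀ A', Lk T C A' → M ⊆ A' → A' ⊆ M := by
  obtain ⟨M, hAM, hM⟩ := (toFinite {A | Lk T C A}).exists_le_maximal hA
  exact ⟨M, hAM, hM.1, fun A' hA' h => hM.2 hA' h⟩

theorem subset_closure_of_subset (hAB : A ⊆ B) : A ∪ nbhd T A ⊆ B ∪ nbhd T B := by
  rintro x (hx | ⟨-, y, hy, h⟩)
  · exact Or.inl (hAB hx)
  · exact nbhd_adj (hAB hy) h

/-- By `Good.lk_union`, a link set whose closure contains a vertex of the maximal set `A` is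
absorbed by `A`. -/
theorem Good.mem_closure_of_colinked [Finite V] (hT : Good T C) (hA : Lk T C A)
    (hmax : ∀ A', Lk T C A' → A ⊆ A' → A' ⊆ A) {x y : V} (hx : x ∈ A) (h : Colinked T C x y) :
    y ∈ A ∪ nbhd T A := by
  rcases h with h | ⟨A', hA', hx', hy'⟩
  · exact nbhd_adj hx h
  · have := hmax _ (hT.lk_union hA hA' hx hx') subset_union_left
    exact subset_closure_of_subset (subset_union_right.trans this) hy'

theorem three_le_degree [Finite V] (hT : Good T C) (hTS : T ≤ S) {x y : V}
    (hx : x ∈ T.support \ C) (hxy : S.Adj x y) (hn : ¬ T.Adj x y) :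
    2 < (S.neighborSet x).ncard := by
  have h1 := hT.two_le_degree hx
  have h2 : insert y (T.neighborSet x) ⊆ S.neighborSet x := by
    rintro z (rfl | hz)
    · exact hxy
    · exact hTS hz
  have h3 := ncard_le_ncard h2 (toFinite _)
  rw [ncard_insert_of_notMem (show y ∉ T.neighborSet x from hn)] at h3
  omega

/-- A maximal link of `T` has no bridge of `S` attached to it. -/
theorem no_bridge_at_link [Finite V] (hT : Good T C) (hS : Good S C) (hTS : T ≤ S)
    (hCT : C ⊆ T.support) (hA : Lk T C A) (hmax : ∀ A', Lk T C A' → A ⊆ A' → A' ⊆ A)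
    (h1 : ∀ x y, x ∈ T.support → y ∈ T.support → S.Adj x y → ¬ T.Adj x y → Colinked T C x y)
    (h2 : ∀ v x y, x ∈ nbhd S (comp S T v) → y ∈ nbhd S (comp S T v) → x ≠ y →
      Colinked T C x y)
    (hex : (∃ x ∈ A ∪ nbhd T A, ∃ y ∈ A ∪ nbhd T A, S.Adj x y ∧ ¬ T.Adj x y) ∨
      ∃ v ∈ S.support \ T.support, nbhd S (comp S T v) ⊆ A ∪ nbhd T A) : False := by
  have hsT : T.support ⊆ S.support := fun x ⟨y, h⟩ => ⟨y, hTS h⟩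
  -- `E` consists of the components off `T` attached entirely within the closure of `A`. By
  -- maximality, a component or edge that touches `A` attaches nowhere else, so `A ∪ E` gains no
  -- outer neighbors in `S`.
  set E : Set V := {v | v ∈ S.support \ T.support ∧ nbhd S (comp S T v) ⊆ A ∪ nbhd T A} with hE
  have hsub : nbhd S (A ∪ E) ⊆ nbhd T A := by
    rintro y ⟨hy, x, hx, hxy⟩
    rw [mem_union, not_or] at hy
    rcases hx with hx | hx
    · have hxT := (hA.subset hx).1
      by_cases hyT : y ∈ T.support
      · by_cases hxyT : T.Adj x y
        · exact ⟨hy.1, x, hx, hxyT⟩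
        · exact (hT.mem_closure_of_colinked hA hmax hx
            (h1 x y hxT hyT hxy hxyT)).resolve_left hy.1
      · refine absurd ⟨⟨⟨x, hxy.symm⟩, hyT⟩, fun z hz => ?_⟩ hy.2
        have hxn : x ∈ nbhd S (comp S T y) :=
          ⟨fun h => comp_disjoint h hxT, y, mem_comp_self hyT, hxy.symm⟩
        by_cases hxz : x = z
        · exact hxz ▸ Or.inl hx
        · exact hT.mem_closure_of_colinked hA hmax hx (h2 y x z hxn hz hxz)
    · by_cases hyT : y ∈ T.support
      · have : y ∈ nbhd S (comp S T x) :=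
          ⟨fun h => comp_disjoint h hyT, x, mem_comp_self hx.1.2, hxy⟩
        exact (hx.2 this).resolve_left hy.1
      · have := comp_adj (mem_comp_self hx.1.2) hxy hyT
        refine absurd ⟨⟨⟨x, hxy.symm⟩, hyT⟩, ?_⟩ hy.2
        rw [comp_eq this]
        exact hx.2
  have hlk : Lk S C (A ∪ E) := by
    refine ⟨hA.nonempty.inl, ?_, (ncard_le_ncard hsub (toFinite _)).trans hA.le⟩
    rintro x (hx | hx)
    · exact ⟨hsT (hA.subset hx).1, (hA.subset hx).2⟩
    · exact ⟨hx.1.1, fun h => hx.1.2 (hCT h)⟩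
  have hN : nbhd S (A ∪ E) = nbhd T A := eq_of_subset_of_ncard_le hsub
    (by rw [hS.ncard_eq hlk]; exact hA.le) (toFinite _)
  -- Now `A ∪ E` is a link set of `S`, so degrees on `A` are 2 in `S`; they are already at least 2
  -- in `T`, leaving no room for new edges.
  have hdeg : ∀ x ∈ A, ∀ y, S.Adj x y → T.Adj x y := by
    intro x hx y hxy
    by_contra hn
    have := three_le_degree hT hTS (hA.subset hx) hxy hn
    rw [hS.lk_degree hlk (Or.inl hx)] at this
    omega
  -- The new edge or component can attach only at the two outer neighbors of `A`, and it attaches at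
  -- both. Each of them thus has a neighbor outside `A` besides one in `A`, and minimum degree 2
  -- contradicts acyclicity.
  have two : ∀ x ∈ nbhd T A, ∃ y ∈ A ∪ E ∪ nbhd S (A ∪ E), y ∉ A ∧ S.Adj x y := by
    rw [hN]
    rcases hex with ⟨x, hx, y, hy, hxy, hn⟩ | ⟨v, hv, hvN⟩
    · have hx' : x ∈ nbhd T A := hx.resolve_left fun h => hn (hdeg x h y hxy)
      have hy' : y ∈ nbhd T A := hy.resolve_left fun h => hn (hdeg y h x hxy.symm).symm
      have he : {x, y} = nbhd T A := eq_of_subset_of_ncard_le (pair_subset hx' hy')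
        (by rw [ncard_pair (S.ne_of_adj hxy)]; exact hA.le) (toFinite _)
      rw [← he]
      rintro z (rfl | rfl)
      · exact ⟨y, Or.inr (Or.inr rfl), hy'.1, hxy⟩
      · exact ⟨x, Or.inr (Or.inl rfl), hx'.1, hxy.symm⟩
    · have hX : nbhd S (comp S T v) ⊆ nbhd T A := by
        intro x hx
        refine (hvN hx).resolve_left fun hxA => ?_
        obtain ⟨-, d, hd, hdx⟩ := hx
        exact comp_disjoint hd ⟨x, (hdeg x hxA d hdx.symm).symm⟩
      have hX2 := (hS (comp S T v) ⟨v, mem_comp_self hv.2⟩ fun x hx =>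
        ⟨comp_subset_support hv.1 hx, fun h => comp_disjoint hx (hCT h)⟩).1
      have he : nbhd S (comp S T v) = nbhd T A :=
        eq_of_subset_of_ncard_le hX (hA.le.trans hX2) (toFinite _)
      rw [← he]
      rintro x ⟨-, d, hd, hdx⟩
      refine ⟨d, Or.inl (Or.inr ⟨⟨comp_subset_support hv.1 hd, comp_disjoint hd⟩, ?_⟩),
        fun h => comp_disjoint hd (hA.subset h).1, hdx.symm⟩
      rw [comp_eq hd]
      exact hvN
  refine not_acyc (T := S) subset_rfl hA.nonempty.inl.inl ?_ (hS.acyc hlk)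
  rintro x (hx | hx)
  · obtain ⟨y, z, hyz, hy, hz⟩ := hS.exists_two (hlk.subset hx)
    exact ⟨y, nbhd_adj hx hy, z, nbhd_adj hx hz, hyz, hy, hz⟩
  · rw [hN] at hx
    obtain ⟨y, hy, hyA, hxy⟩ := two x hx
    obtain ⟨-, z, hz, hzx⟩ := hx
    exact ⟨y, hy, z, Or.inl (Or.inl hz), fun e => hyA (e ▸ hz), hxy, hTS hzx.symm⟩

theorem exists_step [Finite V] (hS : Good S C) (hCg : Cg ≤ S) (hCs : Cg.support = C)
    (hne : Cg ≠ S) :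
    ∃ T, Cg ≤ T ∧ T < S ∧ Good T C ∧ (PathStep C S T ∨ ClawStep C S T) := by
  classical
  -- Vacuous: no vertex of the cycle lies off `C`. This provides a candidate for `T`.
  have hCgood : Good Cg C := by
    rintro A ⟨x, hx⟩ hA
    have := hA hx
    rw [hCs] at this
    exact absurd this.1 this.2
  obtain ⟨T, -, ⟨hCT, hTS, hT⟩, hTmax⟩ :=
    (toFinite {T : SimpleGraph V | Cg ≤ T ∧ T < S ∧ Good T C}).exists_le_maximal
      (show Cg ∈ _ from ⟨le_rfl, lt_of_le_of_ne hCg hne, hCgood⟩)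
  have hCsup : C ⊆ T.support := by
    rw [← hCs]
    rintro x ⟨y, hy⟩
    exact ⟨y, hCT hy⟩
  have hmaxT : ∀ Y : SimpleGraph V, Y ≤ S → ¬ Y ≤ T → Good (T ⊔ Y) C → S = T ⊔ Y := by
    intro Y hY hYT hgood
    by_contra hne'
    have hlt : T ⊔ Y < S := lt_of_le_of_ne (sup_le hTS.le hY) (Ne.symm hne')
    exact hYT (le_sup_right.trans (hTmax ⟨hCT.trans le_sup_left, hlt, hgood⟩ le_sup_left))
  have hstar : ∀ {k : ℕ} {u : V} {w : Fin k → V} {p : ∀ i, S.Walk u (w i)}, 0 < k → IsStar T p →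
      Good (T ⊔ edgeUnion p) C → S = T ⊔ edgeUnion p := by
    intro k u w p hk hs hg
    refine hmaxT _ edgeUnion_le (fun hle => hs.center ?_) hg
    have := IsStar.adj (p := p) ⟨0, hk⟩ (hs.length_pos _)
    rw [Walk.getVert_zero] at this
    exact ⟨_, hle this⟩
  by_cases h1 : ∀ x y, x ∈ T.support → y ∈ T.support → S.Adj x y → ¬ T.Adj x y → Colinked T C x y
  swap
  · push Not at h1
    obtain ⟨x, y, hx, hy, hxy, hn, hcol⟩ := h1
    refine ⟨T, hCT, hTS, hT, Or.inl (step_of_sup_edge (hmaxT _ ?_ ?_ ?_) hx hy hxy hn)⟩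
    · rw [edge_le_iff]
      exact Or.inr hxy
    · rw [edge_le_iff]
      rintro (h | h)
      · exact S.ne_of_adj hxy h
      · exact hn h
    · exact good_sup_edge hT hx hy fun A hA h =>
        hcol (Or.inr ⟨A, hA, h (Or.inl rfl), h (Or.inr rfl)⟩)
  by_cases h2 : ∀ v x y, x ∈ nbhd S (comp S T v) → y ∈ nbhd S (comp S T v) → x ≠ y →
      Colinked T C x y
  swap
  · push Not at h2
    obtain ⟨v, a, b, ha, hb, hab, hcol⟩ := h2
    obtain ⟨P, hP, hin, u, huP, hu⟩ := exists_path_through ha hb hab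
    have haT := nbhd_comp_subset ha
    have hbT := nbhd_comp_subset hb
    obtain ⟨p, hs, hPe⟩ := exists_star_two P hP hin huP hu haT hbT
    refine ⟨T, hCT, hTS, hT, Or.inl (step_of_sup_path hs (hstar (by norm_num) hs ?_) P hP hPe haT
      hbT (fun x h1 h2 h3 => comp_disjoint (hin x h1 h2 h3)) ?_ hCsup)⟩
    · refine hs.good_sup hT le_rfl (fun _ i j h => ?_) fun A hA h =>
        hcol (Or.inr ⟨A, hA, h ⟨0, rfl⟩, h ⟨1, rfl⟩⟩)
      fin_cases i <;> fin_cases j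
      · exact T.ne_of_adj h rfl
      · exact hcol (Or.inl h)
      · exact hcol (Or.inl h.symm)
      · exact T.ne_of_adj h rfl
    · rw [Nat.one_le_iff_ne_zero]
      exact fun h => hab (Walk.eq_of_length_eq_zero h)
  -- From here on any two attachments of a component lie on a common link, so only a claw with three
  -- branch feet can spread over several links.
  by_cases h3 : ∃ v a b c, a ∈ nbhd S (comp S T v) ∧ b ∈ nbhd S (comp S T v) ∧
      c ∈ nbhd S (comp S T v) ∧ a ≠ b ∧ a ≠ c ∧ b ≠ c ∧
      ∀ A, Lk T C A → a ∉ A ∧ b ∉ A ∧ c ∉ A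
  · obtain ⟨v, a, b, c, ha, hb, hc, hab, hac, hbc, hbr⟩ := h3
    obtain ⟨u, p, hs⟩ := exists_star_three ha hb hc hab hac hbc
    have hw : Function.Injective ![a, b, c] := by
      intro i j hij
      fin_cases i <;> fin_cases j
      · rfl
      · exact absurd hij hab
      · exact absurd hij hac
      · exact absurd hij hab.symm
      · rfl
      · exact absurd hij hbc
      · exact absurd hij hac.symm
      · exact absurd hij hbc.symm
      · rfl
    have hbr' : ∀ i A, Lk T C A → ![a, b, c] i ∉ A := by
      intro i A hA
      fin_cases i
      · exact (hbr A hA).1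
      · exact (hbr A hA).2.1
      · exact (hbr A hA).2.2
    have hmem : ∀ i, ![a, b, c] i ∈ nbhd S (comp S T v) := by
      intro i
      fin_cases i
      · exact ha
      · exact hb
      · exact hc
    have hST := hstar (by norm_num) hs <| by
      -- The feet are not inside link sets, and three of them are too many for the outer neighbors
      -- of a single one.
      refine hs.good_sup hT (by norm_num) (by norm_num) fun A hA h => ?_
      have h4 : range ![a, b, c] ⊆ nbhd T A := by
        rintro _ ⟨i, rfl⟩
        exact (h ⟨i, rfl⟩).resolve_left (hbr' i A hA)
      have h5 := ncard_le_ncard h4 (toFinite _)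
      rw [ncard_range_of_injective hw, Nat.card_fin] at h5
      have := hA.le
      omega
    by_cases hall : ∀ i, ![a, b, c] i ∈ C
    · exact ⟨T, hCT, hTS, hT, Or.inr (step_of_sup_claw hs hST hall hCsup)⟩
    · push Not at hall
      obtain ⟨i, hi⟩ := hall
      have hij : i ≠ i + 1 := by
        fin_cases i <;> decide
      have hwij : ![a, b, c] i ≠ ![a, b, c] (i + 1) := fun e => hij (hw e)
      obtain ⟨q, hq⟩ := hT.exists_link_of_colinked hwij (hs.ends _) (hs.ends _) (hbr' _) (hbr' _)
        (h2 v _ _ (hmem i) (hmem (i + 1)) hwij)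
      obtain ⟨T', h5, h6, h7, h8⟩ := step_delete_link hS hs hST hbr' hq hCT hCs hi
      exact ⟨T', h5, h6, h7, Or.inl h8⟩
  -- No piece can be attached as above. Take an edge of `S` missing in `T`: it is a chord, or
  -- belongs to a component, attached within one link, and `no_bridge_at_link` applies to a maximal
  -- link set. If that link is a single edge of `T`, the edge closes a cycle with the component.
  exfalso
  obtain ⟨x, y, hxy, hn⟩ : ∃ x y, S.Adj x y ∧ ¬ T.Adj x y := by
    by_contra! hc
    exact hTS.not_ge fun x y h => hc x y h
  have fin : ∀ A, Lk T C A →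
      ((∃ x ∈ A ∪ nbhd T A, ∃ y ∈ A ∪ nbhd T A, S.Adj x y ∧ ¬ T.Adj x y) ∨
      ∃ v ∈ S.support \ T.support, nbhd S (comp S T v) ⊆ A ∪ nbhd T A) → False := by
    intro A hA hex
    obtain ⟨M, hAM, hM, hmax⟩ := exists_maximal_lk hA
    have hsub := subset_closure_of_subset (T := T) hAM
    refine no_bridge_at_link hT hS hTS.le hCsup hM hmax h1 h2 ?_
    rcases hex with ⟨x, hx, y, hy, h⟩ | ⟨v, hv, h⟩
    · exact Or.inl ⟨x, hsub hx, y, hsub hy, h⟩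
    · exact Or.inr ⟨v, hv, h.trans hsub⟩
  have hcomp : ∀ v ∈ S.support, v ∉ T.support → False := by
    intro v hv hvT
    have hDS : comp S T v ⊆ S.support \ C := fun x hx =>
      ⟨comp_subset_support hv hx, fun h => comp_disjoint hx (hCsup h)⟩
    have hX2 := hS (comp S T v) ⟨v, mem_comp_self hvT⟩ hDS
    by_cases hlk : ∃ A, Lk T C A ∧ ∃ x ∈ A, x ∈ nbhd S (comp S T v)
    · obtain ⟨A, hA, x, hxA, hx⟩ := hlk
      obtain ⟨M, hAM, hM, hmax⟩ := exists_maximal_lk hA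
      refine fin M hM (Or.inr ⟨v, ⟨hv, hvT⟩, fun y hy => ?_⟩)
      by_cases hxy : x = y
      · exact hxy ▸ Or.inl (hAM hxA)
      · exact hT.mem_closure_of_colinked hM hmax (hAM hxA) (h2 v x y hx hy hxy)
    · push Not at hlk
      by_cases hcard : (nbhd S (comp S T v)).ncard ≤ 2
      · obtain ⟨a, b, hab, he⟩ := ncard_eq_two.1 (le_antisymm hcard hX2.1)
        have ha : a ∈ nbhd S (comp S T v) := he ▸ Or.inl rfl
        have hb : b ∈ nbhd S (comp S T v) := he ▸ Or.inr rfl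
        rcases h2 v a b ha hb hab with h | ⟨A, hA, haA, hbA⟩
        · refine not_acyc (T := S) subset_rfl ⟨v, Or.inl (mem_comp_self hvT)⟩ ?_ (hX2.2 hcard)
          rintro x (hx | hx)
          · obtain ⟨y, z, hyz, hy, hz⟩ := hS.exists_two (hDS hx)
            exact ⟨y, nbhd_adj hx hy, z, nbhd_adj hx hz, hyz, hy, hz⟩
          · obtain ⟨-, d, hd, hdx⟩ := id hx
            rw [he] at hx
            rcases hx with rfl | rfl
            · exact ⟨d, Or.inl hd, b, Or.inr hb, fun e => hb.1 (e ▸ hd), hdx.symm, hTS.le h⟩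
            · exact ⟨d, Or.inl hd, a, Or.inr ha, fun e => ha.1 (e ▸ hd), hdx.symm,
                hTS.le h.symm⟩
        · exact fin A hA (Or.inr ⟨v, ⟨hv, hvT⟩, he ▸ pair_subset haA hbA⟩)
      · rw [not_le, two_lt_ncard_iff] at hcard
        obtain ⟨a, b, c, ha, hb, hc, hab, hac, hbc⟩ := hcard
        exact h3 ⟨v, a, b, c, ha, hb, hc, hab, hac, hbc, fun A hA =>
          ⟨fun h => hlk A hA a h ha, fun h => hlk A hA b h hb, fun h => hlk A hA c h hc⟩⟩
  by_cases hxT : x ∈ T.support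
  · by_cases hyT : y ∈ T.support
    · rcases h1 x y hxT hyT hxy hn with h | ⟨A, hA, hx, hy⟩
      · exact hn h
      · exact fin A hA (Or.inl ⟨x, hx, y, hy, hxy, hn⟩)
    · exact hcomp y ⟨x, hxy.symm⟩ hyT
  · exact hcomp x ⟨y, hxy⟩ hxT

end ConvexReduction

/-! ### The graph obtained by contracting links -/

namespace ConvexReduction

variable {V : Type u} {G : SimpleGraph V} {C : Set V}

open SimpleGraph

/-- The graph obtained by replacing every link by an edge. -/
def branchGraph (G : SimpleGraph V) (C : Set V) : SimpleGraph {x // Branch G C x} where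
  Adj a b := ∃ p : G.Walk a.1 b.1, IsLink C p
  symm := ⟨fun _ _ ⟨p, hp⟩ => ⟨p.reverse, hp.reverse⟩⟩
  loopless := ⟨fun _ ⟨_, hp⟩ => hp.ne rfl⟩

/-- By `IsLink.eq` the choice is unique in a `Good` graph, which makes it compatible with reversal.
-/
noncomputable def linkPath {a b : {x // Branch G C x}} (h : (branchGraph G C).Adj a b) :
    G.Walk a.1 b.1 := h.choose

theorem isLink_linkPath {a b : {x // Branch G C x}} (h : (branchGraph G C).Adj a b) :
    IsLink C (linkPath h) := h.choose_spec

theorem linkPath_symm [Finite V] (hG : Good G C) {a b : {x // Branch G C x}}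
    (h : (branchGraph G C).Adj a b) : linkPath h.symm = (linkPath h).reverse :=
  (isLink_linkPath _).eq hG (isLink_linkPath h).reverse

theorem mem_linkPath_cases {a b : {x // Branch G C x}} (h : (branchGraph G C).Adj a b) {x : V}
    (hx : x ∈ (linkPath h).support) : x ∈ interiorVerts (linkPath h) ∨ x = a.1 ∨ x = b.1 := by
  by_cases hc : x = a.1 ∨ x = b.1
  · exact Or.inr hc
  · rw [not_or] at hc
    exact Or.inl ⟨hx, hc⟩

theorem eq_of_mem_linkPath {a b : {x // Branch G C x}} (h : (branchGraph G C).Adj a b)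
    {w : {x // Branch G C x}} (hw : w.1 ∈ (linkPath h).support) : w = a ∨ w = b := by
  rcases mem_linkPath_cases h hw with h1 | h1 | h1
  · exact absurd w.2 ((isLink_linkPath h).not_branch h1)
  · exact Or.inl (Subtype.ext h1)
  · exact Or.inr (Subtype.ext h1)

theorem exists_linkPath [Finite V] (hG : Good G C) {x y : V} (hxy : G.Adj x y) :
    ∃ (a b : {x // Branch G C x}) (h : (branchGraph G C).Adj a b),
      s(x, y) ∈ (linkPath h).edges := by
  obtain ⟨a, b, p, hp, he, ha, hb⟩ := hG.exists_link hxy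
  have h : (branchGraph G C).Adj ⟨a, ha⟩ ⟨b, hb⟩ := ⟨p, hp⟩
  exact ⟨⟨a, ha⟩, ⟨b, hb⟩, h, (isLink_linkPath h).eq hG hp ▸ he⟩

theorem branch_of_mem_linkPaths [Finite V] (hG : Good G C) {a b a' b' : {x // Branch G C x}}
    (h : (branchGraph G C).Adj a b) (h' : (branchGraph G C).Adj a' b') (hne : s(a, b) ≠ s(a', b'))
    {x : V} (hx : x ∈ (linkPath h).support) (hx' : x ∈ (linkPath h').support) :
    Branch G C x := by
  rcases mem_linkPath_cases h hx with h1 | rfl | rfl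
  · rcases mem_linkPath_cases h' hx' with h2 | rfl | rfl
    · have := (isLink_linkPath h).ends_eq hG (isLink_linkPath h') a.2 b.2 a'.2 b'.2 h1 h2
      refine absurd ?_ hne
      rw [Sym2.eq_iff] at this ⊢
      simpa only [Subtype.ext_iff] using this
    · exact a'.2
    · exact b'.2
  · exact a.2
  · exact b.2

theorem exists_linkPath_at [Finite V] (hG : Good G C) (a : {x // Branch G C x}) {y : V}
    (hxy : G.Adj a.1 y) : ∃ (b : {x // Branch G C x}) (h : (branchGraph G C).Adj a b),
      y ∈ (linkPath h).support := by
  obtain ⟨c, d, h, he⟩ := exists_linkPath hG hxy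
  have hy := (linkPath h).snd_mem_support_of_mem_edges he
  rcases eq_of_mem_linkPath h ((linkPath h).fst_mem_support_of_mem_edges he) with rfl | rfl
  · exact ⟨d, h, hy⟩
  · exact ⟨c, h.symm, by rw [linkPath_symm hG h]; simpa using hy⟩

/-! ### Connectivity of the branch graph -/

/-- If all edges leaving `R` went to `u` or `v`, then `R` together with the insides of its links
would have at most two outer neighbors in `G`. By `Good.lk_degree` its vertices would have degree 2,
but those of `R` are branch vertices off `C`. -/
theorem branchGraph_cut [Finite V] (hG : Good G C) (hsup : ∀ x, x ∈ G.support)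
    {R : Set {x // Branch G C x}} (hR : R.Nonempty) (hRC : ∀ r ∈ R, r.1 ∉ C)
    (u v : {x // Branch G C x}) :
    ∃ r ∈ R, ∃ y ∉ R, (branchGraph G C).Adj r y ∧ y ≠ u ∧ y ≠ v := by
  by_contra! hc
  have hN : ∀ r ∈ R, ∀ y, (branchGraph G C).Adj r y → y ∈ R ∨ y = u ∨ y = v := by
    intro r hr y hy
    by_contra! h
    exact h.2.2 (hc r hr y h.1 hy h.2.1)
  set A : Set V := {x | (∃ r ∈ R, r.1 = x) ∨
    ∃ r ∈ R, ∃ b, ∃ h : (branchGraph G C).Adj r b, x ∈ interiorVerts (linkPath h)} with hA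
  have hmem : ∀ r ∈ R, ∀ b, ∀ h : (branchGraph G C).Adj r b, ∀ y ∈ (linkPath h).support,
      y ∈ A ∨ y = u.1 ∨ y = v.1 := by
    intro r hr b h y hy
    rcases mem_linkPath_cases h hy with h1 | rfl | rfl
    · exact Or.inl (Or.inr ⟨r, hr, b, h, h1⟩)
    · exact Or.inl (Or.inl ⟨r, hr, rfl⟩)
    · rcases hN r hr b h with h2 | rfl | rfl
      · exact Or.inl (Or.inl ⟨b, h2, rfl⟩)
      · exact Or.inr (Or.inl rfl)
      · exact Or.inr (Or.inr rfl)
  have hsub : nbhd G A ⊆ {u.1, v.1} := by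
    rintro y ⟨hy, x, hx, hxy⟩
    refine Or.resolve_left ?_ hy
    rcases hx with ⟨r, hr, rfl⟩ | ⟨r, hr, b, h, hx⟩
    · obtain ⟨b, h, hyb⟩ := exists_linkPath_at hG r hxy
      exact hmem r hr b h y hyb
    · exact hmem r hr b h y ((linkPath h).snd_mem_support_of_mem_edges
        ((isLink_linkPath h).mem_edges hx hxy))
  obtain ⟨r, hr⟩ := hR
  have hrA : r.1 ∈ A := Or.inl ⟨r, hr, rfl⟩
  have hlk : Lk G C A := by
    refine ⟨⟨_, hrA⟩, fun x hx => ⟨hsup x, ?_⟩, ncard_le_two_of_subset hsub⟩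
    rcases hx with ⟨r, hr, rfl⟩ | ⟨r, hr, b, h, hx⟩
    · exact hRC r hr
    · exact ((isLink_linkPath h).inner x hx).1
  rcases r.2 with h | h
  · exact hRC r hr h
  · exact h (hG.lk_degree hlk hrA)

theorem connected_of_cut {α : Type*} {K : SimpleGraph α} {B : Set α} (hne : B.Nonempty)
    (hB : ∀ x ∈ B, ∀ y ∈ B, K.Reachable x y)
    (hcut : ∀ R : Set α, R.Nonempty → (∀ r ∈ R, r ∉ B) → ∃ r ∈ R, ∃ y ∉ R, K.Adj r y) :
    K.Connected := by
  have h1 : ∀ x, ∃ b ∈ B, K.Reachable x b := by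
    intro x
    by_contra! hc
    obtain ⟨r, hr, y, hy, hry⟩ := hcut {y | K.Reachable x y} ⟨x, Reachable.refl x⟩
      fun r hr hrB => hc r hrB hr
    exact hy (Reachable.trans hr hry.reachable)
  obtain ⟨b, -⟩ := hne
  refine (connected_iff _).2 ⟨fun x y => ?_, ⟨b⟩⟩
  obtain ⟨b, hb, hxb⟩ := h1 x
  obtain ⟨b', hb', hyb⟩ := h1 y
  exact hxb.trans ((hB b hb b' hb').trans hyb.symm)

/-- Rotate the cycle to start at `a`; without its first edge it is a path from which `a` can be cut
off. -/
theorem exists_walk_avoiding {v : V} {c : G.Walk v v} (hc : c.IsCycle) {a x y : V}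
    (hx : x ∈ c.support) (hy : y ∈ c.support) (hxa : x ≠ a) (hya : y ≠ a) :
    ∃ p : G.Walk x y, ∀ z ∈ p.support, z ≠ a ∧ z ∈ c.support := by
  classical
  by_cases ha : a ∈ c.support
  · have hr := hc.rotate ha
    have hmem : ∀ z, z ∈ (c.rotate a ha).support ↔ z ∈ c.support := fun z => by
      simp
    generalize c.rotate a ha = d at hr hmem
    cases d with
    | nil => exact absurd hr (by simp)
    | @cons _ b _ h q =>
      rw [Walk.cons_isCycle_iff] at hr
      have hq : ∀ z ∈ c.support, z ≠ a → z ∈ q.support := by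
        intro z hz hza
        rw [← hmem, Walk.support_cons, List.mem_cons] at hz
        exact hz.resolve_left hza
      have hqx := hq x hx hxa
      have hqy := hq y hy hya
      refine ⟨(q.takeUntil x hqx).reverse.append (q.takeUntil y hqy), fun z hz => ?_⟩
      rw [Walk.mem_support_append_iff, Walk.support_reverse, List.mem_reverse] at hz
      constructor
      · rintro rfl
        rcases hz with hz | hz
        · exact Walk.endpoint_notMem_support_takeUntil hr.1 hqx hxa.symm hz
        · exact Walk.endpoint_notMem_support_takeUntil hr.1 hqy hya.symm hz
      · rw [← hmem, Walk.support_cons, List.mem_cons]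
        right
        rcases hz with hz | hz
        · exact q.support_takeUntil_subset_support hqx hz
        · exact q.support_takeUntil_subset_support hqy hz
  · refine ⟨(c.takeUntil x hx).reverse.append (c.takeUntil y hy), fun z hz => ?_⟩
    have hzc : z ∈ c.support := by
      rw [Walk.mem_support_append_iff, Walk.support_reverse, List.mem_reverse] at hz
      rcases hz with hz | hz
      · exact c.support_takeUntil_subset_support hx hz
      · exact c.support_takeUntil_subset_support hy hz
    exact ⟨fun h => ha (h ▸ hzc), hzc⟩

theorem branchGraph_adj_of_mem {a b : {x // Branch G C x}} (h : G.Adj a.1 b.1) :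
    (branchGraph G C).Adj a b :=
  ⟨h.toWalk, isLink_toWalk h⟩

theorem reachable_of_walk {s : Set {x // Branch G C x}} {x y : V} (p : G.Walk x y)
    (hp : ∀ z ∈ p.support, ∃ hz : Branch G C z, ⟨z, hz⟩ ∈ s) (hx : Branch G C x)
    (hy : Branch G C y) (hxs : ⟨x, hx⟩ ∈ s) (hys : ⟨y, hy⟩ ∈ s) :
    ((branchGraph G C).induce s).Reachable ⟨⟨x, hx⟩, hxs⟩ ⟨⟨y, hy⟩, hys⟩ := by
  induction p with
  | nil => exact Reachable.refl _
  | @cons u v w h p ih =>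
    obtain ⟨hv, hvs⟩ := hp v (by simp)
    refine Reachable.trans (Adj.reachable ?_) (ih (fun z hz => hp z (by simp [hz])) hv hy hvs hys)
    exact branchGraph_adj_of_mem (a := ⟨u, hx⟩) (b := ⟨v, hv⟩) h

theorem exists_three {v : V} {c : G.Walk v v} (hc : c.IsCycle) :
    ∃ f : Fin 3 → V, Function.Injective f ∧ ∀ i, f i ∈ c.support := by
  refine ⟨fun i => c.getVert (i + 1), fun i j hij => ?_, fun i => c.getVert_mem_support _⟩
  have h3 := hc.three_le_length
  have := hc.getVert_injOn (show 1 ≤ i.1 + 1 ∧ i.1 + 1 ≤ c.length by omega)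
    (show 1 ≤ j.1 + 1 ∧ j.1 + 1 ≤ c.length by omega) hij
  exact Fin.ext (by omega)

theorem three_le_card_branch [Finite V] {v : V} {c : G.Walk v v} (hc : c.IsCycle) :
    3 ≤ Nat.card {x // Branch G {x | x ∈ c.support} x} := by
  obtain ⟨f, hf, hfc⟩ := exists_three hc
  have := Nat.card_le_card_of_injective (fun i => (⟨f i, Or.inl (hfc i)⟩ :
    {x // Branch G {x | x ∈ c.support} x})) fun i j hij => hf (congrArg Subtype.val hij)
  simpa using this

/-- The cycle consists of branch vertices and stays connected without `a`. Every set off the cycle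
has an edge leaving it that avoids `a`, by `branchGraph_cut` with both excluded vertices equal to
`a`. -/
theorem isBiconnected_branchGraph [Finite V] {v : V} {c : G.Walk v v} (hc : c.IsCycle)
    (hG : Good G {x | x ∈ c.support}) (hsup : ∀ x, x ∈ G.support) :
    IsBiconnected (branchGraph G {x | x ∈ c.support}) := by
  refine ⟨three_le_card_branch hc, fun a => ?_⟩
  refine connected_of_cut (B := {w | w.1.1 ∈ c.support}) ?_ ?_ ?_
  · obtain ⟨f, hf, hfc⟩ := exists_three hc
    have : ∃ i, f i ≠ a.1 := by
      by_contra! h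
      exact absurd (hf ((h 0).trans (h 1).symm)) (by decide)
    obtain ⟨i, hi⟩ := this
    exact ⟨⟨⟨f i, Or.inl (hfc i)⟩, fun h => hi (congrArg Subtype.val h)⟩, hfc i⟩
  · rintro ⟨⟨x, hx⟩, hxa⟩ hxc ⟨⟨y, hy⟩, hya⟩ hyc
    obtain ⟨p, hp⟩ := exists_walk_avoiding hc hxc hyc (a := a.1)
      (fun h => hxa (Subtype.ext h)) (fun h => hya (Subtype.ext h))
    exact reachable_of_walk (s := {a}ᶜ) p (fun z hz => ⟨Or.inl (hp z hz).2,
      fun h => (hp z hz).1 (congrArg Subtype.val h)⟩) hx hy hxa hya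
  · intro R hR hRC
    obtain ⟨r, ⟨r', hr', rfl⟩, y, hy, hadj, hya, -⟩ := branchGraph_cut hG hsup (hR.image Subtype.val)
      (by rintro _ ⟨r, hr, rfl⟩; exact hRC r hr) a a
    exact ⟨r', hr', ⟨y, hya⟩, fun h => hy ⟨_, h, rfl⟩, hadj⟩

/-- Adding a vertex adjacent to the vertices of the cycle makes the branch graph triconnected. -/
theorem isTriconnected_of_apex [Finite V] {v : V} {c : G.Walk v v} (hc : c.IsCycle)
    (hG : Good G {x | x ∈ c.support}) (hsup : ∀ x, x ∈ G.support)
    (K : SimpleGraph (Option {x // Branch G {x | x ∈ c.support} x}))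
    (hK : ∀ a b, K.Adj (some a) (some b) ↔ (branchGraph G {x | x ∈ c.support}).Adj a b)
    (hK' : ∀ a, K.Adj (some a) none ↔ a.1 ∈ c.support) : IsTriconnected K := by
  have hbi := isBiconnected_branchGraph hc hG hsup
  have hnone : ∀ a, (K.induce {none, some a}ᶜ).Connected := by
    intro a
    let f : (branchGraph G {x | x ∈ c.support}).induce {a}ᶜ →g K.induce {none, some a}ᶜ :=
      { toFun := fun w => ⟨some w.1, fun h => by
          rcases h with h | h
          · exact Option.some_ne_none _ h
          · exact w.2 (Option.some_injective _ h)⟩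
        map_rel' := fun {x y} h => (hK _ _).2 h }
    refine (hbi.2 a).map f ?_
    rintro ⟨_ | w, hw⟩
    · exact absurd (Or.inl rfl) hw
    · exact ⟨⟨w, fun h => hw (Or.inr (congrArg some h))⟩, rfl⟩
  refine ⟨?_, ?_⟩
  · rw [Finite.card_option]
    have := three_le_card_branch hc
    omega
  · rintro (_ | a) (_ | b) hne
    · exact absurd rfl hne
    · exact hnone b
    · rw [pair_comm]
      exact hnone a
    -- The new vertex remains. A set avoiding it either contains a cycle vertex, adjacent to the new
    -- vertex, or has an edge leaving it to a vertex other than `a` and `b`.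
    · have h0 : (none : Option {x // Branch G {x | x ∈ c.support} x}) ∈
          ({some a, some b}ᶜ : Set _) := by simp
      refine connected_of_cut (B := {⟨none, h0⟩}) (singleton_nonempty _) ?_ ?_
      · rintro x rfl y rfl
        exact Reachable.refl _
      · intro R hR hRn
        have hsome : ∀ r ∈ R, ∃ w, r.1 = some w := by
          rintro ⟨_ | w, hw⟩ hr
          · exact absurd rfl (hRn _ hr)
          · exact ⟨w, rfl⟩
        by_cases hex : ∃ r ∈ R, ∃ w, r.1 = some w ∧ w.1 ∈ c.support
        · obtain ⟨r, hr, w, hw, hwc⟩ := hex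
          refine ⟨r, hr, ⟨none, h0⟩, fun h => hRn _ h rfl, ?_⟩
          change K.Adj r.1 none
          rw [hw]
          exact (hK' w).2 hwc
        · push Not at hex
          obtain ⟨r₀, hr₀⟩ := hR
          obtain ⟨w₀, hw₀⟩ := hsome r₀ hr₀
          obtain ⟨w, ⟨r, hr, hw⟩, y, hy, hadj, hya, hyb⟩ := branchGraph_cut hG hsup
            (R := {w | ∃ r ∈ R, r.1 = some w}) ⟨w₀, r₀, hr₀, hw₀⟩
            (by rintro w ⟨r, hr, hw⟩; exact hex r hr w hw) a b
          refine ⟨r, hr, ⟨some y, ?_⟩, fun h => hy ⟨_, h, rfl⟩, ?_⟩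
          · rintro (h | h)
            · exact hya (Option.some_injective _ h)
            · exact hyb (Option.some_injective _ h)
          · change K.Adj r.1 (some y)
            rw [hw]
            exact (hK _ _).2 hadj

end ConvexReduction

namespace ConvexReduction

variable {V : Type u} {G : SimpleGraph V} {C : Set V}

open SimpleGraph

/-! ### Concatenation of arcs -/

theorem trans_injective {X : Type*} [TopologicalSpace X] {x y z : X} {γ : Path x y} {δ : Path y z}
    (hγ : Function.Injective γ) (hδ : Function.Injective δ) (h : range γ ∩ range δ ⊆ {y}) :
    Function.Injective (γ.trans δ) := by
  have key : ∀ s t : unitInterval, (s : ℝ) ≤ 1 / 2 → ¬ (t : ℝ) ≤ 1 / 2 →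
      γ.trans δ s ≠ γ.trans δ t := by
    intro s t hs ht he
    rw [Path.trans_apply, Path.trans_apply, dif_pos hs, dif_neg ht] at he
    have hy := h ⟨⟨_, he⟩, mem_range_self _⟩
    rw [mem_singleton_iff] at hy
    have := congrArg Subtype.val (hδ (hy.trans δ.source.symm))
    simp only [Set.Icc.coe_zero] at this
    exact ht (by linarith)
  intro s t he
  by_cases hs : (s : ℝ) ≤ 1 / 2 <;> by_cases ht : (t : ℝ) ≤ 1 / 2
  · rw [Path.trans_apply, Path.trans_apply, dif_pos hs, dif_pos ht] at he
    have := congrArg Subtype.val (hγ he)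
    simp only at this
    exact Subtype.ext (by linarith)
  · exact absurd he (key s t hs ht)
  · exact absurd he.symm (key t s ht hs)
  · rw [Path.trans_apply, Path.trans_apply, dif_neg hs, dif_neg ht] at he
    have := congrArg Subtype.val (hδ he)
    simp only at this
    exact Subtype.ext (by linarith)

variable (Γ : PlaneDrawing G)

theorem mem_of_pos_mem_arc {e : Sym2 V} (he : e ∈ G.edgeSet) {w : V} (h : Γ.pos w ∈ Γ.arc e) :
    w ∈ e := by
  induction e using Sym2.ind with
  | _ a b =>
    rcases Γ.vertex_of_mem_arc a b w he h with rfl | rfl <;> simp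

theorem pos_mem_arc_left {u v : V} (h : G.Adj u v) : Γ.pos u ∈ Γ.arc s(u, v) := by
  obtain ⟨γ, -, hγ⟩ := Γ.isArc u v h
  exact hγ ▸ ⟨0, γ.source⟩

theorem mem_support_of_pos_mem_arc {a b w : V} {p : G.Walk a b} {e : Sym2 V} (he : e ∈ p.edges)
    (h : Γ.pos w ∈ Γ.arc e) : w ∈ p.support := by
  have hw := mem_of_pos_mem_arc Γ (p.edges_subset_edgeSet he) h
  induction e using Sym2.ind with
  | _ x y =>
    rw [Sym2.mem_iff] at hw
    rcases hw with rfl | rfl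
    · exact p.fst_mem_support_of_mem_edges he
    · exact p.snd_mem_support_of_mem_edges he

theorem exists_arc_of_isPath {a b : V} (p : G.Walk a b) (hp : p.IsPath) (hpos : 0 < p.length) :
    ∃ γ : Path (Γ.pos a) (Γ.pos b), Function.Injective γ ∧
      range γ = ⋃ e ∈ p.edgeSet, Γ.arc e := by
  induction p with
  | nil => simp at hpos
  | @cons u v w h q ih =>
    rw [Walk.cons_isPath_iff] at hp
    obtain ⟨γ, hγ, hr⟩ := Γ.isArc u v h
    have hedges : ∀ e, e ∈ (Walk.cons h q).edgeSet ↔ e = s(u, v) ∨ e ∈ q.edgeSet := fun e => by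
      change e ∈ (Walk.cons h q).edges ↔ _ ∨ e ∈ q.edges
      simp
    have hun : ⋃ e ∈ (Walk.cons h q).edgeSet, Γ.arc e = Γ.arc s(u, v) ∪ ⋃ e ∈ q.edgeSet, Γ.arc e := by
      ext z
      simp only [mem_iUnion, mem_union, exists_prop, hedges]
      constructor
      · rintro ⟨e, rfl | he, hz⟩
        · exact Or.inl hz
        · exact Or.inr ⟨e, he, hz⟩
      · rintro (hz | ⟨e, he, hz⟩)
        · exact ⟨_, Or.inl rfl, hz⟩
        · exact ⟨e, Or.inr he, hz⟩
    rw [hun]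
    rcases Nat.eq_zero_or_pos q.length with h0 | h0
    · have := Walk.eq_of_length_eq_zero h0
      subst this
      refine ⟨γ, hγ, ?_⟩
      have he : ∀ e, e ∉ q.edgeSet := by
        intro e he
        have h1 : e ∈ q.edges := he
        have h2 := List.length_pos_of_mem h1
        rw [Walk.length_edges] at h2
        omega
      simp [hr, he]
    · obtain ⟨δ, hδ, hr'⟩ := ih hp.1 h0
      refine ⟨γ.trans δ, trans_injective hγ hδ ?_, by rw [Path.trans_range, hr, hr']⟩
      rw [hr, hr']
      rintro z ⟨hz, hz'⟩
      simp only [mem_iUnion, exists_prop] at hz'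
      obtain ⟨e, he, hze⟩ := hz'
      have hne : s(u, v) ≠ e := by
        rintro rfl
        exact hp.2 (q.fst_mem_support_of_mem_edges he)
      obtain ⟨x, rfl⟩ := Γ.arc_inter_arc _ h _ (q.edges_subset_edgeSet he) hne ⟨hz, hze⟩
      rcases Γ.vertex_of_mem_arc u v x h hz with rfl | rfl
      · exact absurd (mem_support_of_pos_mem_arc Γ he hze) hp.2
      · rfl

/-! ### The drawing of the branch graph -/

/-- The union of the arcs of the edges of the link replaced by an edge of the branch graph. -/
def linkArc (C : Set V) (e : Sym2 {x // Branch G C x}) : Set ℂ :=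
  {z | ∃ (a b : {x // Branch G C x}) (h : (branchGraph G C).Adj a b),
    s(a, b) = e ∧ ∃ f ∈ (linkPath h).edges, z ∈ Γ.arc f}

theorem mem_linkArc [Finite V] (hG : Good G C) {a b : {x // Branch G C x}}
    (h : (branchGraph G C).Adj a b) {z : ℂ} :
    z ∈ linkArc Γ C s(a, b) ↔ ∃ f ∈ (linkPath h).edges, z ∈ Γ.arc f := by
  constructor
  · rintro ⟨a', b', h', he, f, hf, hz⟩
    rw [Sym2.eq_iff] at he
    rcases he with ⟨rfl, rfl⟩ | ⟨rfl, rfl⟩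
    · exact ⟨f, hf, hz⟩
    · rw [linkPath_symm hG h] at hf
      exact ⟨f, by simpa using hf, hz⟩
  · rintro ⟨f, hf, hz⟩
    exact ⟨a, b, h, rfl, f, hf, hz⟩

theorem linkArc_eq [Finite V] (hG : Good G C) {a b : {x // Branch G C x}}
    (h : (branchGraph G C).Adj a b) :
    linkArc Γ C s(a, b) = ⋃ e ∈ (linkPath h).edgeSet, Γ.arc e := by
  ext z
  rw [mem_linkArc Γ hG h]
  simp only [mem_iUnion, exists_prop]
  rfl

def branchDrawing [Finite V] (hG : Good G C) : PlaneDrawing (branchGraph G C) where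
  pos w := Γ.pos w.1
  arc := linkArc Γ C
  pos_injective := Γ.pos_injective.comp Subtype.val_injective
  isArc u v h := by
    rw [linkArc_eq Γ hG h]
    exact exists_arc_of_isPath Γ _ (isLink_linkPath h).isPath (isLink_linkPath h).pos
  vertex_of_mem_arc u v w h hw := by
    rw [mem_linkArc Γ hG h] at hw
    obtain ⟨f, hf, hz⟩ := hw
    exact eq_of_mem_linkPath h (mem_support_of_pos_mem_arc Γ hf hz)
  arc_inter_arc := by
    intro e he f hf hne z hz
    induction e using Sym2.ind with
    | _ a b =>
    induction f using Sym2.ind with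
    | _ a' b' =>
    rw [mem_inter_iff, mem_linkArc Γ hG he, mem_linkArc Γ hG hf] at hz
    obtain ⟨⟨e', he', hze⟩, f', hf', hzf⟩ := hz
    -- An edge on both links would have two branch ends, and these would be the ends of both links,
    -- making the links the same edge of the branch graph.
    by_cases hef : e' = f'
    · exfalso
      subst hef
      induction e' using Sym2.ind with
      | _ x y =>
      have hx := (linkPath he).fst_mem_support_of_mem_edges he'
      have hy := (linkPath he).snd_mem_support_of_mem_edges he'
      have hx' := (linkPath hf).fst_mem_support_of_mem_edges hf'
      have hy' := (linkPath hf).snd_mem_support_of_mem_edges hf'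
      have hbx := branch_of_mem_linkPaths hG he hf hne hx hx'
      have hby := branch_of_mem_linkPaths hG he hf hne hy hy'
      have hxy : (⟨x, hbx⟩ : {x // Branch G C x}) ≠ ⟨y, hby⟩ := fun h =>
        G.ne_of_adj ((linkPath he).adj_of_mem_edges he') (congrArg Subtype.val h)
      have h1 := eq_of_mem_linkPath he (w := ⟨x, hbx⟩) hx
      have h2 := eq_of_mem_linkPath he (w := ⟨y, hby⟩) hy
      have h3 := eq_of_mem_linkPath hf (w := ⟨x, hbx⟩) hx'
      have h4 := eq_of_mem_linkPath hf (w := ⟨y, hby⟩) hy'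
      refine hne (((Sym2.mem_and_mem_iff hxy).1 ⟨?_, ?_⟩).trans
        ((Sym2.mem_and_mem_iff hxy).1 ⟨?_, ?_⟩).symm)
      · exact Sym2.mem_iff.2 h1
      · exact Sym2.mem_iff.2 h2
      · exact Sym2.mem_iff.2 h3
      · exact Sym2.mem_iff.2 h4
    · obtain ⟨w, rfl⟩ := Γ.arc_inter_arc _ ((linkPath he).edges_subset_edgeSet he') _
        ((linkPath hf).edges_subset_edgeSet hf') hef ⟨hze, hzf⟩
      exact ⟨⟨w, branch_of_mem_linkPaths hG he hf hne (mem_support_of_pos_mem_arc Γ he' hze)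
        (mem_support_of_pos_mem_arc Γ hf' hzf)⟩, rfl⟩

/-- Every edge lies on a link and no vertex is isolated. Equal supports give equal outer faces,
hence the same external vertices. -/
theorem support_branchDrawing [Finite V] (hG : Good G C) (hsup : ∀ x, x ∈ G.support) :
    (branchDrawing Γ hG).support = Γ.support := by
  ext z
  constructor
  · rintro (⟨w, rfl⟩ | hz)
    · exact Or.inl ⟨w.1, rfl⟩
    · simp only [mem_iUnion, exists_prop] at hz
      obtain ⟨-, -, a, b, h, -, f, hf, hz⟩ := hz
      refine Or.inr ?_
      simp only [mem_iUnion, exists_prop]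
      exact ⟨f, (linkPath h).edges_subset_edgeSet hf, hz⟩
  · have key : ∀ x y, G.Adj x y → Γ.arc s(x, y) ⊆ (branchDrawing Γ hG).support := by
      intro x y hxy z hz
      obtain ⟨a, b, h, he⟩ := exists_linkPath hG hxy
      refine Or.inr ?_
      simp only [mem_iUnion, exists_prop]
      exact ⟨s(a, b), h, a, b, h, rfl, _, he, hz⟩
    rintro (⟨w, rfl⟩ | hz)
    · obtain ⟨y, hy⟩ := hsup w
      exact key w y hy (pos_mem_arc_left Γ hy)
    · simp only [mem_iUnion, exists_prop] at hz
      obtain ⟨f, hf, hz⟩ := hz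
      induction f using Sym2.ind with
      | _ x y => exact key x y hf hz

theorem external_branchDrawing [Finite V] (hG : Good G C) (hsup : ∀ x, x ∈ G.support)
    (w : {x // Branch G C x}) : (branchDrawing Γ hG).External w ↔ Γ.External w.1 := by
  unfold PlaneDrawing.External PlaneDrawing.outerFace
  rw [support_branchDrawing Γ hG hsup]
  rfl

theorem isSubdivisionOf_branchDrawing [Finite V] (hG : Good G C) (hsup : ∀ x, x ∈ G.support) :
    Γ.IsSubdivisionOf (branchDrawing Γ hG) := by
  refine ⟨Function.Embedding.subtype _, fun u v h => linkPath h,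
    fun u v h => (isLink_linkPath h).isPath, fun u v h => linkPath_symm hG h,
    fun u v h w hw => eq_of_mem_linkPath h hw, ?_, ?_, ?_, fun w => rfl,
    fun u v h => linkArc_eq Γ hG h⟩
  · intro u v h u' v' h' hne x hx hx'
    exact ⟨⟨x, branch_of_mem_linkPaths hG h h' hne hx hx'⟩, rfl⟩
  · intro x
    obtain ⟨y, hy⟩ := hsup x
    obtain ⟨a, b, h, he⟩ := exists_linkPath hG hy
    exact Or.inr ⟨a, b, h, (linkPath h).fst_mem_support_of_mem_edges he⟩
  · intro e he
    induction e using Sym2.ind with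
    | _ x y =>
      obtain ⟨a, b, h, he⟩ := exists_linkPath hG he
      exact ⟨a, b, h, he⟩

theorem isSubdivisionOfInternallyTriconnected [Finite V] {v : V} {c : G.Walk v v} (hc : c.IsCycle)
    (hG : Good G {x | x ∈ c.support}) (hsup : ∀ x, x ∈ G.support)
    (hext : ∀ x, Γ.External x ↔ x ∈ c.support) : Γ.IsSubdivisionOfInternallyTriconnected := by
  refine ⟨_, branchGraph G {x | x ∈ c.support}, branchDrawing Γ hG,
    ⟨isBiconnected_branchGraph hc hG hsup, isTriconnected_of_apex hc hG hsup _ ?_ ?_⟩,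
    isSubdivisionOf_branchDrawing Γ hG hsup⟩
  · exact fun a b => Iff.rfl
  · exact fun a => (external_branchDrawing Γ hG hsup a).trans (hext a.1)

end ConvexReduction

namespace ConvexReduction

open SimpleGraph

/-! ### Unbounded components of the complement of a compact set -/

/-- The union of the unbounded components of the complement of `K`. -/
def outerRegion (K : Set ℂ) : Set ℂ :=
  {z | z ∈ Kᶜ ∧ ¬ Bornology.IsBounded (connectedComponentIn Kᶜ z)}

/-- It is the image of a half-plane under the exponential map. -/
theorem isPreconnected_compl_closedBall {R : ℝ} (hR : 0 < R) :
    IsPreconnected (Metric.closedBall (0 : ℂ) R)ᶜ := by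
  have h : (Metric.closedBall (0 : ℂ) R)ᶜ = Complex.exp '' {w | Real.log R < w.re} := by
    ext z
    rw [mem_compl_iff, mem_closedBall_zero_iff, not_le, mem_image]
    constructor
    · intro hz
      have h0 : z ≠ 0 := norm_pos_iff.1 (hR.trans hz)
      refine ⟨Complex.log z, ?_, Complex.exp_log h0⟩
      change Real.log R < (Complex.log z).re
      rw [Complex.log_re]
      exact Real.log_lt_log hR hz
    · rintro ⟨w, hw, rfl⟩
      rw [Complex.norm_exp]
      exact (Real.log_lt_iff_lt_exp hR).1 hw
  rw [h]
  exact (convex_halfSpace_re_gt _).isPreconnected.image _ Complex.continuous_exp.continuousOn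

theorem not_isBounded_compl_closedBall (R : ℝ) :
    ¬ Bornology.IsBounded (Metric.closedBall (0 : ℂ) R)ᶜ := by
  intro h
  have := h.union (Metric.isBounded_closedBall (x := (0 : ℂ)) (r := R))
  rw [compl_union_self] at this
  exact NormedSpace.unbounded_univ ℝ ℂ this

theorem isOpen_outerRegion {K : Set ℂ} (hK : IsClosed K) : IsOpen (outerRegion K) := by
  rw [isOpen_iff_mem_nhds]
  intro z hz
  refine mem_of_superset ((hK.isOpen_compl.connectedComponentIn (x := z)).mem_nhds
    (mem_connectedComponentIn hz.1)) fun y hy => ⟨connectedComponentIn_subset _ _ hy, ?_⟩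
  rw [← connectedComponentIn_eq hy]
  exact hz.2

theorem mem_outerRegion_of_closure {K : Set ℂ} (hK : IsClosed K) {z : ℂ}
    (hz : z ∈ closure (outerRegion K)) (hzK : z ∉ K) : z ∈ outerRegion K := by
  obtain ⟨y, hy, hyF⟩ := mem_closure_iff.1 hz _ (hK.isOpen_compl.connectedComponentIn (x := z))
    (mem_connectedComponentIn hzK)
  refine ⟨hzK, ?_⟩
  rw [connectedComponentIn_eq hy]
  exact hyF.2

theorem subset_outerRegion {K H : Set ℂ} {z : ℂ} (hH : IsPreconnected H) (hHK : H ⊆ Kᶜ)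
    (hz : z ∈ H) (hzF : z ∈ outerRegion K) : H ⊆ outerRegion K := by
  intro y hy
  have := hH.subset_connectedComponentIn hz hHK hy
  refine ⟨hHK hy, ?_⟩
  rw [← connectedComponentIn_eq this]
  exact hzF.2

/-- The region outside a large disc is connected, so every unbounded component of the complement of
`K'` meets the outer region of `K`. That region is open, and relatively closed off `K'` by `h`, so
it contains the whole component. -/
theorem outerRegion_eq_of_subset {K K' : Set ℂ} (hK : IsCompact K) (hsub : K' ⊆ K)
    (h : closure (outerRegion K) ∩ K ⊆ K') : outerRegion K' = outerRegion K := by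
  apply Subset.antisymm
  · rintro z ⟨hzK, hzb⟩
    obtain ⟨R, hR0, hR⟩ := hK.isBounded.subset_closedBall_lt 0 0
    have hpre : IsPreconnected (connectedComponentIn K'ᶜ z) := isPreconnected_connectedComponentIn
    have hmeet : (connectedComponentIn K'ᶜ z ∩ outerRegion K).Nonempty := by
      have hns : ¬ connectedComponentIn K'ᶜ z ⊆ Metric.closedBall 0 R := fun hs =>
        hzb (Metric.isBounded_closedBall.subset hs)
      obtain ⟨y, hy, hyR⟩ := not_subset.1 hns
      have hyK : y ∈ Kᶜ := fun hyK => hyR (hR hyK)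
      refine ⟨y, hy, hyK, fun hb => not_isBounded_compl_closedBall R (hb.subset ?_)⟩
      exact (isPreconnected_compl_closedBall hR0).subset_connectedComponentIn hyR
        (compl_subset_compl.2 hR)
    refine hpre.subset_of_closure_inter_subset (isOpen_outerRegion hK.isClosed) hmeet ?_
      (mem_connectedComponentIn hzK)
    rintro y ⟨hy, hy'⟩
    refine mem_outerRegion_of_closure hK.isClosed hy fun hyK => ?_
    exact connectedComponentIn_subset _ _ hy' (h ⟨hy, hyK⟩)
  · rintro z ⟨hzK, hzb⟩
    exact ⟨fun hz => hzK (hsub hz), fun hb => hzb (hb.subset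
      (connectedComponentIn_mono z (compl_subset_compl.2 hsub)))⟩

/-! ### The boundary of the outer face of a straight-line drawing -/

variable {V : Type u} {G : SimpleGraph V} (Γ : PlaneDrawing G)

theorem isCompact_arc {e : Sym2 V} (he : e ∈ G.edgeSet) : IsCompact (Γ.arc e) := by
  induction e using Sym2.ind with
  | _ a b =>
    obtain ⟨γ, -, hγ⟩ := Γ.isArc a b he
    rw [← hγ]
    exact isCompact_range γ.continuous

theorem isCompact_support [Finite V] : IsCompact Γ.support := by
  have : Finite (Sym2 V) := Quot.finite _
  exact (finite_range _).isCompact.union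
    ((toFinite G.edgeSet).isCompact_biUnion fun e he => isCompact_arc Γ he)

theorem arc_subset_support {e : Sym2 V} (he : e ∈ G.edgeSet) : Γ.arc e ⊆ Γ.support :=
  fun _ hz => Or.inr (mem_biUnion he hz)

theorem isLinearMap_side (σ : ℝ) (d : ℂ) : IsLinearMap ℝ fun w : ℂ => σ * (w / d).im :=
  ⟨fun x y => by rw [add_div, Complex.add_im, mul_add], fun c x => by
    rw [Complex.real_smul, mul_div_assoc, Complex.im_ofReal_mul, smul_eq_mul]
    ring⟩

/-- If the outer region of `K` accumulates at a point near which `K` is contained in a line, then it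
accumulates at all nearby points of the line. -/
theorem line_subset_closure {K : Set ℂ} (hK : IsClosed K) {p d z : ℂ} (hd : d ≠ 0) {r : ℝ}
    (hr : 0 < r) (hline : ∀ w ∈ Metric.ball z r, w ∈ K → ((w - p) / d).im = 0)
    (hz : z ∈ closure (outerRegion K)) :
    ∀ w ∈ Metric.ball z r, ((w - p) / d).im = 0 → w ∈ closure (outerRegion K) := by
  obtain ⟨y₀, hy₀, hyF₀⟩ := mem_closure_iff.1 hz _ Metric.isOpen_ball (Metric.mem_ball_self hr)
  have hU : IsOpen (Metric.ball z r ∩ outerRegion K) :=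
    Metric.isOpen_ball.inter (isOpen_outerRegion hK)
  have him : ∀ (w : ℂ) (ε : ℝ), ((w + ε * (Complex.I * d) - p) / d).im = ((w - p) / d).im + ε := by
    intro w ε
    have : (w + ε * (Complex.I * d) - p) / d = (w - p) / d + ε * Complex.I := by
      field_simp
      ring
    rw [this]
    simp
  have hcont : ∀ w : ℂ, Continuous fun ε : ℝ => w + ε * (Complex.I * d) := fun w => by fun_prop
  -- A nearby point of the outer region is pushed off the line if necessary. The open half-disc on
  -- its side misses `K`, hence lies in the outer region, and its closure contains the line inside
  -- the disc.
  obtain ⟨y, hyB, hyF, hy0⟩ : ∃ y ∈ Metric.ball z r, y ∈ outerRegion K ∧ ((y - p) / d).im ≠ 0 := by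
    by_cases h0 : ((y₀ - p) / d).im = 0
    · have h1 : ∀ᶠ ε : ℝ in 𝓝 0, y₀ + ε * (Complex.I * d) ∈ Metric.ball z r ∩ outerRegion K :=
        (hcont y₀).continuousAt.eventually_mem (hU.mem_nhds (by simpa using ⟨hy₀, hyF₀⟩))
      obtain ⟨ε, ⟨hε1, hε2⟩, hε⟩ := ((h1.filter_mono nhdsWithin_le_nhds).and
        (self_mem_nhdsWithin (a := (0 : ℝ)) (s := Ioi 0))).exists
      refine ⟨_, hε1, hε2, ?_⟩
      rw [him, h0, zero_add]
      exact (ne_of_gt hε)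
    · exact ⟨y₀, hy₀, hyF₀, h0⟩
  set σ : ℝ := ((y - p) / d).im with hσ
  have hσ2 : 0 < σ * σ := mul_self_pos.2 hy0
  let H : Set ℂ := Metric.ball z r ∩ {w | σ * (p / d).im < σ * (w / d).im}
  have hHmem : ∀ w, w ∈ H ↔ w ∈ Metric.ball z r ∧ 0 < σ * ((w - p) / d).im := by
    intro w
    refine and_congr_right fun _ => ?_
    rw [sub_div, Complex.sub_im, mul_sub, sub_pos]
    rfl
  have hHF : H ⊆ outerRegion K := by
    refine subset_outerRegion (z := y) ((convex_ball z r).inter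
      (convex_halfSpace_gt (isLinearMap_side σ d) _)).isPreconnected ?_ ((hHmem y).2 ⟨hyB, hσ2⟩) hyF
    intro w hw hwK
    have h1 := (hHmem w).1 hw
    rw [hline w h1.1 hwK, mul_zero] at h1
    exact lt_irrefl _ h1.2
  intro w hw hw0
  refine closure_mono hHF ?_
  have h1 : Tendsto (fun ε : ℝ => w + (σ * ε : ℝ) * (Complex.I * d)) (𝓝[>] 0) (𝓝 w) := by
    have : Continuous fun ε : ℝ => w + (σ * ε : ℝ) * (Complex.I * d) := by fun_prop
    have h2 := this.tendsto 0
    simp only [mul_zero, Complex.ofReal_zero, zero_mul, add_zero] at h2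
    exact h2.mono_left nhdsWithin_le_nhds
  refine mem_closure_of_tendsto h1 ?_
  filter_upwards [h1.eventually_mem (Metric.isOpen_ball.mem_nhds hw), self_mem_nhdsWithin]
    with ε hε hpos
  refine (hHmem _).2 ⟨hε, ?_⟩
  rw [him, hw0, zero_add, ← mul_assoc]
  exact mul_pos hσ2 hpos

theorem isClosed_rest [Finite V] (e : Sym2 V) :
    IsClosed (range Γ.pos ∪ ⋃ f ∈ G.edgeSet \ {e}, Γ.arc f) := by
  have : Finite (Sym2 V) := Quot.finite _
  exact ((finite_range _).isCompact.union
    ((toFinite _).isCompact_biUnion fun f hf => isCompact_arc Γ hf.1)).isClosed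

/-- Near an inner point of a segment the drawing is contained in a line, so by `line_subset_closure`
the inner points on the boundary of the outer face form an open subset of the open segment. It is
also relatively closed, hence everything once nonempty. -/
theorem arc_subset_closure [Finite V] (hΓ : Γ.IsStraightLine) {u v : V} (h : G.Adj u v) {z : ℂ}
    (hz : z ∈ Γ.arc s(u, v)) (hzv : z ∉ range Γ.pos) (hzF : z ∈ closure Γ.outerFace) :
    Γ.arc s(u, v) ⊆ closure Γ.outerFace := by
  set p := Γ.pos u with hp
  set q := Γ.pos v with hq
  have hd : q - p ≠ 0 := sub_ne_zero.2 fun e => G.ne_of_adj h (Γ.pos_injective e).symm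
  let γ : ℝ → ℂ := fun t => p + t • (q - p)
  have hγ : Continuous γ := by fun_prop
  have harc : Γ.arc s(u, v) = γ '' Icc 0 1 := by
    rw [hΓ u v h, segment_eq_image']
  have him : ∀ t, ((γ t - p) / (q - p)).im = 0 := by
    intro t
    simp only [γ, add_sub_cancel_left, Complex.real_smul]
    rw [mul_div_cancel_right₀ _ hd, Complex.ofReal_im]
  have hinj : ∀ s t, γ s = γ t → s = t := by
    intro s t hst
    simp only [γ, add_right_inj, Complex.real_smul] at hst
    exact_mod_cast mul_right_cancel₀ hd hst
  have hint : ∀ t ∈ Ioo (0 : ℝ) 1, γ t ∉ range Γ.pos ∪ ⋃ f ∈ G.edgeSet \ {s(u, v)}, Γ.arc f := by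
    intro t ht
    have hta : γ t ∈ Γ.arc s(u, v) := harc ▸ ⟨t, Ioo_subset_Icc_self ht, rfl⟩
    have h1 : γ t ∉ range Γ.pos := by
      rintro ⟨w, hw⟩
      rcases Γ.vertex_of_mem_arc u v w h (hw ▸ hta) with rfl | rfl
      · have := hinj t 0 (hw.symm.trans (by simp [γ, hp]))
        exact ht.1.ne' this
      · have := hinj t 1 (hw.symm.trans (by simp [γ, hq]))
        exact ht.2.ne this
    rintro (h2 | h2)
    · exact h1 h2
    · simp only [mem_iUnion, exists_prop] at h2
      obtain ⟨f, hf, hzf⟩ := h2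
      exact h1 (Γ.arc_inter_arc _ h _ hf.1 (Ne.symm hf.2) ⟨hta, hzf⟩)
  let U : Set ℝ := {t | t ∈ Ioo (0 : ℝ) 1 ∧ γ t ∈ closure Γ.outerFace}
  have hU : IsOpen U := by
    rw [isOpen_iff_mem_nhds]
    rintro t ⟨ht, htF⟩
    obtain ⟨r, hr, hball⟩ := Metric.isOpen_iff.1 (isClosed_rest Γ s(u, v)).isOpen_compl _ (hint t ht)
    have hline := line_subset_closure (isCompact_support Γ).isClosed (p := p) hd hr (z := γ t) ?_ htF
    · filter_upwards [isOpen_Ioo.mem_nhds ht, hγ.continuousAt.eventually_mem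
        (Metric.ball_mem_nhds (γ t) hr)] with s hs hsB
      exact ⟨hs, hline _ hsB (him s)⟩
    · intro w hw hwK
      have hnw := hball hw
      rw [mem_compl_iff, mem_union, not_or] at hnw
      rcases hwK with hwK | hwK
      · exact absurd hwK hnw.1
      · simp only [mem_iUnion, exists_prop] at hwK hnw
        obtain ⟨f, hf, hwf⟩ := hwK
        by_cases he : f = s(u, v)
        · rw [he, harc] at hwf
          obtain ⟨s, -, rfl⟩ := hwf
          exact him s
        · exact absurd ⟨f, ⟨hf, he⟩, hwf⟩ hnw.2
  have hne : (Ioo (0 : ℝ) 1 ∩ U).Nonempty := by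
    rw [harc] at hz
    obtain ⟨t, ht, rfl⟩ := hz
    have ht' : t ∈ Ioo (0 : ℝ) 1 := by
      refine ⟨lt_of_le_of_ne ht.1 ?_, lt_of_le_of_ne ht.2 ?_⟩
      · rintro rfl
        exact hzv ⟨u, by simp [γ, hp]⟩
      · rintro rfl
        exact hzv ⟨v, by simp [γ, hq]⟩
    exact ⟨t, ht', ht', hzF⟩
  have hall : Ioo (0 : ℝ) 1 ⊆ U := by
    refine isPreconnected_Ioo.subset_of_closure_inter_subset hU hne ?_
    rintro t ⟨ht, ht'⟩
    refine ⟨ht', ?_⟩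
    have : closure U ⊆ γ ⁻¹' closure Γ.outerFace :=
      closure_minimal (fun s hs => hs.2) (isClosed_closure.preimage hγ)
    exact this ht
  rw [harc, ← closure_Ioo (zero_ne_one' ℝ)]
  refine (image_closure_subset_closure_image hγ).trans (closure_minimal ?_ isClosed_closure)
  rintro _ ⟨t, ht, rfl⟩
  exact (hall ht).2

/-- Every point of the drawing that touches the outer face is an external vertex or lies on an edge
wholly on the boundary, and so remains in `S`. -/
theorem outerFace_restrict [Finite V] (hΓ : Γ.IsStraightLine) {S : G.Subgraph}
    (hS : Γ.outerBoundary ≤ S) : (Γ.restrict S).outerFace = Γ.outerFace := by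
  refine outerRegion_eq_of_subset (isCompact_support Γ) ?_ ?_
  · rintro z (⟨w, rfl⟩ | hz)
    · exact Or.inl ⟨w.1, rfl⟩
    · simp only [mem_iUnion, exists_prop] at hz
      obtain ⟨e, he, hz⟩ := hz
      induction e using Sym2.ind with
      | _ a b => exact arc_subset_support Γ (S.adj_sub he) hz
  · rintro z ⟨hzF, hz⟩
    by_cases hzv : z ∈ range Γ.pos
    · obtain ⟨w, rfl⟩ := hzv
      exact Or.inl ⟨⟨w, hS.1 hzF⟩, rfl⟩
    · rcases hz with hz | hz
      · exact absurd hz hzv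
      · simp only [mem_iUnion, exists_prop] at hz
        obtain ⟨e, he, hz⟩ := hz
        induction e using Sym2.ind with
        | _ a b =>
          have hab : S.Adj a b := hS.2 ⟨he, arc_subset_closure Γ hΓ he hz hzv hzF⟩
          refine Or.inr ?_
          simp only [mem_iUnion, exists_prop]
          exact ⟨s(⟨a, S.edge_vert hab⟩, ⟨b, S.edge_vert hab.symm⟩), hab, hz⟩

theorem external_restrict [Finite V] (hΓ : Γ.IsStraightLine) {S : G.Subgraph}
    (hS : Γ.outerBoundary ≤ S) (x : S.verts) : (Γ.restrict S).External x ↔ Γ.External x.1 := by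
  unfold PlaneDrawing.External
  rw [outerFace_restrict Γ hΓ hS]
  rfl

end ConvexReduction

/-! ### From convex drawings to good graphs -/

namespace ConvexReduction

open SimpleGraph

variable {V : Type u} {G : SimpleGraph V} (Γ : PlaneDrawing G)

/-- The union of two opposite half-open half-planes is the punctured plane: this is the lower one. -/
def IsLower (z : ℂ) : Prop := z.im < 0 ∨ z.im = 0 ∧ z.re < 0

theorem arg_mem_of_not_isLower {z : ℂ} (h : ¬ IsLower z) :
    0 ≤ z.arg ∧ z.arg < Real.pi := by
  rw [IsLower, not_or, not_lt, not_and, not_lt] at h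
  refine ⟨Complex.arg_nonneg_iff.2 h.1, Complex.arg_lt_pi_iff.2 ?_⟩
  by_cases hi : z.im = 0
  · exact Or.inl (h.2 hi)
  · exact Or.inr hi

/-- Angles are computed from arguments measured relative to `d`. The range `(0, 2π]` of `angle` adds
a full turn when the difference is nonpositive. -/
theorem angle_eq {v a c : V} {d : ℂ} (hd : d ≠ 0) (ha : Γ.pos a ≠ Γ.pos v) (hc : Γ.pos c ≠ Γ.pos v)
    (hlt : ((Γ.pos a - Γ.pos v) / d).arg < ((Γ.pos c - Γ.pos v) / d).arg + 2 * Real.pi)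
    (hle : ((Γ.pos c - Γ.pos v) / d).arg ≤ ((Γ.pos a - Γ.pos v) / d).arg) :
    Γ.angle v a c =
      2 * Real.pi + (((Γ.pos c - Γ.pos v) / d).arg - ((Γ.pos a - Γ.pos v) / d).arg) := by
  have ha' := sub_ne_zero.2 ha
  have hc' := sub_ne_zero.2 hc
  have h1 : (Γ.pos c - Γ.pos v) / (Γ.pos a - Γ.pos v) =
      ((Γ.pos c - Γ.pos v) / d) / ((Γ.pos a - Γ.pos v) / d) := by
    field_simp
  have h2 := Complex.arg_div_coe_angle (div_ne_zero hc' hd) (div_ne_zero ha' hd)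
  rw [← h1, ← Real.Angle.coe_sub, Real.Angle.angle_eq_iff_two_pi_dvd_sub] at h2
  obtain ⟨k, hk⟩ := h2
  unfold PlaneDrawing.angle
  rw [toIocMod_eq_iff]
  refine ⟨⟨by linarith, by linarith⟩, k - 1, ?_⟩
  rw [zsmul_eq_mul]
  push_cast
  linarith

/-- All vertices other than `v` and all edges not incident to `v` form a closed set missing `v`, so
close to `v` only the incident segments could meet the ray. -/
theorem exists_ray [Finite V] (hΓ : Γ.IsStraightLine) {v : V} {e : ℂ} (he : e ≠ 0)
    (hray : ∀ c, G.Adj v c → ∀ t : ℝ, 0 < t → e ≠ t * (Γ.pos c - Γ.pos v)) :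
    ∃ δ > 0, ∀ ε : ℝ, 0 < ε → ε < δ → Γ.pos v + ε * e ∉ Γ.support := by
  have : Finite (Sym2 V) := Quot.finite _
  set K₀ : Set ℂ := Γ.pos '' {v}ᶜ ∪ ⋃ f ∈ {f ∈ G.edgeSet | v ∉ f}, Γ.arc f with hK₀
  have hclosed : IsClosed K₀ := (((toFinite ({v}ᶜ : Set V)).image _).isCompact.union
    ((toFinite _).isCompact_biUnion fun f hf => isCompact_arc Γ hf.1)).isClosed
  have hv : Γ.pos v ∈ K₀ᶜ := by
    rintro (⟨w, hw, h⟩ | h)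
    · exact hw (Γ.pos_injective h)
    · simp only [mem_iUnion, exists_prop] at h
      obtain ⟨f, hf, hz⟩ := h
      exact hf.2 (mem_of_pos_mem_arc Γ hf.1 hz)
  have hcont : Continuous fun ε : ℝ => Γ.pos v + ε * e := by fun_prop
  have hev : ∀ᶠ ε : ℝ in 𝓝 0, Γ.pos v + ε * e ∈ K₀ᶜ :=
    hcont.continuousAt.eventually_mem (hclosed.isOpen_compl.mem_nhds (by simpa using hv))
  obtain ⟨δ, hδ, hball⟩ := Metric.eventually_nhds_iff.1 hev
  refine ⟨δ, hδ, fun ε h0 hεδ hmem => ?_⟩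
  have hK := hball (y := ε) (by rw [Real.dist_eq, sub_zero, abs_of_pos h0]; exact hεδ)
  have hε : (ε : ℂ) ≠ 0 := by exact_mod_cast h0.ne'
  have hinc : ∀ c, G.Adj v c → Γ.pos v + ε * e ∉ Γ.arc s(v, c) := by
    intro c hvc hz
    rw [hΓ v c hvc, segment_eq_image'] at hz
    obtain ⟨t, ht, hz⟩ := hz
    simp only [add_right_inj, Complex.real_smul] at hz
    have ht0 : 0 < t := by
      refine lt_of_le_of_ne ht.1 ?_
      rintro rfl
      rw [Complex.ofReal_zero, zero_mul] at hz
      exact mul_ne_zero hε he hz.symm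
    refine hray c hvc (t / ε) (div_pos ht0 h0) ?_
    push_cast
    field_simp
    rw [mul_comm e, ← hz]
  rcases hmem with ⟨w, hw⟩ | hz
  · by_cases hwv : w = v
    · subst hwv
      rw [eq_comm, add_eq_left] at hw
      exact mul_ne_zero hε he hw
    · exact hK (Or.inl ⟨w, hwv, hw⟩)
  · simp only [mem_iUnion, exists_prop] at hz
    obtain ⟨f, hf, hz⟩ := hz
    by_cases hvf : v ∈ f
    · obtain ⟨c, rfl⟩ := hvf
      exact hinc c hf hz
    · refine hK (Or.inr ?_)
      simp only [mem_iUnion, exists_prop]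
      exact ⟨f, ⟨hf, hvf⟩, hz⟩

/-- In a convex drawing, every open half-plane bounded by a line through an internal vertex, together
with one half of that line, contains an edge of the vertex. -/
theorem exists_adj_isLower [Finite V] (hΓ : Γ.IsConvex) {v : V} (hv : ¬ Γ.External v)
    (hsup : v ∈ G.support) {d : ℂ} (hd : d ≠ 0) :
    ∃ c, G.Adj v c ∧ IsLower ((Γ.pos c - Γ.pos v) / d) := by
  by_contra! hc
  have hne : ∀ c, G.Adj v c → Γ.pos c ≠ Γ.pos v := fun c h e =>
    G.ne_of_adj h (Γ.pos_injective e).symm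
  set θ : V → ℝ := fun c => ((Γ.pos c - Γ.pos v) / d).arg with hθ
  have harg : ∀ c, G.Adj v c → 0 ≤ θ c ∧ θ c < Real.pi := fun c h =>
    arg_mem_of_not_isLower (hc c h)
  obtain ⟨x, hx⟩ := hsup
  -- Otherwise all edges at `v` have arguments in `[0, π)`. Counterclockwise from the largest to the
  -- smallest there is a corner with an angle above `π`, so by convexity its face is unbounded and
  -- `v` is external.
  obtain ⟨a, ha, hamax⟩ := (toFinite (G.neighborSet v)).exists_maximalFor θ _ ⟨x, hx⟩
  obtain ⟨b, hb, hbmin⟩ := (toFinite (G.neighborSet v)).exists_minimalFor θ _ ⟨x, hx⟩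
  have hamax' : ∀ c, G.Adj v c → θ c ≤ θ a := fun c h => by
    by_contra hlt
    exact hlt (hamax h (not_le.1 hlt).le)
  have hbmin' : ∀ c, G.Adj v c → θ b ≤ θ c := fun c h => by
    by_contra hlt
    exact hlt (hbmin h (not_le.1 hlt).le)
  have hpi := Real.pi_pos
  have hang : ∀ c, G.Adj v c → Γ.angle v a c = 2 * Real.pi + (θ c - θ a) := fun c h =>
    angle_eq Γ hd (hne a ha) (hne c h) (by have := harg a ha; have := harg c h; linarith)
      (hamax' c h)
  have hnext : Γ.NextCCW v a b := ⟨ha, hb, fun c h => by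
    rw [hang b hb, hang c h]
    have := hbmin' c h
    linarith⟩
  have hbig : Real.pi < Γ.angle v a b := by
    rw [hang b hb]
    have := harg a ha
    have := harg b hb
    linarith
  set e : ℂ := (Γ.pos a - Γ.pos v) * Complex.exp ((Γ.angle v a b / 2 : ℝ) * Complex.I) with he
  have he0 : e ≠ 0 := mul_ne_zero (sub_ne_zero.2 (hne a ha)) (Complex.exp_ne_zero _)
  -- The bisector of the corner is opposite to the direction of argument `(θ a + θ b) / 2`, so no
  -- edge at `v` runs along it.
  have hlow : IsLower (e / d) := by
    set w := (Γ.pos a - Γ.pos v) / d with hw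
    have hw0 : 0 < ‖w‖ := norm_pos_iff.2 (div_ne_zero (sub_ne_zero.2 (hne a ha)) hd)
    have hed : e / d = -(‖w‖ * Complex.exp (((θ a + θ b) / 2 : ℝ) * Complex.I)) := by
      have h1 : e / d = w * Complex.exp ((Γ.angle v a b / 2 : ℝ) * Complex.I) := by
        rw [he, hw]
        ring
      rw [h1, hang b hb, ← Complex.norm_mul_exp_arg_mul_I w, mul_assoc, ← Complex.exp_add,
        norm_mul, Complex.norm_exp_ofReal_mul_I, mul_one, Complex.norm_real, norm_norm,
        ← mul_neg, ← neg_one_mul, ← Complex.exp_pi_mul_I, ← Complex.exp_add]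
      congr 2
      have : w.arg = θ a := rfl
      rw [this]
      push_cast
      ring
    have him : (e / d).im = -(‖w‖ * Real.sin ((θ a + θ b) / 2)) := by
      rw [hed, Complex.neg_im, Complex.im_ofReal_mul, Complex.exp_ofReal_mul_I_im]
    have hre : (e / d).re = -(‖w‖ * Real.cos ((θ a + θ b) / 2)) := by
      rw [hed, Complex.neg_re, Complex.re_ofReal_mul, Complex.exp_ofReal_mul_I_re]
    have h1 := harg a ha
    have h2 := harg b hb
    rcases (show 0 ≤ (θ a + θ b) / 2 by linarith).eq_or_lt with h3 | h3
    · right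
      rw [him, hre, ← h3, Real.sin_zero, Real.cos_zero]
      constructor <;> linarith
    · left
      rw [him, neg_lt_zero]
      exact mul_pos hw0 (Real.sin_pos_of_pos_of_lt_pi h3 (by linarith))
  obtain ⟨δ, hδ, hray⟩ := exists_ray Γ hΓ.1 he0 (v := v) <| by
    rintro c hvc t ht h
    refine hc c hvc ?_
    rw [h, mul_div_assoc, IsLower, Complex.im_ofReal_mul, Complex.re_ofReal_mul] at hlow
    rcases hlow with h1 | ⟨h1, h2⟩
    · exact Or.inl ((pos_iff_neg_of_mul_neg h1).1 ht)
    · exact Or.inr ⟨(mul_eq_zero.1 h1).resolve_left ht.ne', (pos_iff_neg_of_mul_neg h2).1 ht⟩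
  have hcont : Continuous fun ε : ℝ => Γ.pos v + ε * e := by fun_prop
  set z₀ := Γ.pos v + (δ / 2 : ℝ) * e with hz₀
  have hz₀K : z₀ ∈ Γ.supportᶜ := hray _ (by linarith) (by linarith)
  set f := connectedComponentIn Γ.supportᶜ z₀ with hf
  have hsub : (fun ε : ℝ => Γ.pos v + ε * e) '' Ioo 0 δ ⊆ f := by
    refine (isPreconnected_Ioo.image _ hcont.continuousOn).subset_connectedComponentIn
      ⟨δ / 2, ⟨by linarith, by linarith⟩, rfl⟩ ?_
    rintro _ ⟨ε, hε, rfl⟩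
    exact hray ε hε.1 hε.2
  have hev : ∀ᶠ ε : ℝ in 𝓝[>] 0, Γ.pos v + ε * e ∈ f := by
    filter_upwards [Ioo_mem_nhdsGT hδ] with ε hε
    exact hsub ⟨ε, hε, rfl⟩
  have hconv := hΓ.2 f ⟨z₀, hz₀K, rfl⟩ v a b hnext hev
  have hunb : ¬ Bornology.IsBounded f := fun hb' => absurd (hconv.1 hb') (not_le.2 hbig)
  refine hv (mem_closure_of_tendsto (b := 𝓝[>] (0 : ℝ)) (f := fun ε : ℝ => Γ.pos v + ε * e) ?_ ?_)
  · have h2 := hcont.tendsto 0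
    simp only [Complex.ofReal_zero, zero_mul, add_zero] at h2
    exact h2.mono_left nhdsWithin_le_nhds
  · filter_upwards [hev] with ε hε
    refine ⟨connectedComponentIn_subset _ _ hε, ?_⟩
    rw [← connectedComponentIn_eq hε]
    exact hunb

/-- A set of internal vertices lies above the lexicographically least of its outer neighbors. -/
theorem exists_nbhd_le [Finite V] (hΓ : Γ.IsConvex) {A : Set V} (hne : A.Nonempty)
    (hA : A ⊆ G.support \ {x | Γ.External x}) {d : ℂ} (hd : d ≠ 0) :
    ∃ m ∈ nbhd G A, ∀ x ∈ A, (Γ.pos m / d).im ≤ (Γ.pos x / d).im ∧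
      ((Γ.pos m / d).im = (Γ.pos x / d).im → (Γ.pos m / d).re ≤ (Γ.pos x / d).re) := by
  obtain ⟨m, hm, hmin⟩ := (toFinite (A ∪ nbhd G A)).exists_minimalFor
    (fun x => toLex ((Γ.pos x / d).im, (Γ.pos x / d).re)) _ hne.inl
  have hmin' : ∀ x ∈ A ∪ nbhd G A, toLex ((Γ.pos m / d).im, (Γ.pos m / d).re) ≤
      toLex ((Γ.pos x / d).im, (Γ.pos x / d).re) := fun x hx => by
    by_contra hlt
    exact hlt (hmin hx (not_le.1 hlt).le)
  refine ⟨m, hm.resolve_left fun hmA => ?_, fun x hx => ?_⟩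
  -- If the minimum were in `A`, it would have a lexicographically smaller neighbor, still in the
  -- closure of `A`.
  · obtain ⟨c, hc, hlow⟩ := exists_adj_isLower Γ hΓ (hA hmA).2 (hA hmA).1 hd
    have h1 := hmin' c (nbhd_adj hmA hc)
    rw [Prod.Lex.toLex_le_toLex] at h1
    rw [IsLower, sub_div, Complex.sub_im, Complex.sub_re] at hlow
    simp only at h1
    rcases hlow with h2 | ⟨h2, h3⟩ <;> rcases h1 with h4 | ⟨h4, h5⟩ <;> linarith
  · have h1 := hmin' x (Or.inl hx)
    rw [Prod.Lex.toLex_le_toLex] at h1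
    simp only at h1
    rcases h1 with h1 | ⟨h1, h2⟩
    · exact ⟨h1.le, fun h => absurd h h1.ne⟩
    · exact ⟨h1.le, fun _ => h2⟩

/-- Apply `exists_nbhd_le` in opposite directions: a sole outer neighbor would coincide with every
vertex of the set, and two outer neighbors force the set onto the line through them. -/
theorem good_of_isConvex [Finite V] (hΓ : Γ.IsConvex) : Good G {x | Γ.External x} := by
  intro A hne hA
  have hcard : 2 ≤ (nbhd G A).ncard := by
    by_contra! hlt
    have hss : (nbhd G A).Subsingleton := ncard_le_one_iff_subsingleton.1 (by omega)
    obtain ⟨m, hm, h1⟩ := exists_nbhd_le Γ hΓ hne hA one_ne_zero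
    obtain ⟨m', hm', h2⟩ := exists_nbhd_le Γ hΓ hne hA (neg_ne_zero.2 one_ne_zero)
    obtain rfl := hss hm hm'
    obtain ⟨x, hx⟩ := hne
    have h1 := h1 x hx
    have h2 := h2 x hx
    simp only [div_one, div_neg, Complex.neg_im, Complex.neg_re, neg_le_neg_iff, neg_inj] at h1 h2
    have him : (Γ.pos m).im = (Γ.pos x).im := le_antisymm h1.1 h2.1
    have hre : (Γ.pos m).re = (Γ.pos x).re := le_antisymm (h1.2 him) (h2.2 him)
    have := Γ.pos_injective (Complex.ext hre him)
    exact hm.1 (this ▸ hx)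
  refine ⟨hcard, fun hle => ?_⟩
  obtain ⟨u, v, huv, hN⟩ := ncard_eq_two.1 (le_antisymm hle hcard)
  -- Dividing by `d` makes the line through the two outer neighbors horizontal; `g` is then the
  -- coordinate along it.
  set d := Γ.pos v - Γ.pos u with hd
  have hd0 : d ≠ 0 := sub_ne_zero.2 fun e => huv (Γ.pos_injective e).symm
  have hvu : (Γ.pos v / d).im = (Γ.pos u / d).im := by
    have : Γ.pos v / d = Γ.pos u / d + 1 := by
      field_simp
      rw [hd]
      ring
    rw [this]
    simp
  have hNim : ∀ m ∈ nbhd G A, (Γ.pos m / d).im = (Γ.pos u / d).im := by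
    rw [hN]
    rintro m (rfl | rfl)
    · rfl
    · exact hvu
  have him : ∀ x ∈ A ∪ nbhd G A, (Γ.pos x / d).im = (Γ.pos u / d).im := by
    rintro x (hx | hx)
    · obtain ⟨m, hm, h1⟩ := exists_nbhd_le Γ hΓ hne hA hd0
      obtain ⟨m', hm', h2⟩ := exists_nbhd_le Γ hΓ hne hA (neg_ne_zero.2 hd0)
      have h1 := (h1 x hx).1
      have h2 := (h2 x hx).1
      simp only [div_neg, Complex.neg_im, neg_le_neg_iff] at h2
      rw [hNim m hm] at h1
      rw [hNim m' hm'] at h2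
      exact le_antisymm h2 h1
    · exact hNim x hx
  set g : V → ℝ := fun x => (Γ.pos x / d).re with hg
  have hpos : ∀ x ∈ A ∪ nbhd G A, ∀ y ∈ A ∪ nbhd G A,
      Γ.pos y = Γ.pos x + ((g y - g x : ℝ) : ℂ) * d := by
    intro x hx y hy
    have h1 : Γ.pos y / d - Γ.pos x / d = ((g y - g x : ℝ) : ℂ) := by
      apply Complex.ext
      · simp [hg]
      · rw [Complex.sub_im, him x hx, him y hy, sub_self, Complex.ofReal_im]
    rw [← h1]
    field_simp
    ring
  have hginj : ∀ x ∈ A ∪ nbhd G A, ∀ y ∈ A ∪ nbhd G A, g x = g y → x = y := by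
    intro x hx y hy h
    have h1 := hpos x hx y hy
    rw [h, sub_self, Complex.ofReal_zero, zero_mul, add_zero] at h1
    exact (Γ.pos_injective h1).symm
  intro B hB hBne
  obtain ⟨x, hx, hxmax⟩ := (toFinite B).exists_maximalFor g _ hBne
  have hxmax' : ∀ y ∈ B, g y ≤ g x := fun y h => by
    by_contra hlt
    exact hlt (hxmax h (not_le.1 hlt).le)
  -- Both neighbors of the last vertex on the line lie on the same side of it, so the nearer one
  -- would be on the edge to the farther one.
  have key : ∀ y ∈ B, ∀ z ∈ B, G.Adj x y → G.Adj x z → g z < g y → False := by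
    intro y hy z hz hxy hxz hlt
    have hyx : g y < g x := lt_of_le_of_ne (hxmax' y hy) fun e =>
      G.ne_of_adj hxy (hginj y (hB hy) x (hB hx) e).symm
    have hmem : Γ.pos y ∈ Γ.arc s(x, z) := by
      rw [hΓ.1 x z hxz, segment_eq_image']
      have h1 : 0 < g x - g z := by linarith
      refine ⟨(g x - g y) / (g x - g z), ⟨div_nonneg (by linarith) h1.le,
        (div_le_one h1).2 (by linarith)⟩, ?_⟩
      simp only [Complex.real_smul]
      rw [hpos x (hB hx) y (hB hy), hpos x (hB hx) z (hB hz), add_sub_cancel_left, ← mul_assoc,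
        ← Complex.ofReal_mul]
      congr 3
      field_simp
      ring
    rcases Γ.vertex_of_mem_arc x z y hxz hmem with rfl | rfl
    · exact lt_irrefl _ hyx
    · exact lt_irrefl _ hlt
  refine ⟨x, hx, ?_⟩
  rintro y ⟨hy, hxy⟩ z ⟨hz, hxz⟩
  by_contra hyz
  rcases lt_or_gt_of_ne fun e => hyz (hginj y (hB hy) z (hB hz) e) with h | h
  · exact key z hz y hy hxz hxy h
  · exact key y hy z hz hxy hxz h

end ConvexReduction

/-! ### Back to subgraphs and plane drawings -/

namespace ConvexReduction

open SimpleGraph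

variable {V : Type u} {G S T Cg : SimpleGraph V} {C : Set V}

/-- The subgraph of `G` with the edges of `T` and their end-vertices. -/
def toSub (h : T ≤ G) : G.Subgraph where
  verts := T.support
  Adj := T.Adj
  adj_sub hxy := h hxy
  edge_vert hxy := ⟨_, hxy⟩
  symm := T.symm

theorem toSub_eq (hS : S ≤ G) (hT : T ≤ G) {E : Set (Sym2 V)} {D : Set V}
    (h : T = S.deleteEdges E) (hD : T.support = S.support \ D) :
    toSub hT = ((toSub hS).deleteVerts D).deleteEdges E := by
  ext x y
  · exact Set.ext_iff.1 hD x
  · rw [Subgraph.deleteEdges_adj, Subgraph.deleteVerts_adj]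
    change T.Adj x y ↔ (x ∈ S.support ∧ _ ∧ y ∈ S.support ∧ _ ∧ S.Adj x y) ∧ _
    constructor
    · intro hxy
      have hx : x ∈ S.support \ D := hD ▸ ⟨y, hxy⟩
      have hy : y ∈ S.support \ D := hD ▸ ⟨x, hxy.symm⟩
      rw [h, deleteEdges_adj] at hxy
      exact ⟨⟨hx.1, hx.2, hy.1, hy.2, hxy.1⟩, hxy.2⟩
    · rintro ⟨⟨-, -, -, -, h1⟩, h2⟩
      rw [h, deleteEdges_adj]
      exact ⟨h1, h2⟩

theorem edgeSet_mapLe (h : S ≤ G) {a b : V} (p : S.Walk a b) :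
    (p.mapLe h).edgeSet = p.edgeSet := by
  ext e
  change e ∈ (p.mapLe h).edges ↔ e ∈ p.edges
  simp

theorem interiorVerts_mapLe (h : S ≤ G) {a b : V} (p : S.Walk a b) :
    interiorVerts (p.mapLe h) = interiorVerts p := by
  ext x
  simp [interiorVerts]

theorem toSubgraph_mapLe_le (h : S ≤ G) {a b : V} (p : S.Walk a b) (ha : a ∈ S.support) :
    (p.mapLe h).toSubgraph ≤ toSub h := by
  constructor
  · intro x hx
    have hx' : x ∈ p.support := by simpa using hx
    rcases Nat.eq_zero_or_pos p.length with h0 | h0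
    · obtain ⟨i, hi, rfl⟩ := mem_support_iff.1 hx'
      obtain rfl : i = 0 := by omega
      rwa [Walk.getVert_zero]
    · exact support_subset_support h0 hx'
  · intro x y hxy
    have : s(x, y) ∈ (p.mapLe h).edges := by
      rwa [← Walk.mem_edges_toSubgraph, Subgraph.mem_edgeSet]
    exact p.adj_of_mem_edges (by simpa using this)

theorem outerBoundary_le_toSub (Γ : PlaneDrawing G) (hS : S ≤ G)
    (hsup : ∀ x, Γ.External x → x ∈ S.support)
    (hC : Γ.outerBoundary.spanningCoe ≤ S) : Γ.outerBoundary ≤ toSub hS :=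
  ⟨fun x hx => hsup x hx, fun _ _ hxy => hC hxy⟩

theorem isInternalOfDegree_toSub [Finite V] {Γ : PlaneDrawing G} (hΓ : Γ.IsStraightLine)
    (hS : S ≤ G) (hle : Γ.outerBoundary ≤ toSub hS) {x : V} (hx : x ∈ S.support)
    (hext : ¬ Γ.External x) {n : ℕ} (hn : (S.neighborSet x).ncard = n) :
    IsInternalOfDegree Γ (toSub hS) n x :=
  ⟨⟨hx, fun h => hext ((external_restrict Γ hΓ hle _).1 h)⟩, hn⟩

theorem PathStep.isPathDeletion [Finite V] {Γ : PlaneDrawing G} (hΓ : Γ.IsStraightLine)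
    (hS : S ≤ G) (hT : T ≤ G) (hle : Γ.outerBoundary ≤ toSub hS)
    (h : PathStep {x | Γ.External x} S T) : IsPathDeletion Γ (toSub hS) (toSub hT) := by
  obtain ⟨a, b, p, hp, h1, h2⟩ := h
  refine ⟨a, b, p.mapLe hS, hp.isPath.mapLe hS, by simpa using hp.pos,
    toSubgraph_mapLe_le hS p (support_subset_support hp.pos p.start_mem_support), ?_, ?_⟩
  · rw [interiorVerts_mapLe]
    intro x hx
    exact isInternalOfDegree_toSub hΓ hS hle (support_subset_support hp.pos hx.1)
      (hp.inner x hx).1 (hp.inner x hx).2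
  · rw [interiorVerts_mapLe, edgeSet_mapLe]
    exact toSub_eq hS hT h1 h2

theorem ClawStep.isThreePathDeletion [Finite V] {Γ : PlaneDrawing G} (hΓ : Γ.IsStraightLine)
    (hS : S ≤ G) (hT : T ≤ G) (hle : Γ.outerBoundary ≤ toSub hS)
    (h : ClawStep {x | Γ.External x} S T) : IsThreePathDeletion Γ (toSub hS) (toSub hT) := by
  obtain ⟨u, hu, huC, hdeg, w, p, hp, hdis, h1, h2⟩ := h
  refine ⟨u, isInternalOfDegree_toSub hΓ hS hle hu huC hdeg, w, fun i => (p i).mapLe hS,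
    fun i => ⟨(hp i).1.mapLe hS, toSubgraph_mapLe_le hS _ hu, (hp i).2.1, ?_⟩, ?_, ?_⟩
  · rw [interiorVerts_mapLe]
    intro x hx
    have hlen : 1 ≤ (p i).length := by
      rw [Nat.one_le_iff_ne_zero]
      intro h0
      exact huC (Walk.eq_of_length_eq_zero h0 ▸ (hp i).2.1)
    exact isInternalOfDegree_toSub hΓ hS hle (support_subset_support hlen hx.1)
      ((hp i).2.2 x hx).1 ((hp i).2.2 x hx).2
  · intro i j hij x hi hj
    exact hdis i j hij x (by simpa using hi) (by simpa using hj)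
  · simp only [interiorVerts_mapLe, edgeSet_mapLe]
    exact toSub_eq hS hT h1 h2

/-! ### Transfer to the subgraph as a graph -/

theorem nbhd_coe (hS : S ≤ G) (A : Set (toSub hS).verts) :
    Subtype.val '' nbhd (toSub hS).coe A = nbhd S (Subtype.val '' A) := by
  ext y
  constructor
  · rintro ⟨y, ⟨hy, x, hx, hxy⟩, rfl⟩
    refine ⟨?_, x, ⟨x, hx, rfl⟩, hxy⟩
    rintro ⟨z, hz, e⟩
    exact hy (Subtype.ext e ▸ hz)
  · rintro ⟨hy, _, ⟨x, hx, rfl⟩, hxy⟩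
    exact ⟨⟨y, x, hxy.symm⟩, ⟨fun h => hy ⟨_, h, rfl⟩, x, hx, hxy⟩, rfl⟩

theorem Good.coe (hG : Good S C) (hS : S ≤ G) :
    Good (toSub hS).coe {x | x.1 ∈ C} := by
  intro A hne hA
  have h := hG (Subtype.val '' A) (hne.image _) (by
    rintro _ ⟨x, hx, rfl⟩
    exact ⟨x.2, (hA hx).2⟩)
  rw [← nbhd_coe hS, ncard_image_of_injective _ Subtype.val_injective] at h
  refine ⟨h.1, fun hle B hB hBne => ?_⟩
  rw [← image_union] at h
  obtain ⟨_, ⟨x, hx, rfl⟩, hs⟩ := h.2 hle (Subtype.val '' B) (image_mono hB) (hBne.image _)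
  refine ⟨x, hx, ?_⟩
  rintro y ⟨hy, hxy⟩ z ⟨hz, hxz⟩
  exact Subtype.ext (hs ⟨⟨y, hy, rfl⟩, hxy⟩ ⟨⟨z, hz, rfl⟩, hxz⟩)

theorem exists_cycle_coe {H : G.Subgraph} {v : V} {c : G.Walk v v} (hc : c.IsCycle)
    (hle : c.toSubgraph ≤ H) : ∃ (w : H.verts) (c' : H.coe.Walk w w), c'.IsCycle ∧
      ∀ x, x ∈ c'.support ↔ x.1 ∈ c.support := by
  have hmap : (c.mapToSubgraph.map (Subgraph.inclusion hle)).map H.hom = c := by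
    rw [Walk.map_map]
    exact c.map_mapToSubgraph_hom
  refine ⟨_, c.mapToSubgraph.map (Subgraph.inclusion hle), ?_, fun x => ?_⟩
  · rw [← Walk.isCycle_map_iff_of_injective H.hom_injective, hmap]
    exact hc
  · have hs : c.support = (c.mapToSubgraph.map (Subgraph.inclusion hle)).support.map H.hom :=
      (congrArg Walk.support hmap.symm).trans (Walk.support_map _ _)
    rw [hs]
    exact (List.mem_map_of_injective H.hom_injective).symm

theorem isSubdivision_restrict [Finite V] {Γ : PlaneDrawing G} (hΓ : Γ.IsStraightLine)
    {v : V} {c : G.Walk v v} (hc : c.IsCycle) (hcO : c.toSubgraph = Γ.outerBoundary)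
    (hS : S ≤ G) (hle : Γ.outerBoundary ≤ toSub hS) (hgood : Good S {x | Γ.External x}) :
    (Γ.restrict (toSub hS)).IsSubdivisionOfInternallyTriconnected := by
  obtain ⟨w, c', hc', hsupp⟩ := exists_cycle_coe hc (hcO.trans_le hle)
  have hext : ∀ x, Γ.External x ↔ x ∈ c.support := fun x => by
    rw [← Walk.mem_verts_toSubgraph, hcO]
    rfl
  have hset : {x | x ∈ c'.support} = {x : (toSub hS).verts | x.1 ∈ {x | Γ.External x}} := by
    ext x
    exact (hsupp x).trans (hext x.1).symm
  refine isSubdivisionOfInternallyTriconnected _ hc' (hset ▸ hgood.coe hS) ?_ fun x => ?_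
  · rintro ⟨x, y, hxy⟩
    exact ⟨⟨y, x, hxy.symm⟩, hxy⟩
  · rw [external_restrict Γ hΓ hle, hext, hsupp]

/-! ### The reduction sequence -/

/-- Well-founded induction on the subgraph order, prepending `S` to the sequence of the smaller
graph given by `exists_step`. -/
theorem exists_sequence [Finite V] (hCs : Cg.support = C) (hS : Good S C) (hCg : Cg ≤ S) :
    ∃ (ℓ : ℕ) (F : Fin (ℓ + 1) → SimpleGraph V), F 0 = S ∧ F (Fin.last ℓ) = Cg ∧
      (∀ i, Cg ≤ F i ∧ F i ≤ S ∧ Good (F i) C) ∧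
      ∀ i : Fin ℓ, PathStep C (F i.castSucc) (F i.succ) ∨ ClawStep C (F i.castSucc) (F i.succ) := by
  induction S using WellFoundedLT.induction with
  | _ S ih =>
  by_cases hne : Cg = S
  · exact ⟨0, fun _ => S, rfl, hne.symm, fun _ => ⟨hCg, le_rfl, hS⟩, fun i => i.elim0⟩
  · obtain ⟨T, hCT, hTS, hT, hstep⟩ := exists_step hS hCg hCs hne
    obtain ⟨ℓ, F, h0, hl, hF, hs⟩ := ih T hTS hT hCT
    refine ⟨ℓ + 1, Fin.cons S F, rfl, ?_, fun i => ?_, fun i => ?_⟩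
    · rw [← Fin.succ_last, Fin.cons_succ]
      exact hl
    · refine Fin.cases ⟨hCg, le_rfl, hS⟩ (fun j => ?_) i
      rw [Fin.cons_succ]
      exact ⟨(hF j).1, (hF j).2.1.trans hTS.le, (hF j).2.2⟩
    · refine Fin.cases ?_ (fun j => ?_) i
      · rw [Fin.castSucc_zero, Fin.cons_zero, Fin.cons_succ, h0]
        exact hstep
      · rw [Fin.castSucc_succ, Fin.cons_succ, Fin.cons_succ]
        exact hs j

end ConvexReduction

open ConvexReduction

theorem mainTheorem4 {V : Type u} [Finite V] (G : SimpleGraph V) (hG : G.Connected)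
    (Γ : PlaneDrawing G) (hstraight : Γ.IsStraightLine)
    (houter : Γ.OuterFaceIsCycle)
    (hconvex : ∃ Γ' : PlaneDrawing G, Γ'.IsConvex ∧ Γ.Equivalent Γ') :
    ∃ (ℓ : ℕ) (S : Fin (ℓ + 1) → G.Subgraph),
      S 0 = ⊤ ∧
      S (Fin.last ℓ) = Γ.outerBoundary ∧
      (∀ i, (Γ.restrict (S i)).IsSubdivisionOfInternallyTriconnected) ∧
      (∀ i : Fin ℓ, IsPathDeletion Γ (S i.castSucc) (S i.succ) ∨
        IsThreePathDeletion Γ (S i.castSucc) (S i.succ)) := by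
  obtain ⟨Γ', hΓ', -, hout⟩ := hconvex
  obtain ⟨v, c, hc, hcO⟩ := houter
  -- `Good` depends only on the graph and its external vertices, so it carries over from the convex
  -- drawing.
  have hgood : Good G {x | Γ.External x} := by
    have : {x | Γ.External x} = {x | Γ'.External x} := congrArg SimpleGraph.Subgraph.verts hout
    rw [this]
    exact good_of_isConvex Γ' hΓ'
  have hsupp : Γ.outerBoundary.spanningCoe.support = {x | Γ.External x} := by
    ext x
    constructor
    · rintro ⟨y, hxy⟩
      exact Γ.outerBoundary.edge_vert hxy
    · intro hx
      have hxc : x ∈ c.support := by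
        rw [← SimpleGraph.Walk.mem_verts_toSubgraph, hcO]
        exact hx
      have h2 := hc.ncard_neighborSet_toSubgraph_eq_two hxc
      obtain ⟨y, z, -, he⟩ := ncard_eq_two.1 h2
      have hy : y ∈ c.toSubgraph.neighborSet x := he ▸ Or.inl rfl
      rw [hcO] at hy
      exact ⟨y, hy⟩
  obtain ⟨ℓ, F, h0, hl, hF, hs⟩ := exists_sequence hsupp hgood
    (SimpleGraph.Subgraph.spanningCoe_le _)
  have hFG : ∀ i, F i ≤ G := fun i => (hF i).2.1
  have hle : ∀ i, Γ.outerBoundary ≤ toSub (hFG i) := fun i => by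
    refine outerBoundary_le_toSub Γ (hFG i) (fun x hx => ?_) (hF i).1
    have hx' : x ∈ Γ.outerBoundary.spanningCoe.support := hsupp ▸ hx
    obtain ⟨y, hy⟩ := hx'
    exact ⟨y, (hF i).1 hy⟩
  refine ⟨ℓ, fun i => toSub (hFG i), ?_, ?_, fun i => isSubdivision_restrict hstraight hc hcO
    (hFG i) (hle i) (hF i).2.2, fun i => (hs i).imp
      (fun h => h.isPathDeletion hstraight (hFG _) (hFG _) (hle _))
      (fun h => h.isThreePathDeletion hstraight (hFG _) (hFG _) (hle _))⟩
  · ext x y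
    -- Only vertices in the support survive in `toSub`; none is lost, as `G` is connected with at
    -- least three vertices.
    · refine ⟨fun _ => trivial, fun _ => ?_⟩
      change x ∈ (F 0).support
      rw [h0]
      obtain ⟨f, hf, -⟩ := exists_three hc
      obtain ⟨y, hy⟩ : ∃ y, x ≠ y := by
        by_contra! hall
        exact absurd (hf ((hall (f 0)).symm.trans (hall (f 1)))) (by decide)
      obtain ⟨p⟩ := hG.preconnected x y
      refine support_subset_support (p := p) ?_ p.start_mem_support
      rw [Nat.one_le_iff_ne_zero]
      exact fun h => hy (SimpleGraph.Walk.eq_of_length_eq_zero h)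
    · change (F 0).Adj x y ↔ G.Adj x y
      rw [h0]
  · ext x y
    · change x ∈ (F (Fin.last ℓ)).support ↔ _
      rw [hl, hsupp]
      rfl
    · change (F (Fin.last ℓ)).Adj x y ↔ _
      rw [hl]
      rfl
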